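/- **Theorem (Smoothing).** Let $n\ge 1$, let $J$ be a finite set, and for each $j\in J$ let $M_j$ be a connected smooth $n$-dimensional manifold with (possibly empty) boundary (Hausdorff and second countable). Let $M=\coprod_{j\in J}M_j$ with $\partial M=\coprod_{j\in J}\partial M_j$. Let $H=(M,F,G,R)$ be a hybrid dynamical system: $F$ is a smooth vector field on $M$, the guard $G\subset\partial M$ is open in $\partial M$, and the reset map $R:G\to M$ is smooth. Suppose that $F$ is outward-pointing along $G$, that $\partial M=G\sqcup R(G)$ (disjoint union), that $R$ is a diffeomorphism from $G$ onto its image $R(G)$, and that $F$ is inward-pointing along $R(G)$. Then the topological quotient $\widetilde M$ of $M$ obtained by identifying each $x\in G$ with $R(x)$ may be endowed with the structure of a smooth $n$-dimensional manifold without boundary (Hausdorff and second countable, and inducing the quotient topology) such that, with $\pi:M\to\widetilde M$ the quotient projection: 1. for each $j\in J$ the restriction $\pi|_{M_j}:M_j\to\widetilde M$ is a smooth immersion, and it is a smooth embedding whenever $R$ maps no point of $G\cap M_j$ into $M_j$ itself; 2. there is a smooth vector field $\widetilde F$ on $\widetilde M$ such that every execution $x:T\to M$ of $H$ descends to an integral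 curve of $\widetilde F$: $\frac{d}{dt}(\pi\circ x)(t)=\widetilde F(\pi\circ x(t))$ for all $t\in T$. Here an execution is a right-continuous map $x:T\to M$ on an interval $T\subset\mathbb R$ such that at each $t\in T$ where $x$ is continuous, $x$ is differentiable with $\frac{d}{dt}x(t)=F(x(t))$, and at each $t\in T$ where $x$ is discontinuous, the limit $x(t^-)=\lim_{s\to t^-}x(s)$ exists, lies in $G$, and satisfies $R(x(t^-))=x(t)$. At an endpoint of $T$ belonging to $T$, continuity and derivatives are taken within $T$. -/

import Mathlib

open scoped Manifold ContDiff Topology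
open Set Filter

noncomputable section

/-! ### Hybrid manifolds: the disjoint union of a family of manifolds -/

/-- The disjoint union `Σ j, M j` of charted spaces over a non-empty `H`: the charts are those of
the pieces. -/
instance sigmaChartedSpace {ι H : Type*} [TopologicalSpace H] [Nonempty H] {M : ι → Type*}
    [∀ j, TopologicalSpace (M j)] [∀ j, ChartedSpace H (M j)] : ChartedSpace H (Σ j, M j) where
  atlas := {e | ∃ (j : ι) (f : OpenPartialHomeomorph (M j) H), f ∈ atlas H (M j) ∧
    e = f.lift_openEmbedding (Topology.IsOpenEmbedding.sigmaMk (i := j))}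
  chartAt p :=
    (chartAt H p.2).lift_openEmbedding (Topology.IsOpenEmbedding.sigmaMk (i := p.1))
  mem_chart_source p := ⟨p.2, mem_chart_source H p.2, rfl⟩
  chart_mem_atlas p := ⟨p.1, chartAt H p.2, chart_mem_atlas H p.2, rfl⟩

/-- The disjoint union of `C^r` manifolds is a `C^r` manifold. -/
instance sigmaIsManifold {ι : Type*} {E H : Type*} [NormedAddCommGroup E] [NormedSpace ℝ E]
    [TopologicalSpace H] [Nonempty H] {I : ModelWithCorners ℝ E H} {r : ℕ∞ω} {M : ι → Type*}
    [∀ j, TopologicalSpace (M j)] [∀ j, ChartedSpace H (M j)] [hM : ∀ j, IsManifold I r (M j)] :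
    IsManifold I r (Σ j, M j) where
  compatible {e} e' he he' := by
    obtain ⟨j, f, hf, rfl⟩ := he
    obtain ⟨k, f', hf', rfl⟩ := he'
    by_cases hjk : j = k
    · subst hjk
      rw [f.lift_openEmbedding_trans f' Topology.IsOpenEmbedding.sigmaMk]
      exact (hM j).compatible hf hf'
    · apply ContDiffGroupoid.mem_of_source_eq_empty
      ext x
      refine ⟨fun ⟨_, hx₂⟩ => ?_, fun hx => hx.elim⟩
      obtain ⟨y, _, hy⟩ := hx₂
      exact (hjk (congrArg Sigma.fst hy).symm).elim

/-! ### Inward- and outward-pointing tangent vectors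

In `EuclideanHalfSpace n` the distinguished (nonnegative) coordinate is the one with index `0`. -/

section Pointing

variable {n : ℕ} [NeZero n] {N : Type*} [TopologicalSpace N]
  [ChartedSpace (EuclideanHalfSpace n) N]

/-- The component, transverse to the boundary, of a tangent vector `v` at `x` read in a chart
`φ`. -/
def normalCoord (φ : OpenPartialHomeomorph N (EuclideanHalfSpace n)) (x : N)
    (v : TangentSpace (𝓡∂ n) x) : ℝ :=
  (show EuclideanSpace ℝ (Fin n) from
    mfderiv (𝓡∂ n) 𝓘(ℝ, EuclideanSpace ℝ (Fin n)) (φ.extend (𝓡∂ n)) x v) 0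

/-- `v` is inward-pointing at `x`: its transverse component is positive in every smooth chart
around `x`. Only used for boundary points `x`. -/
def IsInwardPointing (x : N) (v : TangentSpace (𝓡∂ n) x) : Prop :=
  ∀ φ ∈ IsManifold.maximalAtlas (𝓡∂ n) ∞ N, x ∈ φ.source → 0 < normalCoord φ x v

/-- `v` is outward-pointing at `x`: its transverse component is negative in every smooth chart
around `x`. Only used for boundary points `x`. -/
def IsOutwardPointing (x : N) (v : TangentSpace (𝓡∂ n) x) : Prop :=
  ∀ φ ∈ IsManifold.maximalAtlas (𝓡∂ n) ∞ N, x ∈ φ.source → normalCoord φ x v < 0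

end Pointing

/-! ### Hybrid dynamical systems -/

/-- A hybrid dynamical system `(M, F, G, R)` on the hybrid manifold `∐ j, M j` all of whose domains
`M j` are smooth `n`-dimensional manifolds with boundary. -/
structure HybridSystem (n : ℕ) [NeZero n] {J : Type*} (M : J → Type*)
    [∀ j, TopologicalSpace (M j)] [∀ j, ChartedSpace (EuclideanHalfSpace n) (M j)]
    [∀ j, IsManifold (𝓡∂ n) ∞ (M j)] where
  /-- the vector field -/
  F : (x : Σ j, M j) → TangentSpace (𝓡∂ n) x
  /-- the vector field is smooth, up to the boundary -/
  contMDiff_F : ContMDiff (𝓡∂ n) (𝓡∂ n).tangent ∞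
    (fun x => (⟨x, F x⟩ : TangentBundle (𝓡∂ n) (Σ j, M j)))
  /-- the guard -/
  G : Set (Σ j, M j)
  /-- the guard is an open subset of the boundary -/
  isOpen_G : ∃ U : Set (Σ j, M j), IsOpen U ∧ G = U ∩ (𝓡∂ n).boundary (Σ j, M j)
  /-- the reset map; only its values on the guard `G` are meaningful -/
  R : (Σ j, M j) → Σ j, M j
  /-- the reset map is smooth on the guard -/
  contMDiffOn_R : ContMDiffOn (𝓡∂ n) (𝓡∂ n) ∞ R G

namespace HybridSystem

variable {n : ℕ} [NeZero n] {J : Type*} {M : J → Type*}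
  [∀ j, TopologicalSpace (M j)] [∀ j, ChartedSpace (EuclideanHalfSpace n) (M j)]
  [∀ j, IsManifold (𝓡∂ n) ∞ (M j)]

/-- The reset map is a diffeomorphism from the guard `G` onto its image `R(G)`: it has a smooth
inverse on `R(G)`. -/
def IsResetDiffeo (H : HybridSystem n M) : Prop :=
  ∃ S : (Σ j, M j) → Σ j, M j,
    ContMDiffOn (𝓡∂ n) (𝓡∂ n) ∞ S (H.R '' H.G) ∧ ∀ x ∈ H.G, S (H.R x) = x

/-- An execution over the interval `T`: a right-continuous map which satisfies the differential
equation at its points of continuity and which, at its points of discontinuity, has a left limit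
that lies in the guard and is sent to the current point by the reset map. Values of `x` outside `T`
are irrelevant; all limits, continuity and derivatives are taken within `T`. -/
structure IsExecution (H : HybridSystem n M) (T : Set ℝ) (x : ℝ → Σ j, M j) : Prop where
  ordConnected : T.OrdConnected
  rightContinuous : ∀ t ∈ T, ContinuousWithinAt x (T ∩ Ici t) t
  flow : ∀ t ∈ T, ContinuousWithinAt x T t →
    HasMFDerivWithinAt 𝓘(ℝ, ℝ) (𝓡∂ n) x T t ((1 : ℝ →L[ℝ] ℝ).smulRight (H.F (x t)))
  jump : ∀ t ∈ T, ¬ ContinuousWithinAt x T t →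
    ∃ p ∈ H.G, Tendsto x (𝓝[T ∩ Iio t] t) (𝓝 p) ∧ H.R p = x t

/-- The relation that identifies each point of the guard with its image under the reset map. -/
def GluingRel (H : HybridSystem n M) (x y : Σ j, M j) : Prop :=
  (x ∈ H.G ∧ H.R x = y) ∨ (y ∈ H.G ∧ H.R y = x) ∨ x = y

/-- The quotient of `∐ j, M j` by the gluing of `G` to `R(G)`, with the quotient topology. -/
abbrev Glued (H : HybridSystem n M) : Type _ := Quot H.GluingRel

/-- The quotient projection. -/
def proj (H : HybridSystem n M) : (Σ j, M j) → H.Glued := Quot.mk H.GluingRel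

end HybridSystem

end

/-! Near a glued point the quotient consists of two half balls, one at `x ∈ G`, which the field
leaves, and one at `R x`, which it enters. Gluing them along their flat faces makes a topological
ball at once; the issue is smoothness, since a map that is smooth on either closed side need not be
smooth across the seam. The vector field decides how the sides fit together. It is transverse to the
boundary, so flow box coordinates turn it into `-v` near `x` and into `v` near `R x`, where `v` is
the inward unit normal. Correcting the second chart by the reset map, extended constantly along `v`,
makes the reset map read as the identity (`exists_isGluePair`). Reflecting the first half ball in
the hyperplane then yields a chart onto a ball in which the field is the constant `v`
(`exists_isGlueChart`).

A transition map `f` between two such charts carries `v` to `v`. Integrating along the normals gives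
`f u = f (P u) + l u • v` on both sides of the hyperplane `l = 0`, where `l` is the normal
coordinate and `P` the projection to the hyperplane. The right-hand side involves a single closed
side, so it is smooth across the seam (`IsFlowChart.apply_symm_eq`, `contDiffAt_of_mem_boundary`).
The glued field is constant in these charts, hence smooth. A projected execution is continuous at a
jump and has velocity `v` just before and just after it, hence also at it.

Two analytic tools enter. A flow box at a boundary point needs the field on a full neighbourhood, so
the field is extended across the boundary by Borel's lemma (`exists_contDiff_eqOn_halfSpace`). It
also needs a flow that is jointly smooth in time and initial point, which comes from the inverse
function theorem in a Banach space of curves (`exists_contDiffOn_flow`).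

For the topology, `G` and `R(G)` are both closed, so the projection is a closed map from a normal
space and the quotient is Hausdorff. Second countability follows from σ-compactness. -/

noncomputable section

/-! ### Extension by zero of functions that are flat along a hyperplane -/

section HalfSpaceExtension

universe u

variable {E F : Type u} [NormedAddCommGroup E] [NormedSpace ℝ E]
  [NormedAddCommGroup F] [NormedSpace ℝ F]

/-- The closed half-space on which a linear form is nonnegative. -/
def halfSpace (l : E →L[ℝ] ℝ) : Set E := {z | 0 ≤ l z}

/-- The directional derivative, within a set. -/
def dirDerivWithin (v : E) (s : Set E) (f : E → F) : E → F := fun z => fderivWithin ℝ f s z v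

lemma isClosed_halfSpace (l : E →L[ℝ] ℝ) : IsClosed (halfSpace l) :=
  isClosed_le continuous_const l.continuous

lemma halfSpace_mem_nhds {l : E →L[ℝ] ℝ} {z : E} (hz : 0 < l z) : halfSpace l ∈ 𝓝 z :=
  mem_of_superset ((isOpen_lt continuous_const l.continuous).mem_nhds hz)
    fun _ hw => le_of_lt (by simpa using hw)

lemma uniqueDiffOn_halfSpace {l : E →L[ℝ] ℝ} {v : E} (hv : l v = 1) :
    UniqueDiffOn ℝ (halfSpace l) := by
  refine uniqueDiffOn_convex ?_ ⟨v, mem_interior_iff_mem_nhds.2 (halfSpace_mem_nhds (by simp [hv]))⟩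
  intro x hx y hy a b ha hb _
  simp only [halfSpace, mem_ofPred_eq, map_add, map_smul, smul_eq_mul] at *
  positivity

lemma dirDerivWithin_congr {v : E} {s : Set E} {f g : E → F} (h : EqOn f g s) :
    EqOn (dirDerivWithin v s f) (dirDerivWithin v s g) s := by
  intro z hz
  simp only [dirDerivWithin, fderivWithin_congr h (h hz)]

lemma iterate_dirDerivWithin_congr {v : E} {s : Set E} {f g : E → F} (h : EqOn f g s) (k : ℕ) :
    EqOn ((dirDerivWithin v s)^[k] f) ((dirDerivWithin v s)^[k] g) s := by
  induction k generalizing f g with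
  | zero => exact h
  | succ k ih => exact ih (dirDerivWithin_congr h)

lemma ContDiffOn.dirDerivWithin {v : E} {s : Set E} {f : E → F} (hf : ContDiffOn ℝ ∞ f s)
    (hs : UniqueDiffOn ℝ s) : ContDiffOn ℝ ∞ (dirDerivWithin v s f) s :=
  (hf.fderivWithin hs (m := ∞) (by simp)).clm_apply contDiffOn_const

lemma ContDiffOn.iterate_dirDerivWithin {v : E} {s : Set E} {f : E → F} (hf : ContDiffOn ℝ ∞ f s)
    (hs : UniqueDiffOn ℝ s) (k : ℕ) : ContDiffOn ℝ ∞ ((_root_.dirDerivWithin v s)^[k] f) s := by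
  induction k generalizing f with
  | zero => exact hf
  | succ k ih => exact ih (hf.dirDerivWithin hs)

lemma iterate_dirDerivWithin_sub {v : E} {s : Set E} {f g : E → F} (hf : ContDiffOn ℝ ∞ f s)
    (hg : ContDiffOn ℝ ∞ g s) (hs : UniqueDiffOn ℝ s) (k : ℕ) :
    EqOn ((dirDerivWithin v s)^[k] (f - g))
      ((dirDerivWithin v s)^[k] f - (dirDerivWithin v s)^[k] g) s := by
  induction k generalizing f g with
  | zero => exact fun _ _ => rfl
  | succ k ih =>
    refine EqOn.trans ?_ (ih (hf.dirDerivWithin hs) (hg.dirDerivWithin hs))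
    refine iterate_dirDerivWithin_congr (fun z hz => ?_) k
    simp only [dirDerivWithin, Pi.sub_apply]
    rw [fderivWithin_sub (hs z hz) (hf.differentiableOn (by simp) z hz)
      (hg.differentiableOn (by simp) z hz)]
    rfl

lemma iterate_dirDerivWithin_of_contDiff {v : E} {s : Set E} {f : E → F} (hf : ContDiff ℝ ∞ f)
    (hs : UniqueDiffOn ℝ s) (k : ℕ) :
    EqOn ((dirDerivWithin v s)^[k] f) ((dirDerivWithin v univ)^[k] f) s := by
  induction k generalizing f with
  | zero => exact fun _ _ => rfl
  | succ k ih =>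
    refine EqOn.trans ?_ (ih (contDiffOn_univ.1 (hf.contDiffOn.dirDerivWithin uniqueDiffOn_univ)))
    refine iterate_dirDerivWithin_congr (fun z hz => ?_) k
    simp only [dirDerivWithin, fderivWithin_univ]
    rw [((hf.differentiable (by simp)) z).fderivWithin (hs z hz)]

/-- Second derivatives are symmetric, so differentiating along `v` commutes with the full
derivative. This lets flatness of `d` along the hyperplane pass to its derivative. -/
lemma iterate_dirDerivWithin_fderivWithin {l : E →L[ℝ] ℝ} {v : E} (hv : l v = 1) {d : E → F}
    (hd : ContDiffOn ℝ ∞ d (halfSpace l)) (k : ℕ) :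
    EqOn ((dirDerivWithin v (halfSpace l))^[k] (fderivWithin ℝ d (halfSpace l)))
      (fderivWithin ℝ ((dirDerivWithin v (halfSpace l))^[k] d) (halfSpace l)) (halfSpace l) := by
  have hs := uniqueDiffOn_halfSpace hv
  induction k generalizing d with
  | zero => exact fun _ _ => rfl
  | succ k ih =>
    refine EqOn.trans ?_ (ih (hd.dirDerivWithin hs))
    refine iterate_dirDerivWithin_congr (fun z hz => ?_) k
    ext u
    have hD := (hd.fderivWithin hs (m := ∞) (by simp)).differentiableOn (by simp) z hz
    have hsym : IsSymmSndFDerivWithinAt ℝ d (halfSpace l) z := by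
      refine (hd z hz).isSymmSndFDerivWithinAt (by simpa using WithTop.coe_le_coe.2 (le_top : (2 : ℕ∞) ≤ ⊤)) hs ?_ hz
      -- Symmetry at a boundary point requires it to be a limit of interior points; those are
      -- reached by moving along `v`.
      refine mem_closure_iff_seq_limit.2 ⟨fun m => z + (1 / ((m : ℝ) + 1)) • v, fun m => ?_, ?_⟩
      · refine mem_interior_iff_mem_nhds.2 (halfSpace_mem_nhds ?_)
        have : 0 ≤ l z := hz
        simp only [map_add, map_smul, hv, smul_eq_mul, mul_one]
        positivity
      · have := (tendsto_one_div_add_atTop_nhds_zero_nat (𝕜 := ℝ)).smul_const v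
        simpa using this.const_add z
    have h1 : fderivWithin ℝ (dirDerivWithin v (halfSpace l) d) (halfSpace l) z u
        = fderivWithin ℝ (fderivWithin ℝ d (halfSpace l)) (halfSpace l) z u v := by
      have := (hD.hasFDerivWithinAt.clm_apply (hasFDerivWithinAt_const v z _)).fderivWithin (hs z hz)
      unfold dirDerivWithin
      rw [this]
      simp
    rw [h1, hsym.eq]
    rfl

/-- Tangential derivatives vanish because `d` is zero on the hyperplane, the transverse one vanishes
by assumption, and `ker l` together with `v` spans the space. -/
lemma fderivWithin_halfSpace_eq_zero {l : E →L[ℝ] ℝ} {v : E} (hv : l v = 1) {d : E → F}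
    (hd : ContDiffOn ℝ ∞ d (halfSpace l)) (h0 : ∀ z, l z = 0 → d z = 0)
    (h1 : ∀ z, l z = 0 → dirDerivWithin v (halfSpace l) d z = 0) {z : E} (hz : l z = 0) :
    fderivWithin ℝ d (halfSpace l) z = 0 := by
  have hzS : z ∈ halfSpace l := hz.ge
  have hdz := (hd.differentiableOn (by simp) z hzS).hasFDerivWithinAt
  have key : ∀ u, l u = 0 → fderivWithin ℝ d (halfSpace l) z u = 0 := by
    intro u hu
    have hc : HasDerivAt (fun t : ℝ => z + t • u) u 0 := by
      simpa using ((hasDerivAt_id (0 : ℝ)).smul_const u).const_add z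
    have h2 := hdz.comp_hasDerivAt_of_eq (0 : ℝ) hc
      (Eventually.of_forall fun t => by simp [halfSpace, hz, hu]) (by simp)
    have h3 : d ∘ (fun t : ℝ => z + t • u) = fun _ => 0 := by
      ext t
      exact h0 _ (by simp [hz, hu])
    rw [h3] at h2
    exact h2.unique (hasDerivAt_const _ _)
  ext u
  have hu : u = (u - l u • v) + l u • v := by abel
  rw [hu, map_add, map_smul, key _ (by simp [hv]), h1 z hz |> fun h => show
    fderivWithin ℝ d (halfSpace l) z v = 0 from h]
  simp

/-- A function on a closed half-space all of whose derivatives transverse to the boundary vanish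
there extends by zero to a smooth function. -/
lemma contDiff_indicator_halfSpace {l : E →L[ℝ] ℝ} {v : E} (hv : l v = 1) {d : E → F}
    (hd : ContDiffOn ℝ ∞ d (halfSpace l))
    (h0 : ∀ k z, l z = 0 → ((dirDerivWithin v (halfSpace l))^[k] d) z = 0) :
    ContDiff ℝ ∞ ((halfSpace l).indicator d) := by
  have hs := uniqueDiffOn_halfSpace hv
  rw [contDiff_infty]
  intro k
  -- The derivative of the extension is the extension by zero of `fderivWithin ℝ d`, which takes
  -- values in `E →L[ℝ] F`. The target therefore changes at each step, and for this reason `E` and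
  -- `F` share a universe.
  induction k generalizing F with
  | zero =>
    rw [Nat.cast_zero, contDiff_zero]
    refine continuous_indicator (fun z hz => ?_) ?_
    · have hz' := frontier_le_subset_eq (continuous_const (y := (0 : ℝ))) l.continuous hz
      exact h0 0 z (Eq.symm hz')
    · rw [(isClosed_halfSpace l).closure_eq]
      exact hd.continuousOn
  | succ k ih =>
    rw [Nat.cast_succ, contDiff_succ_iff_hasFDerivAt]
    have hzero : ∀ k z, l z = 0 →
        fderivWithin ℝ ((dirDerivWithin v (halfSpace l))^[k] d) (halfSpace l) z = 0 :=
      fun k z hz => fderivWithin_halfSpace_eq_zero hv (hd.iterate_dirDerivWithin hs k) (h0 k)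
        (fun w hw => by
          have := h0 (k + 1) w hw
          rwa [Function.iterate_succ_apply'] at this) hz
    refine ⟨(halfSpace l).indicator (fderivWithin ℝ d (halfSpace l)),
      ih (hd.fderivWithin hs (m := ∞) (by simp)) (fun k z hz => ?_), fun z => ?_⟩
    · rw [iterate_dirDerivWithin_fderivWithin hv hd k (show z ∈ halfSpace l from hz.ge)]
      exact hzero k z hz
    · rcases lt_trichotomy (l z) 0 with hz | hz | hz
      · have hz' : z ∉ halfSpace l := not_le.2 hz
        rw [indicator_of_notMem hz']
        refine (hasFDerivAt_const (0 : F) z).congr_of_eventuallyEq ?_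
        filter_upwards [(isClosed_halfSpace l).isOpen_compl.mem_nhds hz'] with w hw
        exact indicator_of_notMem hw _
      · have hzS : z ∈ halfSpace l := hz.ge
        rw [indicator_of_mem hzS, show fderivWithin ℝ d (halfSpace l) z = 0 from hzero 0 z hz]
        -- On the hyperplane the derivative is zero within the half-space and within its complement,
        -- hence zero.
        have h1 : HasFDerivWithinAt ((halfSpace l).indicator d) (0 : E →L[ℝ] F) (halfSpace l) z := by
          have := (hd.differentiableOn (by simp) z hzS).hasFDerivWithinAt
          rw [show fderivWithin ℝ d (halfSpace l) z = 0 from hzero 0 z hz] at this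
          exact this.congr (fun w hw => indicator_of_mem hw d) (indicator_of_mem hzS d)
        have h2 : HasFDerivWithinAt ((halfSpace l).indicator d) (0 : E →L[ℝ] F) (halfSpace l)ᶜ z :=
          (hasFDerivWithinAt_const (0 : F) z _).congr (fun w hw => indicator_of_notMem hw d)
            (by rw [indicator_of_mem hzS]; exact h0 0 z hz)
        have := h1.union h2
        rwa [union_compl_self, hasFDerivWithinAt_univ] at this
      · have hzn := halfSpace_mem_nhds hz
        have hzS : z ∈ halfSpace l := hz.le
        rw [indicator_of_mem hzS]
        refine ((hd.differentiableOn (by simp) z hzS).hasFDerivWithinAt.hasFDerivAt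
          hzn).congr_of_eventuallyEq ?_
        filter_upwards [hzn] with w hw
        exact indicator_of_mem hw _

end HalfSpaceExtension

/-! ### Borel's lemma and smooth extension from a half-space -/

section BorelExtension

universe u

variable {E F : Type u} [NormedAddCommGroup E] [NormedSpace ℝ E]
  [NormedAddCommGroup F] [NormedSpace ℝ F]

lemma iterate_dirDerivWithin_univ_eq {g : E → F} (hg : ContDiff ℝ ∞ g) (v : E) (k : ℕ) (z : E) :
    (dirDerivWithin v univ)^[k] g z = iteratedFDeriv ℝ k g z fun _ => v := by
  induction k generalizing z with
  | zero => rfl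
  | succ k ih =>
    rw [Function.iterate_succ_apply', iteratedFDeriv_succ_apply_left]
    have h : (dirDerivWithin v univ)^[k] g = fun z => iteratedFDeriv ℝ k g z fun _ => v :=
      funext ih
    have hd : DifferentiableAt ℝ (iteratedFDeriv ℝ k g) z :=
      (hg.differentiable_iteratedFDeriv
        (WithTop.coe_lt_coe.2 (WithTop.coe_lt_top k))).differentiableAt
    have h2 := ((ContinuousMultilinearMap.apply ℝ (fun _ : Fin k => E) F
      (fun _ => v)).hasFDerivAt (x := iteratedFDeriv ℝ k g z)).comp z hd.hasFDerivAt
    rw [h, dirDerivWithin, fderivWithin_univ]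
    have h3 : (fun z => iteratedFDeriv ℝ k g z fun _ => v) =
      (ContinuousMultilinearMap.apply ℝ (fun _ : Fin k => E) F (fun _ => v)) ∘
        iteratedFDeriv ℝ k g := rfl
    rw [h3, h2.fderiv]
    rfl

/-- The factor `a` is constant along `v`, so only `θ ∘ l` gets differentiated, and `l` has slope one
along `v`. -/
lemma iterate_dirDerivWithin_smul_of_invariant {l : E →L[ℝ] ℝ} {v : E} (hv : l v = 1) {a : E → F}
    (ha : ContDiff ℝ ∞ a) (hinv : ∀ z (t : ℝ), a (z + t • v) = a z) (k : ℕ) {θ : ℝ → ℝ}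
    (hθ : ContDiff ℝ ∞ θ) :
    (dirDerivWithin v univ)^[k] (fun z => θ (l z) • a z) =
      fun z => iteratedDeriv k θ (l z) • a z := by
  induction k generalizing θ with
  | zero => simp
  | succ k ih =>
    have h1 : dirDerivWithin v univ (fun z => θ (l z) • a z) = fun z => deriv θ (l z) • a z := by
      ext z
      have hc : HasDerivAt (fun t : ℝ => z + t • v) v 0 := by
        simpa using ((hasDerivAt_id (0 : ℝ)).smul_const v).const_add z
      have hz : ∀ t : ℝ, l (z + t • v) = l z + t := by simp [hv]
      have hda : HasFDerivAt (fun z => θ (l z) • a z) (fderiv ℝ (fun z => θ (l z) • a z) z) z :=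
        (((hθ.comp l.contDiff).smul ha).differentiable (by simp) z).hasFDerivAt
      have h2 := hda.comp_hasDerivAt_of_eq (0 : ℝ) hc (by simp)
      have h3 : ((fun z => θ (l z) • a z) ∘ fun t : ℝ => z + t • v) =
          fun t => θ (l z + t) • a z := by
        ext t
        simp only [Function.comp_apply, hz, hinv]
      rw [h3] at h2
      have h4 : HasDerivAt (fun t => θ (l z + t) • a z) (deriv θ (l z) • a z) 0 := by
        have h5 : HasDerivAt θ (deriv θ (l z)) (l z + 0) := by
          simpa using (hθ.differentiable (by simp) (l z)).hasDerivAt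
        exact (h5.comp_const_add (l z) 0).smul_const (a z)
      rw [dirDerivWithin, fderivWithin_univ]
      exact h2.unique h4
    rw [Function.iterate_succ_apply, h1, ih ((contDiff_infty_iff_deriv.1 hθ).2), iteratedDeriv_succ']

lemma exists_bound_iteratedFDeriv {w : E → F} (hw : ContDiff ℝ ∞ w) (hc : HasCompactSupport w)
    (k : ℕ) : ∃ C, ∀ z, ‖iteratedFDeriv ℝ k w z‖ ≤ C :=
  (hc.iteratedFDeriv k).exists_bound_of_continuous (hw.continuous_iteratedFDeriv (by exact_mod_cast le_top))

/-- The dilation by the factor `c` along `v`, transversally to the kernel of `l`. -/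
def dilation (l : E →L[ℝ] ℝ) (v : E) (c : ℝ) : E →L[ℝ] E :=
  ContinuousLinearMap.id ℝ E + (c - 1) • l.smulRight v

lemma norm_dilation_le (l : E →L[ℝ] ℝ) (v : E) {c : ℝ} (hc : 1 ≤ c) :
    ‖dilation l v c‖ ≤ c * (1 + ‖l‖ * ‖v‖) := by
  have h1 : ‖(c - 1) • l.smulRight v‖ ≤ (c - 1) * (‖l‖ * ‖v‖) := by
    rw [norm_smul, Real.norm_of_nonneg (by linarith), ContinuousLinearMap.norm_smulRight_apply]
  have h2 := norm_add_le (ContinuousLinearMap.id ℝ E) ((c - 1) • l.smulRight v)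
  have h3 := ContinuousLinearMap.norm_id_le (𝕜 := ℝ) (E := E)
  have h4 : 0 ≤ ‖l‖ * ‖v‖ := by positivity
  unfold dilation
  nlinarith

/-- A `k`-th derivative of `w ∘ dilation l v c` is at most `C k * (c * K) ^ k`. Division by `c ^ j`
with `k < j` leaves at most `D / c`, so `c ≥ D * 2 ^ j` is enough. These bounds make the series in
Borel's lemma converge with all derivatives. -/
lemma exists_dilation_bound (l : E →L[ℝ] ℝ) (v : E) {w : E → F} (hw : ContDiff ℝ ∞ w)
    (hc : HasCompactSupport w) (j : ℕ) : ∃ c : ℝ, 1 ≤ c ∧ ∀ k < j, ∀ z,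
      ‖iteratedFDeriv ℝ k (fun z => (c ^ j)⁻¹ • w (dilation l v c z)) z‖ ≤ (1 / 2) ^ j := by
  choose C hC using exists_bound_iteratedFDeriv hw hc
  set K := 1 + ‖l‖ * ‖v‖ with hK
  have hK1 : 1 ≤ K := by
    have : 0 ≤ ‖l‖ * ‖v‖ := by positivity
    linarith
  have hC0 : ∀ k, 0 ≤ C k := fun k => (norm_nonneg _).trans (hC k 0)
  set D := ∑ k ∈ Finset.range j, C k * K ^ k with hD
  have hD0 : 0 ≤ D := Finset.sum_nonneg fun k _ => by have := hC0 k; positivity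
  refine ⟨max 1 (D * 2 ^ j), le_max_left _ _, fun k hk z => ?_⟩
  set c := max 1 (D * 2 ^ j)
  have hc1 : 1 ≤ c := le_max_left _ _
  have hc0 : 0 < c := by linarith
  have hsm : ContDiff ℝ ∞ (w ∘ dilation l v c) := hw.comp (dilation l v c).contDiff
  have h1 : iteratedFDeriv ℝ k (fun z => (c ^ j)⁻¹ • w (dilation l v c z)) z =
      (c ^ j)⁻¹ • iteratedFDeriv ℝ k (w ∘ dilation l v c) z :=
    iteratedFDeriv_const_smul_apply (f := w ∘ dilation l v c)
      (hsm.of_le (by exact_mod_cast le_top)).contDiffAt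
  rw [h1, (dilation l v c).iteratedFDeriv_comp_right hw z (by exact_mod_cast le_top), norm_smul,
    norm_inv, norm_pow, Real.norm_of_nonneg hc0.le]
  have h2 := (iteratedFDeriv ℝ k w (dilation l v c z)).norm_compContinuousLinearMap_le
    fun _ => dilation l v c
  have h3 : ‖dilation l v c‖ ^ k ≤ (c * K) ^ k :=
    pow_le_pow_left₀ (norm_nonneg _) (norm_dilation_le l v hc1) k
  have h4 : C k * K ^ k ≤ D :=
    Finset.single_le_sum (f := fun k => C k * K ^ k)
      (fun i _ => by have := hC0 i; positivity) (Finset.mem_range.2 hk)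
  have h5 : D * 2 ^ j ≤ c := le_max_right _ _
  rw [Finset.prod_const, Finset.card_univ, Fintype.card_fin] at h2
  have h6 : ‖(iteratedFDeriv ℝ k w (dilation l v c z)).compContinuousLinearMap
      fun _ => dilation l v c‖ ≤ D * c ^ k := by
    calc _ ≤ _ := h2
      _ ≤ C k * (c * K) ^ k := mul_le_mul (hC k _) h3 (by positivity) (hC0 k)
      _ = (C k * K ^ k) * c ^ k := by rw [mul_pow]; ring
      _ ≤ D * c ^ k := by gcongr
  have h7 : c ^ k * c ≤ c ^ j := by
    rw [← pow_succ]
    exact pow_le_pow_right₀ hc1 hk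
  rw [inv_mul_le_iff₀ (by positivity), one_div, inv_pow, ← div_eq_mul_inv,
    le_div_iff₀ (by positivity)]
  calc _ ≤ D * c ^ k * 2 ^ j := by gcongr
    _ = c ^ k * (D * 2 ^ j) := by ring
    _ ≤ c ^ k * c := by gcongr
    _ ≤ c ^ j := h7

/-- **Borel's lemma** with parameters: a smooth function with prescribed transverse derivatives
along a hyperplane. -/
lemma exists_contDiff_iterate_dirDeriv_eq [CompleteSpace F] {l : E →L[ℝ] ℝ} {v : E} (hv : l v = 1)
    {a : ℕ → E → F} (ha : ∀ j, ContDiff ℝ ∞ (a j)) (hinv : ∀ j z (t : ℝ), a j (z + t • v) = a j z)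
    {K : Set E} (hK : IsCompact K) (hsupp : ∀ j z, a j z ≠ 0 → z - l z • v ∈ K) :
    ∃ B : E → F, ContDiff ℝ ∞ B ∧
      ∀ j z, l z = 0 → (dirDerivWithin v univ)^[j] B z = a j z := by
  let χ : ContDiffBump (0 : ℝ) := ⟨1, 2, one_pos, one_lt_two⟩
  -- The `j`-th transverse Taylor monomial, cut off so as to have compact support.
  let w : ℕ → E → F := fun j z => ((l z) ^ j * (j.factorial : ℝ)⁻¹ * χ (l z)) • a j z
  have hw : ∀ j, ContDiff ℝ ∞ (w j) := fun j =>
    (((l.contDiff.pow j).mul contDiff_const).mul (χ.contDiff.comp l.contDiff)).smul (ha j)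
  have hwc : ∀ j, HasCompactSupport (w j) := by
    intro j
    refine HasCompactSupport.intro
      (K := (fun p : ℝ × E => p.2 + p.1 • v) '' (Metric.closedBall 0 2 ×ˢ K))
      (((isCompact_closedBall (0 : ℝ) 2).prod hK).image (by fun_prop)) fun z hz => ?_
    by_contra hne
    have h1 : a j z ≠ 0 := fun h => hne (by simp [w, h])
    have h2 : χ (l z) ≠ 0 := fun h => hne (by simp [w, h])
    refine hz ⟨(l z, z - l z • v), ⟨?_, hsupp j z h1⟩, by simp⟩
    by_contra h3
    refine h2 (χ.zero_of_le_dist ?_)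
    simp only [Metric.mem_closedBall, not_le] at h3
    exact h3.le
  choose c hc1 hcb using fun j => exists_dilation_bound l v (hw j) (hwc j) j
  have hlD : ∀ c z, l (dilation l v c z) = c * l z := by
    intro c z
    simp [dilation, hv]
    ring
  have hD : ∀ c z, dilation l v c z = z + ((c - 1) * l z) • v := by
    intro c z
    simp [dilation, mul_smul]
  let θ : ℕ → ℝ → ℝ := fun j s =>
    (c j ^ j)⁻¹ * ((c j * s) ^ j * (j.factorial : ℝ)⁻¹ * χ (c j * s))
  have hθ : ∀ j, ContDiff ℝ ∞ (θ j) := fun j =>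
    contDiff_const.mul ((((contDiff_const.mul contDiff_id).pow j).mul contDiff_const).mul
      (χ.contDiff.comp (contDiff_const.mul contDiff_id)))
  -- The factor `c j ^ j` produced by the dilation is divided out: near the hyperplane `T j` is
  -- still the exact Taylor monomial, only the cut-off has been squeezed.
  let T : ℕ → E → F := fun j z => (c j ^ j)⁻¹ • w j (dilation l v (c j) z)
  have hTθ : ∀ j, T j = fun z => θ j (l z) • a j z := by
    intro j
    ext z
    simp only [T, w, θ, hlD, smul_smul]
    rw [hD, hinv]
  have hT : ∀ j, ContDiff ℝ ∞ (T j) := fun j =>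
    contDiff_const.smul ((hw j).comp (dilation l v (c j)).contDiff)
  have hTc : ∀ j, HasCompactSupport (T j) := by
    intro j
    have hcj : 0 < c j := by linarith [hc1 j]
    have hinvD : ∀ z, dilation l v (c j)⁻¹ (dilation l v (c j) z) = z := by
      intro z
      rw [hD, hlD, hD, add_assoc, ← add_smul]
      have : (c j - 1) * l z + ((c j)⁻¹ - 1) * (c j * l z) = 0 := by field_simp; ring
      rw [this, zero_smul, add_zero]
    refine HasCompactSupport.intro (K := dilation l v (c j)⁻¹ '' tsupport (w j))
      (IsCompact.image (hwc j) (dilation l v (c j)⁻¹).continuous) fun z hz => ?_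
    have : dilation l v (c j) z ∉ tsupport (w j) := fun h => hz ⟨_, h, hinvD z⟩
    simp [T, image_eq_zero_of_notMem_tsupport this]
  choose C hC using fun k j => exists_bound_iteratedFDeriv (hT j) (hTc j) k
  -- The geometric bound holds only for `k < j`; the finitely many remaining terms are bounded by
  -- compactness of support, which does not affect summability.
  let u : ℕ → ℕ → ℝ := fun k j => if k < j then (1 / 2) ^ j else C k j
  have hu : ∀ k : ℕ, (k : ℕ∞) ≤ ⊤ → Summable (u k) := by
    intro k _
    refine (summable_geometric_of_lt_one (r := (1 / 2 : ℝ)) (by norm_num)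
      (by norm_num)).congr_cofinite ?_
    rw [Nat.cofinite_eq_atTop]
    filter_upwards [eventually_gt_atTop k] with j hj
    simp [u, hj]
  have hub : ∀ (k j : ℕ) (z : E), (k : ℕ∞) ≤ ⊤ → ‖iteratedFDeriv ℝ k (T j) z‖ ≤ u k j := by
    intro k j z _
    by_cases hkj : k < j
    · simp only [u, hkj, if_true]
      exact hcb j k hkj z
    · simp only [u, hkj, if_false]
      exact hC k j z
  have hB : ContDiff ℝ ∞ fun z => ∑' j, T j z :=
    contDiff_tsum (N := ⊤) hT hu fun k j z hk => hub k j z hk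
  refine ⟨_, hB, fun k z hz => ?_⟩
  rw [iterate_dirDerivWithin_univ_eq hB, iteratedFDeriv_tsum_apply (N := ⊤) hT hu hub le_top]
  have hsum : Summable fun j => iteratedFDeriv ℝ k (T j) z :=
    .of_norm_bounded (hu k le_top) fun j => hub k j z le_top
  have h1 := (ContinuousMultilinearMap.apply ℝ (fun _ : Fin k => E) F (fun _ => v)).map_tsum hsum
  simp only [ContinuousMultilinearMap.apply_apply] at h1
  rw [h1]
  -- Near `0` the function `θ j` is `s ^ j / j!`, so its `k`-th derivative at `0` is one for `j = k`
  -- and zero otherwise: only one term of the series survives.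
  have h2 : ∀ j, iteratedFDeriv ℝ k (T j) z (fun _ => v) = if j = k then a k z else 0 := by
    intro j
    rw [← iterate_dirDerivWithin_univ_eq (hT j), hTθ,
      iterate_dirDerivWithin_smul_of_invariant hv (ha j) (hinv j) k (hθ j)]
    have hcj : c j ≠ 0 := by linarith [hc1 j]
    have h3 : θ j =ᶠ[𝓝 0] fun s => (j.factorial : ℝ)⁻¹ * s ^ j := by
      have h4 : ∀ᶠ s in 𝓝 (0 : ℝ), c j * s ∈ Metric.ball (0 : ℝ) 1 := by
        have : Tendsto (fun s : ℝ => c j * s) (𝓝 0) (𝓝 0) := by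
          simpa using (continuous_const.mul continuous_id).tendsto (f := fun s : ℝ => c j * s) 0
        exact this (Metric.ball_mem_nhds _ one_pos)
      filter_upwards [h4] with s hs
      have : χ (c j * s) = 1 := χ.one_of_mem_closedBall (Metric.ball_subset_closedBall hs)
      simp only [θ, this, mul_pow]
      field_simp
    have h5 : iteratedDeriv k (θ j) 0 = if k = j then 1 else 0 := by
      rw [h3.iteratedDeriv_eq, iteratedDeriv_const_mul _ (contDiff_id.pow j).contDiffAt,
        iteratedDeriv_fun_pow_zero]
      split_ifs with h
      · field_simp
      · simp
    simp only [hz, h5]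
    by_cases hjk : j = k
    · subst hjk; simp
    · simp [hjk, Ne.symm hjk]
  simp only [h2, tsum_ite_eq]

/-- A smooth compactly supported function on a closed half-space extends to a smooth function on
the whole space. -/
lemma exists_contDiff_eqOn_halfSpace [CompleteSpace F] {l : E →L[ℝ] ℝ} {v : E} (hv : l v = 1)
    {f : E → F} (hf : ContDiffOn ℝ ∞ f (halfSpace l)) (hc : HasCompactSupport f) :
    ∃ g : E → F, ContDiff ℝ ∞ g ∧ EqOn g f (halfSpace l) := by
  have hs := uniqueDiffOn_halfSpace hv
  have hlP : ∀ z, l (z - l z • v) = 0 := fun z => by simp [hv]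
  have hmaps : ∀ z, z - l z • v ∈ halfSpace l := fun z => (hlP z).ge
  have hzero : ∀ k z, z ∉ tsupport f → (dirDerivWithin v (halfSpace l))^[k] f z = 0 := by
    intro k
    induction k with
    | zero => exact fun z hz => image_eq_zero_of_notMem_tsupport hz
    | succ k ih =>
      intro z hz
      rw [Function.iterate_succ_apply', dirDerivWithin]
      have h1 : (dirDerivWithin v (halfSpace l))^[k] f =ᶠ[𝓝[halfSpace l] z] fun _ => 0 := by
        refine Filter.Eventually.filter_mono nhdsWithin_le_nhds ?_
        filter_upwards [(isClosed_tsupport f).isOpen_compl.mem_nhds hz] with w hw using ih w hw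
      rw [h1.fderivWithin_eq (ih z hz)]
      simp
  -- The prescribed coefficients are the transverse derivatives of `f` at the projection to the
  -- hyperplane, hence constant along `v`.
  obtain ⟨B, hB, hBd⟩ := exists_contDiff_iterate_dirDeriv_eq hv
    (a := fun j z => (dirDerivWithin v (halfSpace l))^[j] f (z - l z • v))
    (fun j => (hf.iterate_dirDerivWithin hs j).comp_contDiff
      (contDiff_id.sub (l.contDiff.smul contDiff_const)) hmaps)
    (fun j z t => by simp [hv, add_smul])
    hc (fun j z h => by
      by_contra h'
      exact h (hzero j _ h'))
  -- All transverse derivatives of `f - B` vanish on the hyperplane, so its extension by zero is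
  -- smooth; adding `B` back restores `f` on the half-space.
  refine ⟨B + (halfSpace l).indicator (f - B), hB.add
    (contDiff_indicator_halfSpace hv (hf.sub hB.contDiffOn) fun k z hz => ?_), fun z hz => ?_⟩
  · have hzS : z ∈ halfSpace l := hz.ge
    rw [iterate_dirDerivWithin_sub hf hB.contDiffOn hs k hzS, Pi.sub_apply,
      iterate_dirDerivWithin_of_contDiff hB hs k hzS, hBd k z hz]
    simp [hz]
  · simp [hz]

end BorelExtension

/-! ### A smooth local inverse on a whole neighbourhood -/

section LocalInverse

variable {E F : Type*} [NormedAddCommGroup E] [NormedSpace ℝ E] [CompleteSpace E]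
  [NormedAddCommGroup F] [NormedSpace ℝ F]

/-- The inverse function theorem for smooth maps, on a neighbourhood. -/
lemma ContDiffOn.exists_openPartialHomeomorph {f : E → F} {U : Set E} (hf : ContDiffOn ℝ ∞ f U)
    (hU : IsOpen U) {a : E} (ha : a ∈ U) {f' : E ≃L[ℝ] F} (hf' : HasFDerivAt f (f' : E →L[ℝ] F) a) :
    ∃ e : OpenPartialHomeomorph E F, a ∈ e.source ∧ e.source ⊆ U ∧ (⇑e = f) ∧
      ContDiffOn ℝ ∞ e.symm e.target ∧
      ∀ x ∈ e.source, ∃ g : E ≃L[ℝ] F, HasFDerivAt f (g : E →L[ℝ] F) x := by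
  have hfa : ContDiffAt ℝ ∞ f a := hf.contDiffAt (hU.mem_nhds ha)
  let e₀ := hfa.toOpenPartialHomeomorph f hf' (by simp)
  -- Invertible operators form an open set, so the domain can be shrunk until the derivative is
  -- invertible throughout; the inverse is then smooth on its whole domain and not only at one
  -- point.
  let V : Set E := U ∩ fderiv ℝ f ⁻¹' range ContinuousLinearEquiv.toContinuousLinearMap
  have hV : IsOpen V := (hf.continuousOn_fderiv_of_isOpen hU (by simp)).isOpen_inter_preimage hU
    ContinuousLinearEquiv.isOpen
  have haV : a ∈ V := ⟨ha, f', by rw [hf'.fderiv]⟩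
  have hd : ∀ x ∈ V, ∃ g : E ≃L[ℝ] F, HasFDerivAt f (g : E →L[ℝ] F) x := by
    rintro x ⟨hx, g, hg⟩
    refine ⟨g, ?_⟩
    rw [hg]
    exact ((hf.contDiffAt (hU.mem_nhds hx)).differentiableAt (by simp)).hasFDerivAt
  have hsrc : ∀ x ∈ (e₀.restrOpen V hV).source, x ∈ V := fun x hx => hx.2
  refine ⟨e₀.restrOpen V hV, ⟨hfa.mem_toOpenPartialHomeomorph_source hf' (by simp), haV⟩,
    fun x hx => (hsrc x hx).1, rfl, fun y hy => ?_, fun x hx => hd x (hsrc x hx)⟩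
  have hx := (e₀.restrOpen V hV).map_target hy
  obtain ⟨g, hg⟩ := hd _ (hsrc _ hx)
  exact ((e₀.restrOpen V hV).contDiffAt_symm hy hg
    (hf.contDiffAt (hU.mem_nhds (hsrc _ hx).1))).contDiffWithinAt

end LocalInverse

/-! ### Postcomposition as a smooth map of spaces of curves -/

section Superposition

universe u

variable {K : Type*} [TopologicalSpace K] [CompactSpace K]
  {E F : Type u} [NormedAddCommGroup E] [NormedSpace ℝ E] [NormedAddCommGroup F] [NormedSpace ℝ F]

/-- The pointwise application of a continuous family of continuous linear maps. -/
def ContinuousMap.pointwiseApply : C(K, E →L[ℝ] F) →L[ℝ] C(K, E) →L[ℝ] C(K, F) :=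
  LinearMap.mkContinuous₂
    (LinearMap.mk₂ ℝ (fun (A : C(K, E →L[ℝ] F)) (a : C(K, E)) => (⟨fun t => A t (a t), by fun_prop⟩ : C(K, F)))
      (fun _ _ _ => by ext; simp) (fun _ _ _ => by ext; simp) (fun _ _ _ => by ext; simp)
      (fun _ _ _ => by ext; simp)) 1 fun A a => by
    rw [ContinuousMap.norm_le _ (by positivity)]
    intro t
    rw [one_mul]
    exact ((A t).le_opNorm _).trans (mul_le_mul (A.norm_coe_le_norm t) (a.norm_coe_le_norm t)
      (norm_nonneg _) (norm_nonneg A))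

@[simp] lemma ContinuousMap.pointwiseApply_apply (A : C(K, E →L[ℝ] F)) (a : C(K, E)) (t : K) :
    ContinuousMap.pointwiseApply A a t = A t (a t) := rfl

/-- Compactness of `K` makes `a ↦ fderiv ℝ f ∘ a` continuous for the sup norm, so the mean value
inequality on the segments from `a t` to `b t` is uniform in `t`. -/
lemma ContinuousMap.hasFDerivAt_comp {f : E → F} (hf : ContDiff ℝ ∞ f) (a : C(K, E)) :
    HasFDerivAt (fun a : C(K, E) => (⟨f, hf.continuous⟩ : C(E, F)).comp a)
      (ContinuousMap.pointwiseApply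
        ((⟨fderiv ℝ f, hf.continuous_fderiv (by simp)⟩ : C(E, E →L[ℝ] F)).comp a)) a := by
  refine .of_isLittleO (Asymptotics.isLittleO_iff.2 fun c hc => ?_)
  have hcont := (ContinuousMap.continuous_postcomp (X := K)
    (⟨fderiv ℝ f, hf.continuous_fderiv (by simp)⟩ : C(E, E →L[ℝ] F))).continuousAt (x := a)
  obtain ⟨δ, hδ, hball⟩ := (Metric.continuousAt_iff (α := C(K, E)) (β := C(K, E →L[ℝ] F))).1
    hcont c hc
  filter_upwards [Metric.ball_mem_nhds a hδ] with b hb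
  rw [ContinuousMap.norm_le _ (by positivity)]
  intro t
  have hseg : ∀ x ∈ segment ℝ (a t) (b t), ‖fderiv ℝ f x - fderiv ℝ f (a t)‖ ≤ c := by
    intro x hx
    rw [segment_eq_image'] at hx
    obtain ⟨θ, hθ, rfl⟩ := hx
    have h1 : a + θ • (b - a) ∈ Metric.ball a δ := by
      rw [mem_ball_iff_norm] at hb ⊢
      rw [add_sub_cancel_left, norm_smul, Real.norm_of_nonneg hθ.1]
      nlinarith [hθ.2, norm_nonneg (b - a)]
    have h2 := hball h1
    have h3 := (ContinuousMap.dist_apply_le_dist (f := ContinuousMap.comp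
      (⟨fderiv ℝ f, hf.continuous_fderiv (by simp)⟩ : C(E, E →L[ℝ] F)) (a + θ • (b - a)))
      (g := ContinuousMap.comp _ a) t).trans h2.le
    rw [dist_eq_norm] at h3
    exact h3
  have h3 := (convex_segment (a t) (b t)).norm_image_sub_le_of_norm_hasFDerivWithin_le'
    (fun x _ => ((hf.differentiable (by simp)) x).hasFDerivAt.hasFDerivWithinAt) hseg
    (left_mem_segment ℝ _ _) (right_mem_segment ℝ _ _)
  refine h3.trans ?_
  gcongr
  exact (b - a).norm_coe_le_norm t

/-- Postcomposition with a smooth map is a smooth map between spaces of continuous functions. -/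
lemma ContinuousMap.contDiff_comp {f : E → F} (hf : ContDiff ℝ ∞ f) :
    ContDiff ℝ ∞ (fun a : C(K, E) => (⟨f, hf.continuous⟩ : C(E, F)).comp a) := by
  rw [contDiff_infty]
  intro k
  -- The derivative is `pointwiseApply` after postcomposition with `fderiv ℝ f`, so the induction
  -- runs over all targets.
  induction k generalizing F with
  | zero => exact contDiff_zero.2 (ContinuousMap.continuous_postcomp _)
  | succ k ih =>
    rw [Nat.cast_succ, contDiff_succ_iff_hasFDerivAt]
    exact ⟨_, ContinuousMap.pointwiseApply.contDiff.comp
      (ih (hf.fderiv_right (m := ∞) (by simp))), hasFDerivAt_comp hf⟩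

end Superposition

/-! ### Smooth dependence of flows on time and initial point -/

section Flow

universe u

variable {E : Type u} [NormedAddCommGroup E] [NormedSpace ℝ E]

omit [NormedSpace ℝ E] in
lemma continuous_comp_projIcc (a : C(unitInterval, E)) :
    Continuous fun τ : ℝ => a (projIcc 0 1 zero_le_one τ) :=
  a.continuous.comp continuous_projIcc

/-- The primitive, vanishing at `0`, of a continuous function on the unit interval. -/
def primitiveCLM : C(unitInterval, E) →L[ℝ] C(unitInterval, E) :=
  LinearMap.mkContinuous
    { toFun := fun a => ⟨fun t => ∫ τ in (0 : ℝ)..t, a (projIcc 0 1 zero_le_one τ),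
        (intervalIntegral.continuous_primitive
          (fun x y => (continuous_comp_projIcc a).intervalIntegrable x y) 0).comp
            continuous_subtype_val⟩
      map_add' := fun a b => by
        ext t
        exact intervalIntegral.integral_add ((continuous_comp_projIcc a).intervalIntegrable _ _)
          ((continuous_comp_projIcc b).intervalIntegrable _ _)
      map_smul' := fun c a => by
        ext t
        exact intervalIntegral.integral_smul c _ }
    1 fun a => by
      rw [ContinuousMap.norm_le _ (by positivity)]
      intro t
      refine (intervalIntegral.norm_integral_le_of_norm_le_const
        (C := ‖a‖) fun τ _ => a.norm_coe_le_norm _).trans ?_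
      rw [one_mul, sub_zero, abs_of_nonneg t.2.1]
      exact mul_le_of_le_one_right (norm_nonneg _) t.2.2

/-- Constant functions, as a continuous linear map. -/
def constCLM : E →L[ℝ] C(unitInterval, E) :=
  LinearMap.mkContinuous
    { toFun := fun y => ContinuousMap.const _ y
      map_add' := fun _ _ => rfl
      map_smul' := fun _ _ => rfl } 1 fun y => by
      rw [ContinuousMap.norm_le _ (by positivity)]
      intro t
      rw [one_mul]
      exact le_rfl

@[simp] lemma constCLM_apply (y : E) (t : unitInterval) : constCLM y t = y := rfl

variable {W : E → E} (hW : ContDiff ℝ ∞ W)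

/-- The map whose zeros `(s, y, a)` in the last component are the integral curves `τ ↦ a (τ / s)`
of `W` starting at `y`. -/
def picardDefect (p : ℝ × E × C(unitInterval, E)) : ℝ × E × C(unitInterval, E) :=
  (p.1, p.2.1, p.2.2 - constCLM p.2.1 -
    p.1 • primitiveCLM ((⟨W, hW.continuous⟩ : C(E, E)).comp p.2.2))

lemma contDiff_picardDefect : ContDiff ℝ ∞ (picardDefect hW) := by
  have h2 : ContDiff ℝ ∞ fun p : ℝ × E × C(unitInterval, E) => p.2.2 := contDiff_snd.snd
  have h1 : ContDiff ℝ ∞ fun p : ℝ × E × C(unitInterval, E) => constCLM p.2.1 :=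
    (constCLM (E := E)).contDiff.comp (contDiff_fst.comp contDiff_snd)
  have h3 : ContDiff ℝ ∞ fun p : ℝ × E × C(unitInterval, E) =>
      primitiveCLM ((⟨W, hW.continuous⟩ : C(E, E)).comp p.2.2) :=
    (primitiveCLM (E := E)).contDiff.comp ((ContinuousMap.contDiff_comp hW).comp h2)
  exact contDiff_fst.prodMk (contDiff_snd.fst.prodMk ((h2.sub h1).sub (contDiff_fst.smul h3)))

lemma hasFDerivAt_picardDefect (p : ℝ × E × C(unitInterval, E)) :
    ∃ L : (ℝ × E × C(unitInterval, E)) →L[ℝ] (ℝ × E × C(unitInterval, E)),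
      HasFDerivAt (picardDefect hW) L p ∧
      ∀ q, L q = (q.1, q.2.1, q.2.2 - constCLM q.2.1 -
        (p.1 • primitiveCLM (ContinuousMap.pointwiseApply
          ((⟨fderiv ℝ W, hW.continuous_fderiv (by simp)⟩ : C(E, E →L[ℝ] E)).comp p.2.2) q.2.2) +
        q.1 • primitiveCLM ((⟨W, hW.continuous⟩ : C(E, E)).comp p.2.2))) := by
  have h2 : HasFDerivAt (fun p : ℝ × E × C(unitInterval, E) => p.2.2) _ p :=
    (hasFDerivAt_snd (𝕜 := ℝ) (p := p)).snd
  have h1 : HasFDerivAt (fun p : ℝ × E × C(unitInterval, E) => p.2.1) _ p :=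
    (hasFDerivAt_snd (𝕜 := ℝ) (p := p)).fst
  have h3 := primitiveCLM.hasFDerivAt.comp p ((ContinuousMap.hasFDerivAt_comp hW p.2.2).comp p h2)
  refine ⟨_, hasFDerivAt_fst.prodMk (h1.prodMk
    ((h2.sub (constCLM.hasFDerivAt.comp p h1)).sub (hasFDerivAt_fst.smul h3))), fun q => ?_⟩
  simp

/-- The derivative of `picardDefect` at time zero. -/
def picardDefectEquiv (c : C(unitInterval, E)) :
    (ℝ × E × C(unitInterval, E)) ≃L[ℝ] (ℝ × E × C(unitInterval, E)) :=
  ContinuousLinearEquiv.equivOfInverse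
    ((ContinuousLinearMap.fst ℝ _ _).prod (((ContinuousLinearMap.fst ℝ _ _).comp
      (ContinuousLinearMap.snd ℝ _ _)).prod
      ((ContinuousLinearMap.snd ℝ _ _).comp (ContinuousLinearMap.snd ℝ _ _) -
        constCLM.comp ((ContinuousLinearMap.fst ℝ _ _).comp (ContinuousLinearMap.snd ℝ _ _)) -
        (ContinuousLinearMap.fst ℝ _ _).smulRight c)))
    ((ContinuousLinearMap.fst ℝ _ _).prod (((ContinuousLinearMap.fst ℝ _ _).comp
      (ContinuousLinearMap.snd ℝ _ _)).prod
      ((ContinuousLinearMap.snd ℝ _ _).comp (ContinuousLinearMap.snd ℝ _ _) +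
        constCLM.comp ((ContinuousLinearMap.fst ℝ _ _).comp (ContinuousLinearMap.snd ℝ _ _)) +
        (ContinuousLinearMap.fst ℝ _ _).smulRight c)))
    (fun q => Prod.ext rfl (Prod.ext rfl (by simp; abel)))
    (fun q => Prod.ext rfl (Prod.ext rfl (by simp; abel)))

/-- Along a zero of `picardDefect`, the function `t ↦ t • W (a t)` solves the linearized
equation. -/
lemma picard_linearized_eq [CompleteSpace E] {s : ℝ} {y : E} {a : C(unitInterval, E)}
    (ha : a = constCLM y + s • primitiveCLM ((⟨W, hW.continuous⟩ : C(E, E)).comp a))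
    (w : C(unitInterval, E)) (hw : ∀ t, w t = (t : ℝ) • W (a t)) :
    w = s • primitiveCLM (ContinuousMap.pointwiseApply
          ((⟨fderiv ℝ W, hW.continuous_fderiv (by simp)⟩ : C(E, E →L[ℝ] E)).comp a) w) +
        primitiveCLM ((⟨W, hW.continuous⟩ : C(E, E)).comp a) := by
  set g : ℝ → E := fun τ => W (a (projIcc 0 1 zero_le_one τ)) with hg
  have hgc : Continuous g := hW.continuous.comp (continuous_comp_projIcc a)
  -- `A` extends `a` to a differentiable curve on the whole line, so that the derivative of `τ • W
  -- (A τ)` can be integrated; this derivative is the integrand of the linearized equation.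
  set A : ℝ → E := fun t => y + s • ∫ τ in (0 : ℝ)..t, g τ with hA
  have hAd : ∀ t, HasDerivAt A (s • g t) t := fun t =>
    ((intervalIntegral.integral_hasDerivAt_right (hgc.intervalIntegrable _ _)
      (hgc.stronglyMeasurableAtFilter _ _) hgc.continuousAt).const_smul s).const_add y
  have hAa : ∀ t : unitInterval, A t = a t := by
    intro t
    conv_rhs => rw [ha]
    rfl
  ext t
  have hint : ∀ τ ∈ uIcc (0 : ℝ) t, HasDerivAt (fun τ => τ • W (A τ))
      (s • (fderiv ℝ W (a (projIcc 0 1 zero_le_one τ)) (w (projIcc 0 1 zero_le_one τ))) + g τ)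
      τ := by
    intro τ hτ
    rw [uIcc_of_le t.2.1] at hτ
    have hτ1 : τ ∈ Icc (0 : ℝ) 1 := ⟨hτ.1, hτ.2.trans t.2.2⟩
    have hAτ : A τ = a (projIcc 0 1 zero_le_one τ) := by
      rw [projIcc_of_mem _ hτ1]
      exact hAa ⟨τ, hτ1⟩
    have h1 := ((hW.differentiable (by simp)) (A τ)).hasFDerivAt.comp_hasDerivAt τ (hAd τ)
    have h2 : HasDerivAt (fun τ => τ • W (A τ)) _ τ := (hasDerivAt_id τ).smul h1
    convert h2 using 1
    simp only [hw, hg, hAτ, map_smul, id_eq, projIcc_of_mem _ hτ1, one_smul]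
    rw [smul_comm]
  have hc1 : Continuous fun τ : ℝ => fderiv ℝ W (a (projIcc 0 1 zero_le_one τ))
      (w (projIcc 0 1 zero_le_one τ)) :=
    ((hW.continuous_fderiv (by simp)).comp (continuous_comp_projIcc a)).clm_apply
      (continuous_comp_projIcc w)
  have hc2 : Continuous fun τ : ℝ => s • fderiv ℝ W (a (projIcc 0 1 zero_le_one τ))
      (w (projIcc 0 1 zero_le_one τ)) := hc1.const_smul s
  have h3 := intervalIntegral.integral_eq_sub_of_hasDerivAt hint
    ((hc2.add hgc).intervalIntegrable _ _)
  rw [intervalIntegral.integral_add (hc2.intervalIntegrable _ _)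
    (hgc.intervalIntegrable _ _), intervalIntegral.integral_smul] at h3
  simp only [zero_smul, sub_zero, hAa, ← hw] at h3
  rw [← h3]
  rfl

/-- A smooth vector field has a local flow that depends smoothly on time and initial point. -/
theorem exists_contDiffOn_flow [CompleteSpace E] {W : E → E} (hW : ContDiff ℝ ∞ W) (u : E) :
    ∃ (fl : ℝ × E → E) (U : Set (ℝ × E)), IsOpen U ∧ (0, u) ∈ U ∧ ContDiffOn ℝ ∞ fl U ∧
      (∀ y, (0, y) ∈ U → fl (0, y) = y) ∧
      ∀ s y, (s, y) ∈ U → HasDerivAt (fun s => fl (s, y)) (W (fl (s, y))) s := by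
  -- At time zero the term with `fderiv ℝ W` drops out, so the derivative is triangular and
  -- invertible without any contraction estimate.
  have hder : HasFDerivAt (picardDefect hW)
      (picardDefectEquiv (primitiveCLM ((⟨W, hW.continuous⟩ : C(E, E)).comp (constCLM u))) :
        _ →L[ℝ] _) (0, u, constCLM u) := by
    obtain ⟨L, hL, hLq⟩ := hasFDerivAt_picardDefect hW (0, u, constCLM u)
    convert hL using 1
    refine ContinuousLinearMap.ext fun q => ?_
    simp [hLq, picardDefectEquiv]
  obtain ⟨e, hae, -, he, hes, hinv⟩ := (contDiff_picardDefect hW).contDiffOn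
    (s := univ) |>.exists_openPartialHomeomorph isOpen_univ (mem_univ _) hder
  -- Solving `picardDefect = (s, y, 0)` means finding the integral curve from `y`, rescaled from
  -- duration `s` to the unit interval.
  let ι : ℝ × E → ℝ × E × C(unitInterval, E) := fun p => (p.1, p.2, 0)
  have hι : ContDiff ℝ ∞ ι := contDiff_fst.prodMk (contDiff_snd.prodMk contDiff_const)
  have hp0 : ι (0, u) = e (0, u, constCLM u) := by simp [he, picardDefect, ι]
  have hsol : ∀ s y, ι (s, y) ∈ e.target → ∃ a : C(unitInterval, E),
      e.symm (ι (s, y)) = (s, y, a) ∧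
      a = constCLM y + s • primitiveCLM ((⟨W, hW.continuous⟩ : C(E, E)).comp a) := by
    intro s y h
    have h1 := e.right_inv h
    rw [he] at h1
    obtain ⟨h2, h3, h4⟩ : _ ∧ _ ∧ _ := by
      simpa only [picardDefect, ι, Prod.mk.injEq] using h1
    refine ⟨(e.symm (ι (s, y))).2.2, Prod.ext h2 (Prod.ext h3 rfl), ?_⟩
    rw [h2, h3, sub_sub, sub_eq_zero] at h4
    exact h4
  -- The flow at time `s` is the end point of the rescaled curve.
  let ev : C(unitInterval, E) →L[ℝ] E := ContinuousMap.evalCLM ℝ (1 : unitInterval)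
  have hcd : ContDiffOn ℝ ∞ (fun p => (e.symm (ι p)).2.2) (ι ⁻¹' e.target) :=
    (hes.comp hι.contDiffOn fun _ h => h).snd.snd
  refine ⟨fun p => ev (e.symm (ι p)).2.2, ι ⁻¹' e.target, e.open_target.preimage hι.continuous,
    ?_, ev.contDiff.comp_contDiffOn hcd, fun y hy => ?_, fun s y hy => ?_⟩
  · rw [mem_preimage, hp0]
    exact e.map_source hae
  · obtain ⟨a, h1, h2⟩ := hsol 0 y hy
    simp only [h1]
    rw [h2]
    simp [ev]
  · obtain ⟨a, h1, h2⟩ := hsol s y hy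
    have hopen : IsOpen (ι ⁻¹' e.target) := e.open_target.preimage hι.continuous
    have hd : HasFDerivAt (fun p => e.symm (ι p)) _ (s, y) := ((hes.comp hι.contDiffOn fun _ h => h).differentiableOn (by simp) (s, y)
      hy).differentiableAt (hopen.mem_nhds hy) |>.hasFDerivAt
    have hc : HasDerivAt (fun s : ℝ => (s, y)) ((1 : ℝ), (0 : E)) s :=
      (hasDerivAt_id s).prodMk (hasDerivAt_const s y)
    obtain ⟨D, hD⟩ : ∃ D, HasDerivAt (fun s => e.symm (ι (s, y))) D s :=
      ⟨_, HasFDerivAt.comp_hasDerivAt (l := fun p => e.symm (ι p)) s hd hc⟩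
    obtain ⟨L, hL, hLq⟩ := hasFDerivAt_picardDefect hW (s, y, a)
    rw [← h1] at hL
    -- Both the derivative `D` of the solution in `s` and the explicit `(1, 0, t ↦ t • W (a t))` are
    -- sent to `(1, 0, 0)` by the invertible `L`, so they agree. At `t = 1` this says that the flow
    -- has velocity `W`.
    have hLD : L D = (1, 0, 0) := by
      have h3 := hL.comp_hasDerivAt s hD
      have h4 : HasDerivAt (fun s : ℝ => ι (s, y)) ((1 : ℝ), (0 : E), (0 : C(unitInterval, E))) s :=
        (hasDerivAt_id s).prodMk ((hasDerivAt_const s y).prodMk (hasDerivAt_const s _))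
      refine h3.unique (h4.congr_of_eventuallyEq ?_)
      have : ∀ᶠ r in 𝓝 s, (r, y) ∈ ι ⁻¹' e.target :=
        hc.continuousAt.eventually_mem (hopen.mem_nhds hy)
      filter_upwards [this] with r hr
      rw [Function.comp_apply, ← he]
      exact e.right_inv hr
    let w : C(unitInterval, E) := ⟨fun t => (t : ℝ) • W (a t),
      continuous_subtype_val.smul (hW.continuous.comp a.continuous)⟩
    have hLw : L (1, 0, w) = (1, 0, 0) := by
      rw [hLq]
      have h3 := picard_linearized_eq hW h2 w fun t => rfl
      simp only [map_zero, sub_zero, one_smul, Prod.mk.injEq, true_and]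
      exact sub_eq_zero.2 h3
    have hx : e.symm (ι (s, y)) ∈ e.source := e.map_target hy
    obtain ⟨g, hg⟩ := hinv _ hx
    have hLg : L = g := hL.unique hg
    have hDw : D = (1, 0, w) := g.injective (by
      rw [hLg] at hLD hLw
      exact hLD.trans hLw.symm)
    have h5 : HasDerivAt (fun s => ev (e.symm (ι (s, y))).2.2) (ev w) s := by
      have := ev.hasFDerivAt.comp_hasDerivAt s hD.snd.snd
      rwa [hDw] at this
    convert h5 using 1
    simp only [h1]
    simp [ev, w]

end Flow

/-! ### Flow boxes at the boundary of a half-space -/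

section FlowBox

universe u

variable {E : Type u} [NormedAddCommGroup E] [NormedSpace ℝ E]

/-- A local diffeomorphism, in both directions smooth, that preserves a closed half-space and its
boundary. -/
structure IsHalfSpaceDiffeo (l : E →L[ℝ] ℝ) (e : OpenPartialHomeomorph E E) : Prop where
  contDiffOn : ContDiffOn ℝ ∞ e e.source
  contDiffOn_symm : ContDiffOn ℝ ∞ e.symm e.target
  nonneg_iff : ∀ z ∈ e.source, 0 ≤ l (e z) ↔ 0 ≤ l z
  eq_zero_iff : ∀ z ∈ e.source, l (e z) = 0 ↔ l z = 0

lemma IsHalfSpaceDiffeo.symm {l : E →L[ℝ] ℝ} {e : OpenPartialHomeomorph E E}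
    (h : IsHalfSpaceDiffeo l e) : IsHalfSpaceDiffeo l e.symm where
  contDiffOn := h.contDiffOn_symm
  contDiffOn_symm := h.contDiffOn
  nonneg_iff z hz := by
    have := h.nonneg_iff _ (e.map_target hz)
    rwa [e.right_inv hz, Iff.comm] at this
  eq_zero_iff z hz := by
    have := h.eq_zero_iff _ (e.map_target hz)
    rwa [e.right_inv hz, Iff.comm] at this

/-- The linear change of coordinates that fixes the kernel of `l` and sends `v` to `w`. -/
def shearEquiv {l : E →L[ℝ] ℝ} {v w : E} (hv : l v = 1) (hw : l w ≠ 0) : E ≃L[ℝ] E :=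
  ContinuousLinearEquiv.equivOfInverse
    (ContinuousLinearMap.id ℝ E + l.smulRight (w - v))
    (ContinuousLinearMap.id ℝ E + ((l w)⁻¹ • l).smulRight (v - w))
    (fun q => by
      simp only [add_apply, ContinuousLinearMap.id_apply,
        ContinuousLinearMap.smulRight_apply, smul_apply, map_add, map_smul,
        map_sub, hv, smul_eq_mul]
      match_scalars <;> field_simp <;> ring)
    (fun q => by
      simp only [add_apply, ContinuousLinearMap.id_apply,
        ContinuousLinearMap.smulRight_apply, smul_apply, map_add, map_smul,
        map_sub, hv, smul_eq_mul]
      match_scalars <;> field_simp <;> ring)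

lemma shearEquiv_apply {l : E →L[ℝ] ℝ} {v w : E} (hv : l v = 1) (hw : l w ≠ 0) (q : E) :
    shearEquiv hv hw q = (q - l q • v) + l q • w := by
  change q + l q • (w - v) = _
  module

/-- Bounding the component along `v` and the component in `ker l` separately yields a neighbourhood
that contains, with each point, the normal segment down to the hyperplane. -/
lemma exists_slab_subset {l : E →L[ℝ] ℝ} {v : E} {N : Set E} (hN : N ∈ 𝓝 (0 : E)) :
    ∃ δ > 0, ∀ z : E, ‖z - l z • v‖ < δ → |l z| < δ → z ∈ N := by
  have hc : ContinuousAt (fun p : E × ℝ => p.1 + p.2 • v) (0, 0) := by fun_prop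
  obtain ⟨δ, hδ, h⟩ := Metric.continuousAt_iff.1 hc _ (Metric.mem_nhds_iff.1 hN).choose_spec.1
  refine ⟨δ, hδ, fun z h1 h2 => (Metric.mem_nhds_iff.1 hN).choose_spec.2 ?_⟩
  have := @h (z - l z • v, l z) (by
    rw [Prod.dist_eq, max_lt_iff, dist_zero_right, dist_zero_right]
    exact ⟨h1, h2⟩)
  simpa using this

/-- **Flow box theorem** at a point of the boundary of a half-space, for a vector field pointing
into the half-space. -/
theorem exists_flowBox [CompleteSpace E] {l : E →L[ℝ] ℝ} {v : E} (hv : l v = 1) {W : E → E}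
    (hW : ContDiff ℝ ∞ W) {u : E} (hu : l u = 0) (hWu : 0 < l (W u)) :
    ∃ e : OpenPartialHomeomorph E E, IsHalfSpaceDiffeo l e ∧ u ∈ e.source ∧ e u = 0 ∧
      ∀ z ∈ e.source, ∃ L : E →L[ℝ] E, HasFDerivAt e L z ∧ L (W z) = v := by
  obtain ⟨fl, U, hU, h0U, hfl, hfl0, hflow⟩ := exists_contDiffOn_flow hW u
  -- `Θ = fl ∘ κ` starts at `u` plus the tangential part of `z` and flows for the time `l z`. It
  -- carries lines parallel to `v` to integral curves, and the required chart is its inverse.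
  let κ : E → ℝ × E := fun z => (l z, u + (z - l z • v))
  have hκ : ContDiff ℝ ∞ κ := by
    refine l.contDiff.prodMk (contDiff_const.add (contDiff_id.sub (l.contDiff.smul contDiff_const)))
  have hκ0 : κ 0 = (0, u) := by simp [κ]
  have hlP : ∀ z, l (z - l z • v) = 0 := fun z => by simp [hv]
  have hκv : ∀ z (t : ℝ), κ (z + t • v) = (l z + t, u + (z - l z • v)) := by
    intro z t
    simp [κ, hv, add_smul]
  let Θ : E → E := fl ∘ κ
  have hUκ : IsOpen (κ ⁻¹' U) := hU.preimage hκ.continuous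
  have hΘ : ContDiffOn ℝ ∞ Θ (κ ⁻¹' U) := hfl.comp hκ.contDiffOn fun _ h => h
  have h0κ : (0 : E) ∈ κ ⁻¹' U := by rw [mem_preimage, hκ0]; exact h0U
  have hΘP : ∀ z, l z = 0 → κ z ∈ U → Θ z = u + z := by
    intro z hz hzU
    have h1 : κ z = (0, u + z) := by simp [κ, hz]
    rw [h1] at hzU
    simp only [Θ, Function.comp_apply, h1]
    exact hfl0 _ hzU
  have hΘ0 : Θ 0 = u := by simpa using hΘP 0 (map_zero l) h0κ
  have hΘv : ∀ z t, κ (z + t • v) ∈ U →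
      HasDerivAt (fun t : ℝ => Θ (z + t • v)) (W (Θ (z + t • v))) t := by
    intro z t ht
    simp only [Θ, Function.comp_apply, hκv] at ht ⊢
    have h2 : HasDerivAt (fun t : ℝ => l z + t) 1 t := (hasDerivAt_id t).const_add (l z)
    have h3 := (hflow _ _ ht).scomp t h2
    rwa [one_smul] at h3
  have hderv : ∀ z (L : E →L[ℝ] E), κ z ∈ U → HasFDerivAt Θ L z → L v = W (Θ z) := by
    intro z L hz hL
    have hc : HasDerivAt (fun t : ℝ => z + t • v) v 0 := by
      simpa using ((hasDerivAt_id (0 : ℝ)).smul_const v).const_add z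
    have h1 := hL.comp_hasDerivAt_of_eq (0 : ℝ) hc (by simp)
    have h2 := hΘv z 0 (by simpa using hz)
    simpa using h1.unique h2
  -- On the hyperplane `Θ` is a translation and along `v` its derivative is `W u`, so the derivative
  -- is a shear, invertible since `l (W u) ≠ 0`.
  have hder0 : HasFDerivAt Θ (shearEquiv hv hWu.ne' : E →L[ℝ] E) 0 := by
    have h1 := ((hΘ.contDiffAt (hUκ.mem_nhds h0κ)).differentiableAt (by simp)).hasFDerivAt
    convert h1 using 1
    ext q
    have h2 : fderiv ℝ Θ 0 (q - l q • v) = q - l q • v := by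
      have hc : HasDerivAt (fun t : ℝ => t • (q - l q • v)) (q - l q • v) 0 := by
        simpa using (hasDerivAt_id (0 : ℝ)).smul_const (q - l q • v)
      have h3 := h1.comp_hasDerivAt_of_eq (0 : ℝ) hc (by simp)
      have h4 : HasDerivAt (fun t : ℝ => u + t • (q - l q • v)) (q - l q • v) 0 := hc.const_add u
      refine h3.unique (h4.congr_of_eventuallyEq ?_)
      have : ∀ᶠ t in 𝓝 (0 : ℝ), t • (q - l q • v) ∈ κ ⁻¹' U :=
        hc.continuousAt.eventually_mem (by simpa using hUκ.mem_nhds h0κ)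
      filter_upwards [this] with t ht
      exact hΘP _ (by rw [map_smul, hlP, smul_zero]) ht
    have h5 := hderv 0 _ h0κ h1
    rw [hΘ0] at h5
    conv_rhs => rw [show q = (q - l q • v) + l q • v by abel, map_add, map_smul, h2, h5]
    exact shearEquiv_apply hv hWu.ne' q
  obtain ⟨e, h0e, heU, heΘ, hes, hinv⟩ := hΘ.exists_openPartialHomeomorph hUκ h0κ hder0
  have hposopen : {z | z ∈ e.source ∧ 0 < l (W (Θ z))} ∈ 𝓝 (0 : E) := by
    have h1 : ContinuousAt (fun z => l (W (Θ z))) 0 := by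
      have := (hΘ.contDiffAt (hUκ.mem_nhds h0κ)).continuousAt
      exact l.continuous.continuousAt.comp (hW.continuous.continuousAt.comp this)
    filter_upwards [e.open_source.mem_nhds h0e,
      h1.eventually (lt_mem_nhds (by simpa [hΘ0] using hWu))] with z h2 h3 using ⟨h2, h3⟩
  obtain ⟨δ, hδ, hslab⟩ := exists_slab_subset (l := l) (v := v) hposopen
  let B : Set E := {z | ‖z - l z • v‖ < δ} ∩ {z | |l z| < δ}
  have hB : IsOpen B := (isOpen_lt (by fun_prop) continuous_const).inter
    (isOpen_lt (by fun_prop) continuous_const)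
  have hBe : ∀ z ∈ B, z ∈ e.source ∧ 0 < l (W (Θ z)) := fun z hz => hslab z hz.1 hz.2
  -- Within the slab `l` increases along integral curves. Those start on the hyperplane, so `l (Θ
  -- z)` and `l z` have the same sign and `Θ` preserves the half-space.
  have hmono : ∀ z ∈ B, StrictMonoOn (fun t => l (Θ ((z - l z • v) + t • v))) (Ioo (-δ) δ) := by
    intro z hz
    have hmem : ∀ t ∈ Ioo (-δ) δ, (z - l z • v) + t • v ∈ B := by
      intro t ht
      have h1 : l ((z - l z • v) + t • v) = t := by simp [hv]
      refine ⟨?_, ?_⟩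
      · rw [mem_ofPred_eq, h1, add_sub_cancel_right]
        exact hz.1
      · rw [mem_ofPred_eq, h1]
        exact abs_lt.2 ht
    have hd : ∀ t ∈ Ioo (-δ) δ, HasDerivAt (fun t => l (Θ ((z - l z • v) + t • v)))
        (l (W (Θ ((z - l z • v) + t • v)))) t := fun t ht =>
      l.hasFDerivAt.comp_hasDerivAt t (hΘv _ t (heU (hBe _ (hmem t ht)).1))
    refine strictMonoOn_of_deriv_pos (convex_Ioo _ _)
      (fun t ht => (hd t ht).continuousAt.continuousWithinAt) fun t ht => ?_
    rw [interior_Ioo] at ht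
    rw [(hd t ht).deriv]
    exact (hBe _ (hmem t ht)).2
  have hsign : ∀ z ∈ B, (0 ≤ l (Θ z) ↔ 0 ≤ l z) ∧ (l (Θ z) = 0 ↔ l z = 0) := by
    intro z hz
    have h0m : (0 : ℝ) ∈ Ioo (-δ) δ := ⟨by linarith, hδ⟩
    have hzm : l z ∈ Ioo (-δ) δ := abs_lt.1 hz.2
    have hPB : z - l z • v ∈ B := by
      refine ⟨?_, ?_⟩
      · simpa [mem_ofPred_eq, hlP] using hz.1
      · simpa [mem_ofPred_eq, hlP] using hδ
    have h1 : l (Θ ((z - l z • v) + (0 : ℝ) • v)) = 0 := by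
      rw [zero_smul, add_zero, hΘP _ (hlP z) (heU (hBe _ hPB).1), map_add, hu, hlP, add_zero]
    have h2 : l (Θ ((z - l z • v) + l z • v)) = l (Θ z) := by rw [sub_add_cancel]
    have h3 := (hmono z hz).le_iff_le h0m hzm
    have h4 := (hmono z hz).eq_iff_eq hzm h0m
    simp only [h1, h2] at h3 h4
    exact ⟨h3, h4⟩
  have h0B : (0 : E) ∈ B := by simp [B, hδ]
  let e' := e.restrOpen B hB
  have he's : ∀ z ∈ e'.source, z ∈ e.source ∧ z ∈ B := fun z hz => hz
  have he'd : IsHalfSpaceDiffeo l e' :=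
    { contDiffOn := by
        change ContDiffOn ℝ ∞ e e'.source
        rw [heΘ]
        exact hΘ.mono fun z hz => heU (he's z hz).1
      contDiffOn_symm := hes.mono fun z hz => hz.1
      nonneg_iff := fun z hz => by
        change 0 ≤ l (e z) ↔ _
        rw [heΘ]
        exact (hsign z (he's z hz).2).1
      eq_zero_iff := fun z hz => by
        change l (e z) = 0 ↔ _
        rw [heΘ]
        exact (hsign z (he's z hz).2).2 }
  have h0e' : (0 : E) ∈ e'.source := ⟨h0e, h0B⟩
  have he'0 : e' 0 = u := by
    change e 0 = u
    rw [heΘ, hΘ0]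
  refine ⟨e'.symm, he'd.symm, ?_, ?_, fun z hz => ?_⟩
  · rw [← he'0]
    exact e'.map_source h0e'
  · rw [← he'0]
    exact e'.left_inv h0e'
  · have hx := e'.map_target hz
    obtain ⟨g, hg⟩ := hinv _ (he's _ hx).1
    have hgv := hderv _ _ (heU (he's _ hx).1) hg
    have h1 : Θ (e'.symm z) = z := by
      rw [← heΘ]
      exact e'.right_inv hz
    rw [h1] at hgv
    refine ⟨(g.symm : E →L[ℝ] E), ?_, ?_⟩
    · refine e'.hasFDerivAt_symm hz ?_
      change HasFDerivAt e _ _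
      rw [heΘ]
      exact hg
    · rw [← hgv]
      exact g.symm_apply_apply v

end FlowBox

/-! ### Manifold charts that straighten a transverse vector field -/

section FlowChart

variable {n : ℕ} [NeZero n]

/-- The coordinate that vanishes on the boundary of the Euclidean half-space. -/
def normalForm (n : ℕ) [NeZero n] : EuclideanSpace ℝ (Fin n) →L[ℝ] ℝ := EuclideanSpace.proj 0

/-- The unit inward normal vector of the Euclidean half-space. -/
def normalVec (n : ℕ) [NeZero n] : EuclideanSpace ℝ (Fin n) := EuclideanSpace.single 0 1

lemma normalForm_apply (z : EuclideanSpace ℝ (Fin n)) : normalForm n z = z 0 := rfl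

@[simp] lemma normalForm_normalVec : normalForm n (normalVec n) = 1 := by
  simp [normalForm, normalVec]

lemma range_euclideanHalfSpace_eq : range (𝓡∂ n) = halfSpace (normalForm n) :=
  range_modelWithCornersEuclideanHalfSpace n

lemma normalForm_coe_nonneg (x : EuclideanHalfSpace n) : 0 ≤ normalForm n ((𝓡∂ n) x) := x.2

lemma modelWithCorners_symm_right_inv {z : EuclideanSpace ℝ (Fin n)} (hz : 0 ≤ normalForm n z) :
    (𝓡∂ n) ((𝓡∂ n).symm z) = z :=
  (𝓡∂ n).right_inv (by rw [range_euclideanHalfSpace_eq]; exact hz)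

lemma IsHalfSpaceDiffeo.restrOpen {E : Type*} [NormedAddCommGroup E] [NormedSpace ℝ E]
    {l : E →L[ℝ] ℝ} {e : OpenPartialHomeomorph E E} (h : IsHalfSpaceDiffeo l e) (s : Set E)
    (hs : IsOpen s) : IsHalfSpaceDiffeo l (e.restrOpen s hs) where
  contDiffOn := h.contDiffOn.mono fun _ hz => hz.1
  contDiffOn_symm := h.contDiffOn_symm.mono fun _ hz => hz.1
  nonneg_iff z hz := h.nonneg_iff z hz.1
  eq_zero_iff z hz := h.eq_zero_iff z hz.1

/-- The local homeomorphism of the Euclidean half-space induced by a local diffeomorphism of the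
ambient space that preserves it. -/
def IsHalfSpaceDiffeo.toHalfSpace
    {e : OpenPartialHomeomorph (EuclideanSpace ℝ (Fin n)) (EuclideanSpace ℝ (Fin n))}
    (h : IsHalfSpaceDiffeo (normalForm n) e) :
    OpenPartialHomeomorph (EuclideanHalfSpace n) (EuclideanHalfSpace n) where
  toFun x := (𝓡∂ n).symm (e ((𝓡∂ n) x))
  invFun y := (𝓡∂ n).symm (e.symm ((𝓡∂ n) y))
  source := (𝓡∂ n) ⁻¹' e.source
  target := (𝓡∂ n) ⁻¹' e.target
  map_source' x hx := by
    rw [mem_preimage, modelWithCorners_symm_right_inv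
      ((h.nonneg_iff _ hx).2 (normalForm_coe_nonneg x))]
    exact e.map_source hx
  map_target' x hx := by
    rw [mem_preimage, modelWithCorners_symm_right_inv
      ((h.symm.nonneg_iff _ hx).2 (normalForm_coe_nonneg x))]
    exact e.map_target hx
  left_inv' x hx := by
    rw [modelWithCorners_symm_right_inv ((h.nonneg_iff _ hx).2 (normalForm_coe_nonneg x)),
      e.left_inv hx, (𝓡∂ n).left_inv]
  right_inv' x hx := by
    rw [modelWithCorners_symm_right_inv ((h.symm.nonneg_iff _ hx).2 (normalForm_coe_nonneg x)),
      e.right_inv hx, (𝓡∂ n).left_inv]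
  open_source := e.open_source.preimage (𝓡∂ n).continuous
  open_target := e.open_target.preimage (𝓡∂ n).continuous
  continuousOn_toFun := (𝓡∂ n).continuous_symm.comp_continuousOn
    (e.continuousOn.comp (𝓡∂ n).continuous.continuousOn fun _ hx => hx)
  continuousOn_invFun := (𝓡∂ n).continuous_symm.comp_continuousOn
    (e.symm.continuousOn.comp (𝓡∂ n).continuous.continuousOn fun _ hx => hx)

lemma IsHalfSpaceDiffeo.coe_toHalfSpace
    {e : OpenPartialHomeomorph (EuclideanSpace ℝ (Fin n)) (EuclideanSpace ℝ (Fin n))}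
    (h : IsHalfSpaceDiffeo (normalForm n) e) {x : EuclideanHalfSpace n}
    (hx : (𝓡∂ n) x ∈ e.source) : (𝓡∂ n) (h.toHalfSpace x) = e ((𝓡∂ n) x) :=
  modelWithCorners_symm_right_inv ((h.nonneg_iff _ hx).2 (normalForm_coe_nonneg x))

lemma IsHalfSpaceDiffeo.contMDiffOn_toHalfSpace
    {e : OpenPartialHomeomorph (EuclideanSpace ℝ (Fin n)) (EuclideanSpace ℝ (Fin n))}
    (h : IsHalfSpaceDiffeo (normalForm n) e) :
    ContMDiffOn (𝓡∂ n) (𝓡∂ n) ∞ h.toHalfSpace h.toHalfSpace.source := by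
  refine (𝓡∂ n).contMDiffOn_symm.comp ((contMDiffOn_iff_contDiffOn.2 h.contDiffOn).comp
    (𝓡∂ n).contMDiff.contMDiffOn fun x hx => hx) fun x hx => ?_
  rw [mem_preimage, range_euclideanHalfSpace_eq]
  exact (h.nonneg_iff _ hx).2 (normalForm_coe_nonneg x)

variable {N : Type*} [TopologicalSpace N] [ChartedSpace (EuclideanHalfSpace n) N]

/-- Change of coordinates of a chart by a local diffeomorphism that preserves the half-space. -/
def transHalfSpace (φ : OpenPartialHomeomorph N (EuclideanHalfSpace n))
    {e : OpenPartialHomeomorph (EuclideanSpace ℝ (Fin n)) (EuclideanSpace ℝ (Fin n))}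
    (h : IsHalfSpaceDiffeo (normalForm n) e) : OpenPartialHomeomorph N (EuclideanHalfSpace n) :=
  φ.trans h.toHalfSpace

section

omit [ChartedSpace (EuclideanHalfSpace n) N]

lemma mem_transHalfSpace_source {φ : OpenPartialHomeomorph N (EuclideanHalfSpace n)}
    {e : OpenPartialHomeomorph (EuclideanSpace ℝ (Fin n)) (EuclideanSpace ℝ (Fin n))}
    (h : IsHalfSpaceDiffeo (normalForm n) e) {p : N} :
    p ∈ (transHalfSpace φ h).source ↔ p ∈ φ.source ∧ φ.extend (𝓡∂ n) p ∈ e.source := by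
  rw [transHalfSpace, OpenPartialHomeomorph.trans_source]
  rfl

lemma transHalfSpace_extend {φ : OpenPartialHomeomorph N (EuclideanHalfSpace n)}
    {e : OpenPartialHomeomorph (EuclideanSpace ℝ (Fin n)) (EuclideanSpace ℝ (Fin n))}
    (h : IsHalfSpaceDiffeo (normalForm n) e) {p : N} (hp : p ∈ (transHalfSpace φ h).source) :
    (transHalfSpace φ h).extend (𝓡∂ n) p = e (φ.extend (𝓡∂ n) p) :=
  h.coe_toHalfSpace ((mem_transHalfSpace_source h).1 hp).2

end

lemma transHalfSpace_mem_maximalAtlas [IsManifold (𝓡∂ n) ∞ N]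
    {φ : OpenPartialHomeomorph N (EuclideanHalfSpace n)}
    (hφ : φ ∈ IsManifold.maximalAtlas (𝓡∂ n) ∞ N)
    {e : OpenPartialHomeomorph (EuclideanSpace ℝ (Fin n)) (EuclideanSpace ℝ (Fin n))}
    (h : IsHalfSpaceDiffeo (normalForm n) e) :
    transHalfSpace φ h ∈ IsManifold.maximalAtlas (𝓡∂ n) ∞ N := by
  refine OpenPartialHomeomorph.mem_maximalAtlas_of_contMDiffOn _ ?_ ?_
  · exact h.contMDiffOn_toHalfSpace.comp
      ((contMDiffOn_of_mem_maximalAtlas hφ).mono fun p hp => hp.1) fun p hp => hp.2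
  · exact (contMDiffOn_symm_of_mem_maximalAtlas hφ).comp
      (h.symm.contMDiffOn_toHalfSpace.mono fun x hx => hx.1) fun x hx => hx.2

/-- This is the fibre component of the tangent map of `f` composed with the section `F`; the tangent
bundle of the target is trivial. -/
lemma contMDiffOn_mfderiv_apply [IsManifold (𝓡∂ n) ∞ N] {F : (x : N) → TangentSpace (𝓡∂ n) x}
    (hF : ContMDiff (𝓡∂ n) (𝓡∂ n).tangent ∞ fun x => (⟨x, F x⟩ : TangentBundle (𝓡∂ n) N))
    {f : N → EuclideanSpace ℝ (Fin n)} {s : Set N} (hs : IsOpen s)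
    (hf : ContMDiffOn (𝓡∂ n) 𝓘(ℝ, EuclideanSpace ℝ (Fin n)) ∞ f s) :
    ContMDiffOn (𝓡∂ n) 𝓘(ℝ, EuclideanSpace ℝ (Fin n)) ∞
      (fun p => (show EuclideanSpace ℝ (Fin n) from
        mfderiv (𝓡∂ n) 𝓘(ℝ, EuclideanSpace ℝ (Fin n)) f p (F p))) s := by
  have h1 := hf.contMDiffOn_tangentMapWithin (m := ∞) (by simp) hs.uniqueMDiffOn
  have h2 := h1.comp hF.contMDiffOn (s := s) fun p hp => hp
  have h3 := (contMDiff_snd_tangentBundle_modelSpace (EuclideanSpace ℝ (Fin n))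
    𝓘(ℝ, EuclideanSpace ℝ (Fin n)) (n := ∞)).comp_contMDiffOn h2
  refine h3.congr fun p hp => ?_
  change _ = mfderivWithin (𝓡∂ n) 𝓘(ℝ, EuclideanSpace ℝ (Fin n)) f s p (F p)
  rw [mfderivWithin_of_mem_nhds (hs.mem_nhds hp)]

/-- A chart of the smooth structure in which the vector field `F` reads as the constant field `c`
times the unit normal, and which recognizes boundary points. -/
structure IsFlowChart (F : (x : N) → TangentSpace (𝓡∂ n) x) (c : ℝ)
    (φ : OpenPartialHomeomorph N (EuclideanHalfSpace n)) : Prop where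
  mem_maximalAtlas : φ ∈ IsManifold.maximalAtlas (𝓡∂ n) ∞ N
  boundary_iff : ∀ p ∈ φ.source,
    p ∈ (𝓡∂ n).boundary N ↔ normalForm n (φ.extend (𝓡∂ n) p) = 0
  mfderiv_eq : ∀ p ∈ φ.source,
    (show EuclideanSpace ℝ (Fin n) from
      mfderiv (𝓡∂ n) 𝓘(ℝ, EuclideanSpace ℝ (Fin n)) (φ.extend (𝓡∂ n)) p (F p)) = c • normalVec n

/-- Being an interior point can be tested in any chart of the atlas, and a point of the closed
half-space is interior to it exactly when its normal coordinate is positive. -/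
lemma boundary_iff_of_mem_atlas [IsManifold (𝓡∂ n) ∞ N]
    {φ : OpenPartialHomeomorph N (EuclideanHalfSpace n)} (hφ : φ ∈ atlas (EuclideanHalfSpace n) N)
    {p : N} (hp : p ∈ φ.source) :
    p ∈ (𝓡∂ n).boundary N ↔ normalForm n (φ.extend (𝓡∂ n) p) = 0 := by
  have h1 := ModelWithCorners.isInteriorPoint_iff_of_mem_atlas (I := 𝓡∂ n) (n := ∞) (by simp) hφ hp
  have h2 : φ.extend (𝓡∂ n) p ∈ interior (φ.extend (𝓡∂ n)).target ↔
      0 < normalForm n (φ.extend (𝓡∂ n) p) := by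
    have h3 := interior_range_modelWithCornersEuclideanHalfSpace n
    refine ⟨fun h => ?_, fun h => φ.mem_interior_extend_target (φ.map_source hp) ?_⟩
    · have h4 := interior_mono φ.extend_target_subset_range h
      rwa [h3] at h4
    · rw [h3]
      exact h
  rw [h2] at h1
  have h5 : 0 ≤ normalForm n (φ.extend (𝓡∂ n) p) := normalForm_coe_nonneg (φ p)
  rw [← ModelWithCorners.compl_interior, mem_compl_iff]
  exact (not_congr h1).trans (not_lt.trans (h5.ge_iff_eq.trans eq_comm))

lemma mfderiv_transHalfSpace [IsManifold (𝓡∂ n) ∞ N]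
    {φ : OpenPartialHomeomorph N (EuclideanHalfSpace n)}
    (hφ : φ ∈ IsManifold.maximalAtlas (𝓡∂ n) ∞ N)
    {e : OpenPartialHomeomorph (EuclideanSpace ℝ (Fin n)) (EuclideanSpace ℝ (Fin n))}
    (h : IsHalfSpaceDiffeo (normalForm n) e) {p : N} (hp : p ∈ (transHalfSpace φ h).source)
    {L : EuclideanSpace ℝ (Fin n) →L[ℝ] EuclideanSpace ℝ (Fin n)}
    (hL : HasFDerivAt e L (φ.extend (𝓡∂ n) p)) (w : TangentSpace (𝓡∂ n) p) :
    (show EuclideanSpace ℝ (Fin n) from mfderiv (𝓡∂ n) 𝓘(ℝ, EuclideanSpace ℝ (Fin n))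
      ((transHalfSpace φ h).extend (𝓡∂ n)) p w) =
    L (mfderiv (𝓡∂ n) 𝓘(ℝ, EuclideanSpace ℝ (Fin n)) (φ.extend (𝓡∂ n)) p w) := by
  have hpφ := ((mem_transHalfSpace_source h).1 hp).1
  have h1 := ((φ.contMDiffAt_extend hφ hpφ).mdifferentiableAt (by simp)).hasMFDerivAt
  have h2 := HasMFDerivAt.comp p hL.hasMFDerivAt h1
  have h3 : (transHalfSpace φ h).extend (𝓡∂ n) =ᶠ[𝓝 p] e ∘ φ.extend (𝓡∂ n) := by
    filter_upwards [(transHalfSpace φ h).open_source.mem_nhds hp] with q hq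
    exact transHalfSpace_extend h hq
  rw [(h2.congr_of_eventuallyEq h3).mfderiv]
  rfl

/-- Every boundary point at which the vector field is transverse to the boundary lies in the
domain of a flow chart. -/
theorem exists_isFlowChart [IsManifold (𝓡∂ n) ∞ N] {F : (x : N) → TangentSpace (𝓡∂ n) x}
    (hF : ContMDiff (𝓡∂ n) (𝓡∂ n).tangent ∞ fun x => (⟨x, F x⟩ : TangentBundle (𝓡∂ n) N))
    {q : N} (hq : q ∈ (𝓡∂ n).boundary N) {c : ℝ} (hc : c * c = 1)
    (hpos : 0 < c * normalCoord (chartAt (EuclideanHalfSpace n) q) q (F q)) :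
    ∃ φ : OpenPartialHomeomorph N (EuclideanHalfSpace n), IsFlowChart F c φ ∧ q ∈ φ.source ∧
      φ.extend (𝓡∂ n) q = 0 := by
  set φ₀ := chartAt (EuclideanHalfSpace n) q with hφ₀
  have hφ₀a : φ₀ ∈ IsManifold.maximalAtlas (𝓡∂ n) ∞ N := IsManifold.chart_mem_maximalAtlas q
  have hqs : q ∈ φ₀.source := mem_chart_source _ q
  set f := φ₀.extend (𝓡∂ n) with hf
  let D : N → EuclideanSpace ℝ (Fin n) := fun p =>
    mfderiv (𝓡∂ n) 𝓘(ℝ, EuclideanSpace ℝ (Fin n)) f p (F p)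
  have hD : ContMDiffOn (𝓡∂ n) 𝓘(ℝ, EuclideanSpace ℝ (Fin n)) ∞ D φ₀.source :=
    contMDiffOn_mfderiv_apply hF φ₀.open_source (φ₀.contMDiffOn_extend hφ₀a)
  -- The sign `c` makes the field point inwards, as the flow box theorem requires; it is undone at
  -- the end by `c * c = 1`.
  let V : EuclideanSpace ℝ (Fin n) → EuclideanSpace ℝ (Fin n) := fun u => c • D (f.symm u)
  have hV : ContDiffOn ℝ ∞ V f.target := by
    rw [← contMDiffOn_iff_contDiffOn]
    refine ContMDiffOn.comp (t := univ) (contDiff_id.const_smul c).contMDiff.contMDiffOn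
      (hD.comp ?_ fun u hu => ?_) fun _ _ => mem_univ _
    · rw [hf, φ₀.extend_target']
      exact contMDiffOn_extend_symm hφ₀a
    · have := f.map_target hu
      rwa [hf, φ₀.extend_source] at this
  have htgt : f.target ∈ 𝓝[halfSpace (normalForm n)] f q := by
    rw [← range_euclideanHalfSpace_eq]
    exact φ₀.extend_target_mem_nhdsWithin hqs
  obtain ⟨r, hr, hball⟩ := Metric.mem_nhdsWithin_iff.1 htgt
  -- The cut-off is one on the ball of radius `r / 3` and is supported within radius `r / 2 < r`, so
  -- `χ • V` is smooth on the entire half-space and has compact support.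
  let χ : ContDiffBump (f q) := ⟨r / 3, r / 2, by positivity, by linarith⟩
  have hsupp : ∀ z, z ∈ tsupport χ → z ∈ Metric.ball (f q) r := by
    intro z hz
    rw [χ.tsupport_eq] at hz
    exact Metric.closedBall_subset_ball (by change r / 2 < r; linarith) hz
  obtain ⟨W, hW, hWV⟩ := exists_contDiff_eqOn_halfSpace (l := normalForm n) (v := normalVec n)
    normalForm_normalVec (f := fun z => χ z • V z) (by
      intro z hz
      by_cases hzs : z ∈ tsupport χ
      · have h1 : f.target ∈ 𝓝[halfSpace (normalForm n)] z := by
          filter_upwards [inter_mem_nhdsWithin _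
            (Metric.isOpen_ball.mem_nhds (hsupp z hzs))] with w hw using hball ⟨hw.2, hw.1⟩
        exact χ.contDiffAt.contDiffWithinAt.smul
          ((hV z (hball ⟨hsupp z hzs, hz⟩)).mono_of_mem_nhdsWithin h1)
      · refine (contDiffWithinAt_const (c := (0 : EuclideanSpace ℝ (Fin n)))).congr_of_eventuallyEq
          (nhdsWithin_le_nhds ?_) (by simp [image_eq_zero_of_notMem_tsupport hzs])
        filter_upwards [(isClosed_tsupport _).isOpen_compl.mem_nhds hzs] with w hw
        simp [image_eq_zero_of_notMem_tsupport hw]) χ.hasCompactSupport.smul_right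
  have hWV' : ∀ z ∈ Metric.ball (f q) (r / 3), 0 ≤ normalForm n z → W z = V z := by
    intro z hz hz0
    have h1 : χ z = 1 := χ.one_of_mem_closedBall (Metric.ball_subset_closedBall hz)
    have h2 := hWV (show z ∈ halfSpace (normalForm n) from hz0)
    rw [h2]
    simp [h1]
  have hq0 : normalForm n (f q) = 0 :=
    (boundary_iff_of_mem_atlas (chart_mem_atlas _ q) hqs).1 hq
  have hqball : f q ∈ Metric.ball (f q) (r / 3) := Metric.mem_ball_self (by positivity)
  have hfs : f.symm (f q) = q := φ₀.extend_left_inv hqs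
  have hWq : 0 < normalForm n (W (f q)) := by
    rw [hWV' _ hqball hq0.ge]
    simp only [V, map_smul, smul_eq_mul, hfs]
    exact hpos
  obtain ⟨e, he, heq, heq0, heW⟩ := exists_flowBox (normalForm_normalVec (n := n)) hW hq0 hWq
  let B := Metric.ball (f q) (r / 3)
  -- Only on this ball, and on the side of the half-space, does `W` agree with the given field.
  have heB := he.restrOpen B Metric.isOpen_ball
  have hsrc : ∀ p, p ∈ (transHalfSpace φ₀ heB).source ↔ p ∈ φ₀.source ∧ f p ∈ e.source ∧ f p ∈ B :=
    fun p => mem_transHalfSpace_source heB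
  have hqsrc : q ∈ (transHalfSpace φ₀ heB).source := (hsrc q).2 ⟨hqs, heq, hqball⟩
  refine ⟨transHalfSpace φ₀ heB, ⟨transHalfSpace_mem_maximalAtlas hφ₀a heB, fun p hp => ?_,
    fun p hp => ?_⟩, hqsrc, ?_⟩
  · obtain ⟨h1, h2, h3⟩ := (hsrc p).1 hp
    rw [transHalfSpace_extend heB hp]
    exact (boundary_iff_of_mem_atlas (chart_mem_atlas _ q) h1).trans
      (he.eq_zero_iff _ h2).symm
  · obtain ⟨h1, h2, h3⟩ := (hsrc p).1 hp
    obtain ⟨L, hL, hLW⟩ := heW _ h2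
    rw [mfderiv_transHalfSpace hφ₀a heB hp hL]
    have h4 : W (f p) = c • D p := by
      rw [hWV' _ h3 (normalForm_coe_nonneg (φ₀ p))]
      change c • D (f.symm (f p)) = _
      rw [hf, φ₀.extend_left_inv h1]
    rw [h4, map_smul] at hLW
    rw [← hLW, smul_smul, hc, one_smul]
  · rw [transHalfSpace_extend heB hqsrc]
    exact heq0

end FlowChart

/-! ### Shrinking and changing flow charts -/

section FlowChartOperations

variable {n : ℕ} [NeZero n] {N : Type*} [TopologicalSpace N]
  [ChartedSpace (EuclideanHalfSpace n) N]

/-- Restriction of a local homeomorphism to an open subset of its target. -/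
def restrTarget (φ : OpenPartialHomeomorph N (EuclideanHalfSpace n))
    (s : Set (EuclideanHalfSpace n)) (hs : IsOpen s) :
    OpenPartialHomeomorph N (EuclideanHalfSpace n) :=
  (φ.symm.restrOpen s hs).symm

omit [ChartedSpace (EuclideanHalfSpace n) N] in
lemma restrTarget_mem_source {φ : OpenPartialHomeomorph N (EuclideanHalfSpace n)}
    {s : Set (EuclideanHalfSpace n)} {hs : IsOpen s} {p : N}
    (hp : p ∈ (restrTarget φ s hs).source) : p ∈ φ.source ∧ φ p ∈ s := by
  have h1 := (restrTarget φ s hs).map_source hp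
  have h2 : (restrTarget φ s hs).symm ((restrTarget φ s hs) p) = p :=
    (restrTarget φ s hs).left_inv hp
  have h3 : φ.symm (φ p) = p := h2
  refine ⟨?_, h1.2⟩
  rw [← h3]
  exact φ.map_target h1.1

lemma IsFlowChart.restrTarget [IsManifold (𝓡∂ n) ∞ N] {F : (x : N) → TangentSpace (𝓡∂ n) x} {c : ℝ}
    {φ : OpenPartialHomeomorph N (EuclideanHalfSpace n)} (h : IsFlowChart F c φ)
    (s : Set (EuclideanHalfSpace n)) (hs : IsOpen s) : IsFlowChart F c (restrTarget φ s hs) where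
  mem_maximalAtlas := by
    refine OpenPartialHomeomorph.mem_maximalAtlas_of_contMDiffOn _ ?_ ?_
    · exact (contMDiffOn_of_mem_maximalAtlas h.mem_maximalAtlas).mono
        fun p hp => (restrTarget_mem_source hp).1
    · exact (contMDiffOn_symm_of_mem_maximalAtlas h.mem_maximalAtlas).mono fun p hp => hp.1
  boundary_iff p hp := h.boundary_iff p (restrTarget_mem_source hp).1
  mfderiv_eq p hp := h.mfderiv_eq p (restrTarget_mem_source hp).1

lemma IsFlowChart.transHalfSpace [IsManifold (𝓡∂ n) ∞ N] {F : (x : N) → TangentSpace (𝓡∂ n) x}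
    {c : ℝ} {φ : OpenPartialHomeomorph N (EuclideanHalfSpace n)} (h : IsFlowChart F c φ)
    {e : OpenPartialHomeomorph (EuclideanSpace ℝ (Fin n)) (EuclideanSpace ℝ (Fin n))}
    (he : IsHalfSpaceDiffeo (normalForm n) e)
    (hL : ∀ z ∈ e.source, ∃ L : EuclideanSpace ℝ (Fin n) →L[ℝ] EuclideanSpace ℝ (Fin n),
      HasFDerivAt e L z ∧ L (normalVec n) = normalVec n) :
    IsFlowChart F c (transHalfSpace φ he) where
  mem_maximalAtlas := transHalfSpace_mem_maximalAtlas h.mem_maximalAtlas he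
  boundary_iff p hp := by
    obtain ⟨h1, h2⟩ := (mem_transHalfSpace_source he).1 hp
    rw [transHalfSpace_extend he hp]
    exact (h.boundary_iff p h1).trans (he.eq_zero_iff _ h2).symm
  mfderiv_eq p hp := by
    obtain ⟨h1, h2⟩ := (mem_transHalfSpace_source he).1 hp
    obtain ⟨L, hL, hLv⟩ := hL _ h2
    rw [mfderiv_transHalfSpace h.mem_maximalAtlas he hp hL]
    have h3 := congrArg L (h.mfderiv_eq p h1)
    refine Eq.trans h3 ((L.map_smul c (normalVec n)).trans ?_)
    rw [hLv]

omit [ChartedSpace (EuclideanHalfSpace n) N] in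
lemma extend_symm_apply_of_eq {φ : OpenPartialHomeomorph N (EuclideanHalfSpace n)} {p : N}
    (hp : p ∈ φ.source) {z : EuclideanSpace ℝ (Fin n)} (h : φ.extend (𝓡∂ n) p = z) :
    φ.symm ((𝓡∂ n).symm z) = p := by
  subst h
  exact φ.extend_left_inv (I := 𝓡∂ n) hp

end FlowChartOperations

/-! ### Matching flow charts at a guard point and at its image -/

namespace HybridSystem

variable {n : ℕ} [NeZero n] {J : Type*} {M : J → Type*}
  [∀ j, TopologicalSpace (M j)] [∀ j, ChartedSpace (EuclideanHalfSpace n) (M j)]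
  [∀ j, IsManifold (𝓡∂ n) ∞ (M j)]

/-- The conditions under which the guard can be glued to its image under the reset map. -/
structure IsGluable (H : HybridSystem n M) : Prop where
  outward : ∀ x ∈ H.G, IsOutwardPointing x (H.F x)
  diffeo : H.IsResetDiffeo
  boundary_eq : (𝓡∂ n).boundary (Σ j, M j) = H.G ∪ H.R '' H.G
  disjoint : Disjoint H.G (H.R '' H.G)
  inward : ∀ x ∈ H.R '' H.G, IsInwardPointing x (H.F x)

/-- A pair of flow charts, one near a point of the guard and one near its image, with the same half
ball as target, in which the reset map reads as the identity. -/
structure IsGluePair (H : HybridSystem n M)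
    (φ ψ : OpenPartialHomeomorph (Σ j, M j) (EuclideanHalfSpace n)) (δ : ℝ) : Prop where
  pos : 0 < δ
  left : IsFlowChart H.F (-1) φ
  right : IsFlowChart H.F 1 ψ
  target_left : φ.target = (𝓡∂ n) ⁻¹' Metric.ball 0 δ
  target_right : ψ.target = (𝓡∂ n) ⁻¹' Metric.ball 0 δ
  disjoint : Disjoint φ.source ψ.source
  mem_guard : ∀ h ∈ φ.target, normalForm n ((𝓡∂ n) h) = 0 → φ.symm h ∈ H.G
  reset : ∀ h ∈ φ.target, normalForm n ((𝓡∂ n) h) = 0 → H.R (φ.symm h) = ψ.symm h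

/-- The reset map in coordinates, extended constantly in the normal direction. -/
def resetInCharts (H : HybridSystem n M)
    (φ ψ : OpenPartialHomeomorph (Σ j, M j) (EuclideanHalfSpace n))
    (z : EuclideanSpace ℝ (Fin n)) : EuclideanSpace ℝ (Fin n) :=
  normalForm n z • normalVec n + ψ.extend (𝓡∂ n)
    (H.R (φ.symm ((𝓡∂ n).symm (z - normalForm n z • normalVec n))))

lemma normalForm_sub_normal (z : EuclideanSpace ℝ (Fin n)) :
    normalForm n (z - normalForm n z • normalVec n) = 0 := by simp

/-- Commuting with normal translations forces the derivative to fix the normal vector, so a flow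
chart corrected by this map is still a flow chart. -/
lemma resetInCharts_add_smul (H : HybridSystem n M)
    (φ ψ : OpenPartialHomeomorph (Σ j, M j) (EuclideanHalfSpace n))
    (z : EuclideanSpace ℝ (Fin n)) (t : ℝ) :
    H.resetInCharts φ ψ (z + t • normalVec n) = H.resetInCharts φ ψ z + t • normalVec n := by
  have h1 : z + t • normalVec n - normalForm n (z + t • normalVec n) • normalVec n =
      z - normalForm n z • normalVec n := by
    simp only [map_add, map_smul, normalForm_normalVec, smul_eq_mul, mul_one]
    module
  simp only [resetInCharts, h1]
  simp only [map_add, map_smul, normalForm_normalVec, smul_eq_mul, mul_one]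
  module

lemma resetInCharts_of_normalForm_eq_zero (H : HybridSystem n M)
    (φ ψ : OpenPartialHomeomorph (Σ j, M j) (EuclideanHalfSpace n))
    {z : EuclideanSpace ℝ (Fin n)} (hz : normalForm n z = 0) :
    H.resetInCharts φ ψ z = ψ.extend (𝓡∂ n) (H.R (φ.symm ((𝓡∂ n).symm z))) := by
  rw [resetInCharts, hz, zero_smul, zero_add, sub_zero]

/-- The reset map is smooth in flow charts, on a neighbourhood of the origin. -/
lemma exists_contDiffOn_resetInCharts {H : HybridSystem n M}
    {φ ψ : OpenPartialHomeomorph (Σ j, M j) (EuclideanHalfSpace n)} {c c' : ℝ}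
    (hφ : IsFlowChart H.F c φ) (hψ : IsFlowChart H.F c' ψ) {x : Σ j, M j} (hx : x ∈ H.G)
    (hxφ : x ∈ φ.source) (hx0 : φ.extend (𝓡∂ n) x = 0) (hxψ : H.R x ∈ ψ.source) :
    ∃ U : Set (EuclideanSpace ℝ (Fin n)), IsOpen U ∧ 0 ∈ U ∧
      ContDiffOn ℝ ∞ (H.resetInCharts φ ψ) U ∧
      ∀ z ∈ U, (𝓡∂ n).symm (z - normalForm n z • normalVec n) ∈ φ.target ∧
        φ.symm ((𝓡∂ n).symm (z - normalForm n z • normalVec n)) ∈ H.G ∧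
        H.R (φ.symm ((𝓡∂ n).symm (z - normalForm n z • normalVec n))) ∈ ψ.source := by
  obtain ⟨O, hO, hGO⟩ := H.isOpen_G
  let P : EuclideanSpace ℝ (Fin n) → EuclideanSpace ℝ (Fin n) :=
    fun z => z - normalForm n z • normalVec n
  have hP : ContDiff ℝ ∞ P :=
    contDiff_id.sub ((normalForm n).contDiff.smul contDiff_const)
  have hP0 : ∀ z, normalForm n (P z) = 0 := normalForm_sub_normal
  let k : EuclideanSpace ℝ (Fin n) → EuclideanHalfSpace n := fun z => (𝓡∂ n).symm (P z)
  have hIk : ∀ z, (𝓡∂ n) (k z) = P z := fun z => modelWithCorners_symm_right_inv (hP0 z).ge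
  have hk : Continuous k := (𝓡∂ n).continuous_symm.comp hP.continuous
  have hksm : ContMDiff 𝓘(ℝ, EuclideanSpace ℝ (Fin n)) (𝓡∂ n) ∞ k :=
    (𝓡∂ n).contMDiffOn_symm.comp_contMDiff hP.contMDiff fun z => by
      rw [range_euclideanHalfSpace_eq]
      exact (hP0 z).ge
  let m : EuclideanSpace ℝ (Fin n) → Σ j, M j := fun z => φ.symm (k z)
  have hm : ContMDiffOn 𝓘(ℝ, EuclideanSpace ℝ (Fin n)) (𝓡∂ n) ∞ m (k ⁻¹' φ.target) :=
    (contMDiffOn_symm_of_mem_maximalAtlas hφ.mem_maximalAtlas).comp hksm.contMDiffOn fun _ hz => hz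
  have hA : IsOpen (k ⁻¹' φ.target ∩ m ⁻¹' O) :=
    hm.continuousOn.isOpen_inter_preimage (φ.open_target.preimage hk) hO
  -- The point `m z` has normal coordinate zero, hence lies on the boundary, and the guard is the
  -- trace of `O` there. Projecting to the hyperplane first thus makes the reset map available on a
  -- full neighbourhood.
  have hmG : ∀ z ∈ k ⁻¹' φ.target ∩ m ⁻¹' O, m z ∈ H.G := by
    rintro z ⟨hz1, hz2⟩
    rw [hGO]
    refine ⟨hz2, (hφ.boundary_iff _ (φ.map_target hz1)).2 ?_⟩
    have : φ.extend (𝓡∂ n) (m z) = P z := by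
      change (𝓡∂ n) (φ (φ.symm (k z))) = _
      rw [φ.right_inv hz1, hIk]
    rw [this, hP0]
  have hRm : ContMDiffOn 𝓘(ℝ, EuclideanSpace ℝ (Fin n)) (𝓡∂ n) ∞ (fun z => H.R (m z))
      (k ⁻¹' φ.target ∩ m ⁻¹' O) :=
    H.contMDiffOn_R.comp (hm.mono inter_subset_left) hmG
  have hm0 : m 0 = x := by
    have hP00 : P 0 = 0 := by simp [P]
    change φ.symm ((𝓡∂ n).symm (P 0)) = x
    rw [hP00]
    exact extend_symm_apply_of_eq hxφ hx0
  refine ⟨(k ⁻¹' φ.target ∩ m ⁻¹' O) ∩ (fun z => H.R (m z)) ⁻¹' ψ.source,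
    hRm.continuousOn.isOpen_inter_preimage hA ψ.open_source, ⟨⟨?_, ?_⟩, ?_⟩, ?_,
    fun z hz => ⟨hz.1.1, hmG z hz.1, hz.2⟩⟩
  · have : k 0 = φ x := by
      apply (𝓡∂ n).injective
      rw [hIk]
      change _ = φ.extend (𝓡∂ n) x
      rw [hx0]
      simp [P]
    rw [mem_preimage, this]
    exact φ.map_source hxφ
  · rw [mem_preimage, hm0]
    rw [hGO] at hx
    exact hx.1
  · change H.R (m 0) ∈ ψ.source
    rw [hm0]
    exact hxψ
  · have h1 : ContDiffOn ℝ ∞ (fun z => ψ.extend (𝓡∂ n) (H.R (m z)))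
        ((k ⁻¹' φ.target ∩ m ⁻¹' O) ∩ (fun z => H.R (m z)) ⁻¹' ψ.source) := by
      rw [← contMDiffOn_iff_contDiffOn]
      exact (ψ.contMDiffOn_extend hψ.mem_maximalAtlas).comp (hRm.mono inter_subset_left)
        fun _ hz => hz.2
    exact ((normalForm n).contDiff.smul contDiff_const).contDiffOn.add h1

/-- The reset map takes values in the boundary, so its reading in `ψ` has no normal component and
only the added normal term contributes. -/
lemma normalForm_resetInCharts {H : HybridSystem n M} (hH : H.IsGluable)
    {φ ψ : OpenPartialHomeomorph (Σ j, M j) (EuclideanHalfSpace n)} {c' : ℝ}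
    (hψ : IsFlowChart H.F c' ψ) {z : EuclideanSpace ℝ (Fin n)}
    (hz1 : φ.symm ((𝓡∂ n).symm (z - normalForm n z • normalVec n)) ∈ H.G)
    (hz2 : H.R (φ.symm ((𝓡∂ n).symm (z - normalForm n z • normalVec n))) ∈ ψ.source) :
    normalForm n (H.resetInCharts φ ψ z) = normalForm n z := by
  have h1 := (hψ.boundary_iff _ hz2).1 (by
    rw [hH.boundary_eq]
    exact Or.inr (mem_image_of_mem _ hz1))
  rw [resetInCharts, map_add, map_smul, normalForm_normalVec, h1]
  simp

/-- The reset map in flow charts has an injective derivative at the origin. -/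
lemma injective_of_hasFDerivAt_resetInCharts {H : HybridSystem n M} (hH : H.IsGluable)
    {φ ψ : OpenPartialHomeomorph (Σ j, M j) (EuclideanHalfSpace n)} {c c' : ℝ}
    (hφ : IsFlowChart H.F c φ) (hψ : IsFlowChart H.F c' ψ) {x : Σ j, M j} (hx : x ∈ H.G)
    (hxφ : x ∈ φ.source) (hx0 : φ.extend (𝓡∂ n) x = 0) (hxψ : H.R x ∈ ψ.source)
    (hRx0 : ψ.extend (𝓡∂ n) (H.R x) = 0)
    {D : EuclideanSpace ℝ (Fin n) →L[ℝ] EuclideanSpace ℝ (Fin n)}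
    (hD : HasFDerivAt (H.resetInCharts φ ψ) D 0) : Function.Injective D := by
  obtain ⟨U, hU, h0U, -, hUm⟩ := exists_contDiffOn_resetInCharts hφ hψ hx hxφ hx0 hxψ
  obtain ⟨S, hS, hSR⟩ := hH.diffeo
  have hm0 : φ.symm ((𝓡∂ n).symm 0) = x := extend_symm_apply_of_eq hxφ hx0
  have hb0 : H.resetInCharts φ ψ 0 = 0 := by
    rw [resetInCharts_of_normalForm_eq_zero _ _ _ (map_zero _), hm0, hRx0]
  rw [injective_iff_map_eq_zero]
  intro w hw
  have hc : HasDerivAt (fun t : ℝ => t • w) w 0 := by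
    simpa using (hasDerivAt_id (0 : ℝ)).smul_const w
  have hcU : ∀ᶠ t : ℝ in 𝓝 0, t • w ∈ U :=
    hc.continuousAt.eventually_mem (by simpa using hU.mem_nhds h0U)
  have hbc := hD.comp_hasDerivAt_of_eq (0 : ℝ) hc (by simp)
  -- The map preserves the normal coordinate, so a vector in the kernel of `D` is tangent to the
  -- hyperplane.
  have hlw : normalForm n w = 0 := by
    have h1 := (normalForm n).hasFDerivAt.comp_hasDerivAt (0 : ℝ) hbc
    have h2 : HasDerivAt (fun t : ℝ => normalForm n (t • w)) (normalForm n w) 0 :=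
      (normalForm n).hasFDerivAt.comp_hasDerivAt (0 : ℝ) hc
    have h3 := h2.unique (h1.congr_of_eventuallyEq (by
      filter_upwards [hcU] with t ht
      exact (normalForm_resetInCharts hH hψ (hUm _ ht).2.1 (hUm _ ht).2.2).symm))
    rw [h3, hw, map_zero]
  -- The inverse `S` is smooth only on `R(G)`, so its reading `a` is differentiated within `T`.
  -- Along the line `t • w` the reset map stays in `T` and `a` undoes it, whence `w` is the image of
  -- `D w = 0`.
  let T : Set (EuclideanSpace ℝ (Fin n)) :=
    {y | (𝓡∂ n).symm y ∈ ψ.target ∧ y ∈ range (𝓡∂ n) ∧ ψ.symm ((𝓡∂ n).symm y) ∈ H.R '' H.G}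
  let a : EuclideanSpace ℝ (Fin n) → EuclideanSpace ℝ (Fin n) :=
    fun y => φ.extend (𝓡∂ n) (S (ψ.symm ((𝓡∂ n).symm y)))
  have hn0 : ψ.symm ((𝓡∂ n).symm 0) = H.R x := extend_symm_apply_of_eq hxψ hRx0
  have hT0 : (0 : EuclideanSpace ℝ (Fin n)) ∈ T := by
    refine ⟨?_, ?_, ?_⟩
    · rw [← hRx0]
      change (𝓡∂ n).symm ((𝓡∂ n) (ψ _)) ∈ _
      rw [(𝓡∂ n).left_inv]
      exact ψ.map_source hxψ
    · rw [range_euclideanHalfSpace_eq]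
      show (0 : ℝ) ≤ normalForm n 0
      exact (map_zero _).ge
    · rw [hn0]
      exact mem_image_of_mem _ hx
  have ha : ContDiffWithinAt ℝ ∞ a T 0 := by
    rw [← contMDiffWithinAt_iff_contDiffWithinAt]
    have h1 : ContMDiffOn 𝓘(ℝ, EuclideanSpace ℝ (Fin n)) (𝓡∂ n) ∞
        (fun y => S (ψ.symm ((𝓡∂ n).symm y))) T :=
      hS.comp ((contMDiffOn_symm_of_mem_maximalAtlas hψ.mem_maximalAtlas).comp
        ((𝓡∂ n).contMDiffOn_symm.mono fun y hy => hy.2.1) fun y hy => hy.1) fun y hy => hy.2.2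
    refine ContMDiffAt.comp_contMDiffWithinAt (0 : EuclideanSpace ℝ (Fin n))
      (g := φ.extend (𝓡∂ n)) ?_ (h1 0 hT0)
    simp only [hn0, hSR x hx]
    exact φ.contMDiffAt_extend hφ.mem_maximalAtlas hxφ
  have had := (ha.differentiableWithinAt (by simp)).hasFDerivWithinAt
  have hab : ∀ᶠ t : ℝ in 𝓝 0, H.resetInCharts φ ψ (t • w) ∈ T ∧
      a (H.resetInCharts φ ψ (t • w)) = t • w := by
    filter_upwards [hcU] with t ht
    obtain ⟨h1, h2, h3⟩ := hUm _ ht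
    have hl : normalForm n (t • w) = 0 := by rw [map_smul, hlw, smul_zero]
    simp only [hl, zero_smul, sub_zero] at h1 h2 h3
    have hb : H.resetInCharts φ ψ (t • w) =
        (𝓡∂ n) (ψ (H.R (φ.symm ((𝓡∂ n).symm (t • w))))) :=
      resetInCharts_of_normalForm_eq_zero _ _ _ hl
    have h4 : (𝓡∂ n).symm (H.resetInCharts φ ψ (t • w)) =
        ψ (H.R (φ.symm ((𝓡∂ n).symm (t • w)))) := by rw [hb, (𝓡∂ n).left_inv]
    refine ⟨⟨?_, ?_, ?_⟩, ?_⟩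
    · rw [h4]
      exact ψ.map_source h3
    · rw [hb]
      exact mem_range_self _
    · rw [h4, ψ.left_inv h3]
      exact mem_image_of_mem _ h2
    · change φ.extend (𝓡∂ n) (S (ψ.symm ((𝓡∂ n).symm _))) = _
      rw [h4, ψ.left_inv h3, hSR _ h2]
      change (𝓡∂ n) (φ (φ.symm _)) = _
      rw [φ.right_inv h1, modelWithCorners_symm_right_inv hl.ge]
  have h5 := had.comp_hasDerivAt_of_eq (0 : ℝ) hbc
    (hab.mono fun t ht => ht.1) (by simp [hb0])
  have h6 := hc.unique (h5.congr_of_eventuallyEq (hab.mono fun t ht => ht.2.symm))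
  rw [h6, hw, map_zero]

/-- Around each point of the guard there is a glue pair. -/
theorem exists_isGluePair [∀ j, T2Space (M j)] {H : HybridSystem n M} (hH : H.IsGluable)
    {x : Σ j, M j} (hx : x ∈ H.G) :
    ∃ (φ ψ : OpenPartialHomeomorph (Σ j, M j) (EuclideanHalfSpace n)) (δ : ℝ),
      H.IsGluePair φ ψ δ ∧ x ∈ φ.source ∧ φ.extend (𝓡∂ n) x = 0 := by
  have hRx : H.R x ∈ H.R '' H.G := mem_image_of_mem _ hx
  obtain ⟨φ, hφ, hxφ, hx0⟩ := exists_isFlowChart H.contMDiff_F (q := x)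
    (by rw [hH.boundary_eq]; exact Or.inl hx) (c := -1) (by norm_num) (by
      have := hH.outward x hx _ (IsManifold.chart_mem_maximalAtlas x) (mem_chart_source _ x)
      linarith)
  obtain ⟨ψ₀, hψ₀, hxψ₀, hRx0⟩ := exists_isFlowChart H.contMDiff_F (q := H.R x)
    (by rw [hH.boundary_eq]; exact Or.inr hRx) (c := 1) (by norm_num) (by
      have := hH.inward _ hRx _ (IsManifold.chart_mem_maximalAtlas _) (mem_chart_source _ _)
      linarith)
  obtain ⟨U, hU, h0U, hb, hUm⟩ := exists_contDiffOn_resetInCharts hφ hψ₀ hx hxφ hx0 hxψ₀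
  have hb0' := ((hb.contDiffAt (hU.mem_nhds h0U)).differentiableAt (by simp)).hasFDerivAt
  have hinj := injective_of_hasFDerivAt_resetInCharts hH hφ hψ₀ hx hxφ hx0 hxψ₀ hRx0 hb0'
  -- An injective endomorphism of a finite-dimensional space is invertible, so the inverse function
  -- theorem applies.
  obtain ⟨e, h0e, heU, hecoe, hes, hinv⟩ := hb.exists_openPartialHomeomorph hU h0U
    (f' := (LinearEquiv.ofInjectiveEndo (fderiv ℝ (H.resetInCharts φ ψ₀) 0 :
      EuclideanSpace ℝ (Fin n) →ₗ[ℝ] EuclideanSpace ℝ (Fin n)) hinj).toContinuousLinearEquiv) (by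
      convert hb0' using 1
      ext z
      rfl)
  have hle : ∀ z ∈ e.source, normalForm n (e z) = normalForm n z := by
    intro z hz
    rw [hecoe]
    exact normalForm_resetInCharts hH hψ₀ (hUm z (heU hz)).2.1 (hUm z (heU hz)).2.2
  have he : IsHalfSpaceDiffeo (normalForm n) e :=
    { contDiffOn := by rw [hecoe]; exact hb.mono heU
      contDiffOn_symm := hes
      nonneg_iff := fun z hz => by rw [hle z hz]
      eq_zero_iff := fun z hz => by rw [hle z hz] }
  -- Composing `ψ₀` with the inverse of the reset map in coordinates turns the reset map into the
  -- identity, and it keeps the field equal to the unit normal.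
  have hψ₁ : IsFlowChart H.F 1 (transHalfSpace ψ₀ he.symm) := by
    refine hψ₀.transHalfSpace he.symm fun z hz => ?_
    obtain ⟨g, hg⟩ := hinv _ (e.map_target hz)
    have hgv : g (normalVec n) = normalVec n := by
      have hc : HasDerivAt (fun t : ℝ => e.symm z + t • normalVec n) (normalVec n) 0 := by
        simpa using ((hasDerivAt_id (0 : ℝ)).smul_const (normalVec n)).const_add (e.symm z)
      have h1 := hg.comp_hasDerivAt_of_eq (0 : ℝ) hc (by simp)
      have h2 : HasDerivAt (fun t : ℝ => H.resetInCharts φ ψ₀ (e.symm z) + t • normalVec n)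
          (normalVec n) 0 := by
        simpa using ((hasDerivAt_id (0 : ℝ)).smul_const (normalVec n)).const_add
          (H.resetInCharts φ ψ₀ (e.symm z))
      refine h1.unique (h2.congr_of_eventuallyEq (Eventually.of_forall fun t => ?_))
      exact H.resetInCharts_add_smul φ ψ₀ _ t
    refine ⟨(g.symm : EuclideanSpace ℝ (Fin n) →L[ℝ] EuclideanSpace ℝ (Fin n)),
      e.hasFDerivAt_symm hz (by rw [hecoe]; exact hg), ?_⟩
    exact g.symm_apply_eq.2 hgv.symm
  set ψ₁ := transHalfSpace ψ₀ he.symm with hψ₁def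
  have hbz : ∀ z ∈ e.source, normalForm n z = 0 →
      H.R (φ.symm ((𝓡∂ n).symm z)) ∈ ψ₁.source ∧
        ψ₁.extend (𝓡∂ n) (H.R (φ.symm ((𝓡∂ n).symm z))) = z := by
    intro z hz hz0
    obtain ⟨h1, h2, h3⟩ := hUm z (heU hz)
    simp only [hz0, zero_smul, sub_zero] at h1 h2 h3
    have h4 : e z = ψ₀.extend (𝓡∂ n) (H.R (φ.symm ((𝓡∂ n).symm z))) := by
      rw [hecoe, resetInCharts_of_normalForm_eq_zero _ _ _ hz0]
    have h5 : H.R (φ.symm ((𝓡∂ n).symm z)) ∈ ψ₁.source := by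
      rw [hψ₁def, mem_transHalfSpace_source he.symm, ← h4]
      exact ⟨h3, e.map_source hz⟩
    refine ⟨h5, ?_⟩
    rw [hψ₁def, transHalfSpace_extend he.symm h5, ← h4]
    exact e.left_inv hz
  have hm0 : φ.symm ((𝓡∂ n).symm 0) = x := extend_symm_apply_of_eq hxφ hx0
  obtain ⟨hRxs, hRx1⟩ := hbz 0 h0e (map_zero _)
  rw [hm0] at hRxs hRx1
  have hne : x ≠ H.R x := fun h => disjoint_left.1 hH.disjoint hx (h ▸ hRx)
  obtain ⟨O₁, O₂, hO₁, hO₂, hx1, hx2, hO⟩ := t2_separation hne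
  have hφx : φ x = (𝓡∂ n).symm 0 := by
    rw [← hx0]
    exact ((𝓡∂ n).left_inv _).symm
  have hψx : ψ₁ (H.R x) = (𝓡∂ n).symm 0 := by
    rw [← hRx1]
    exact ((𝓡∂ n).left_inv _).symm
  -- The radius `δ` must keep the half ball inside both targets, keep the two domains in the
  -- disjoint sets `O₁` and `O₂`, and stay where the inverse function theorem holds.
  have hN : (φ.target ∩ φ.symm ⁻¹' O₁) ∩ (ψ₁.target ∩ ψ₁.symm ⁻¹' O₂) ∩ (𝓡∂ n) ⁻¹' e.source
      ∈ 𝓝 ((𝓡∂ n).symm 0 : EuclideanHalfSpace n) := by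
    refine (((φ.isOpen_inter_preimage_symm hO₁).inter (ψ₁.isOpen_inter_preimage_symm hO₂)).inter
      (e.open_source.preimage (𝓡∂ n).continuous)).mem_nhds ⟨⟨⟨?_, ?_⟩, ?_, ?_⟩, ?_⟩
    · rw [← hφx]; exact φ.map_source hxφ
    · rw [mem_preimage, hm0]; exact hx1
    · rw [← hψx]; exact ψ₁.map_source hRxs
    · rw [mem_preimage, extend_symm_apply_of_eq hRxs hRx1]; exact hx2
    · rw [mem_preimage, modelWithCorners_symm_right_inv (map_zero _).ge]; exact h0e
  obtain ⟨δ, hδ, hball⟩ : ∃ δ > 0, (𝓡∂ n) ⁻¹' Metric.ball (0 : EuclideanSpace ℝ (Fin n)) δ ⊆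
      (φ.target ∩ φ.symm ⁻¹' O₁) ∩ (ψ₁.target ∩ ψ₁.symm ⁻¹' O₂) ∩ (𝓡∂ n) ⁻¹' e.source := by
    rw [(𝓡∂ n).isClosedEmbedding.isInducing.nhds_eq_comap,
      modelWithCorners_symm_right_inv (map_zero _).ge] at hN
    obtain ⟨δ, hδ, h⟩ := (Metric.nhds_basis_ball.comap (𝓡∂ n)).mem_iff.1 hN
    exact ⟨δ, hδ, h⟩
  have hopen : IsOpen ((𝓡∂ n) ⁻¹' Metric.ball (0 : EuclideanSpace ℝ (Fin n)) δ) :=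
    Metric.isOpen_ball.preimage (𝓡∂ n).continuous
  have htl : (restrTarget φ _ hopen).target = (𝓡∂ n) ⁻¹' Metric.ball 0 δ :=
    inter_eq_right.2 fun h hh => (hball hh).1.1.1
  have htr : (restrTarget ψ₁ _ hopen).target = (𝓡∂ n) ⁻¹' Metric.ball 0 δ :=
    inter_eq_right.2 fun h hh => (hball hh).1.2.1
  refine ⟨restrTarget φ _ hopen, restrTarget ψ₁ _ hopen, δ,
    ⟨hδ, hφ.restrTarget _ hopen, hψ₁.restrTarget _ hopen, htl, htr, ?_, ?_, ?_⟩, ?_, hx0⟩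
  · rw [disjoint_left]
    intro p hp1 hp2
    obtain ⟨h1, h2⟩ := restrTarget_mem_source hp1
    obtain ⟨h3, h4⟩ := restrTarget_mem_source hp2
    have h5 := (hball h2).1.1.2
    have h6 := (hball h4).1.2.2
    rw [mem_preimage, φ.left_inv h1] at h5
    rw [mem_preimage, ψ₁.left_inv h3] at h6
    exact disjoint_left.1 hO h5 h6
  · intro h hh h0
    rw [htl] at hh
    have h1 := (hUm _ (heU (hball hh).2)).2.1
    rw [h0, zero_smul, sub_zero, (𝓡∂ n).left_inv] at h1
    exact h1
  · intro h hh h0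
    rw [htl] at hh
    obtain ⟨h1, h2⟩ := hbz _ (hball hh).2 h0
    have h3 := extend_symm_apply_of_eq h1 h2
    rw [(𝓡∂ n).left_inv] at h3
    exact h3.symm
  · have h1 : φ x ∈ (restrTarget φ _ hopen).target := by
      rw [htl, mem_preimage]
      change φ.extend (𝓡∂ n) x ∈ _
      rw [hx0]
      exact Metric.mem_ball_self hδ
    have h2 := (restrTarget φ _ hopen).map_target h1
    have h3 : (restrTarget φ _ hopen).symm (φ x) = x := φ.left_inv hxφ
    rwa [h3] at h2

end HybridSystem

/-! ### Topology of the quotient -/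

/-- The image of a normal `T1` space under a closed continuous map is Hausdorff. -/
lemma IsClosedMap.t2Space {X Y : Type*} [TopologicalSpace X] [TopologicalSpace Y] [NormalSpace X]
    [T1Space X] {f : X → Y} (hf : IsClosedMap f) (hc : Continuous f)
    (hs : Function.Surjective f) : T2Space Y := by
  refine ⟨fun y₁ y₂ hne => ?_⟩
  obtain ⟨x₁, rfl⟩ := hs y₁
  obtain ⟨x₂, rfl⟩ := hs y₂
  have hcl : ∀ x, IsClosed (f ⁻¹' {f x}) := fun x => by
    rw [← image_singleton]
    exact (hf _ isClosed_singleton).preimage hc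
  have hd : Disjoint (f ⁻¹' {f x₁}) (f ⁻¹' {f x₂}) :=
    Disjoint.preimage f (disjoint_singleton.2 hne)
  obtain ⟨U, V, hU, hV, h1, h2, hUV⟩ := normal_separation (hcl x₁) (hcl x₂) hd
  -- `kernImage f U` consists of the points whose whole fibre lies in `U`; it is open because `f` is
  -- closed.
  refine ⟨kernImage f U, kernImage f V, isClosedMap_iff_kernImage.1 hf hU,
    isClosedMap_iff_kernImage.1 hf hV, fun x hx => h1 hx, fun x hx => h2 hx, ?_⟩
  rw [disjoint_left]
  intro y hy1 hy2
  obtain ⟨x, rfl⟩ := hs y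
  exact disjoint_left.1 hUV (hy1 rfl) (hy2 rfl)

namespace HybridSystem

variable {n : ℕ} [NeZero n] {J : Type*} {M : J → Type*}
  [∀ j, TopologicalSpace (M j)] [∀ j, ChartedSpace (EuclideanHalfSpace n) (M j)]
  [∀ j, IsManifold (𝓡∂ n) ∞ (M j)] {H : HybridSystem n M}

lemma IsGluable.injOn (hH : H.IsGluable) : InjOn H.R H.G := by
  obtain ⟨S, -, hS⟩ := hH.diffeo
  intro x hx y hy h
  rw [← hS x hx, h, hS y hy]

lemma IsGluable.reset_notMem (hH : H.IsGluable) {x : Σ j, M j} (hx : x ∈ H.G) : H.R x ∉ H.G :=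
  fun h => disjoint_left.1 hH.disjoint h (mem_image_of_mem _ hx)

lemma IsGluable.guard_subset (hH : H.IsGluable) : H.G ⊆ (𝓡∂ n).boundary (Σ j, M j) := by
  rw [hH.boundary_eq]
  exact subset_union_left

lemma IsGluable.image_subset (hH : H.IsGluable) :
    H.R '' H.G ⊆ (𝓡∂ n).boundary (Σ j, M j) := by
  rw [hH.boundary_eq]
  exact subset_union_right

/-- The gluing relation is already transitive: two identifications cannot be chained from `G` to
`R(G)` and onwards since these sets are disjoint, and two guard points with the same image coincide.
-/
lemma IsGluable.proj_eq_iff (hH : H.IsGluable) {x y : Σ j, M j} :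
    H.proj x = H.proj y ↔ H.GluingRel x y := by
  have h : Equivalence H.GluingRel := by
    refine ⟨fun x => Or.inr (Or.inr rfl), ?_, ?_⟩
    · rintro x y (h | h | h)
      exacts [Or.inr (Or.inl h), Or.inl h, Or.inr (Or.inr h.symm)]
    · rintro x y z (⟨hx, rfl⟩ | ⟨hy, rfl⟩ | rfl) (⟨h1, rfl⟩ | ⟨h1, h2⟩ | rfl)
      · exact (hH.reset_notMem hx h1).elim
      · exact Or.inr (Or.inr (hH.injOn h1 hx h2).symm)
      · exact Or.inl ⟨hx, rfl⟩
      · exact Or.inr (Or.inr rfl)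
      · exact (hH.reset_notMem h1 (h2 ▸ hy)).elim
      · exact Or.inr (Or.inl ⟨hy, rfl⟩)
      · exact Or.inl ⟨h1, rfl⟩
      · exact Or.inr (Or.inl ⟨h1, h2⟩)
      · exact Or.inr (Or.inr rfl)
  exact Quot.eq.trans h.eqvGen_iff

lemma proj_reset {x : Σ j, M j} (hx : x ∈ H.G) : H.proj (H.R x) = H.proj x :=
  (Quot.sound (r := H.GluingRel) (Or.inl ⟨hx, rfl⟩)).symm

lemma IsGluable.eq_of_proj_eq (hH : H.IsGluable) {x y : Σ j, M j}
    (hx : x ∉ (𝓡∂ n).boundary (Σ j, M j)) (h : H.proj x = H.proj y) : x = y := by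
  rcases hH.proj_eq_iff.1 h with ⟨h1, -⟩ | ⟨h1, rfl⟩ | h1
  · exact (hx (hH.guard_subset h1)).elim
  · exact (hx (hH.image_subset (mem_image_of_mem _ h1))).elim
  · exact h1

variable (H) in
lemma isQuotientMap_proj : Topology.IsQuotientMap H.proj := isQuotientMap_quot_mk

variable (H) in
lemma surjective_proj : Function.Surjective H.proj := Quot.mk_surjective

section GluePair

variable {φ ψ : OpenPartialHomeomorph (Σ j, M j) (EuclideanHalfSpace n)} {δ : ℝ}

lemma IsGluePair.mem_guard_of_mem_boundary (h : H.IsGluePair φ ψ δ) {p : Σ j, M j}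
    (hp : p ∈ φ.source) (hb : p ∈ (𝓡∂ n).boundary (Σ j, M j)) : p ∈ H.G := by
  have h1 := h.mem_guard _ (φ.map_source hp) ((h.left.boundary_iff p hp).1 hb)
  rwa [φ.left_inv hp] at h1

lemma IsGluePair.target_eq (h : H.IsGluePair φ ψ δ) : φ.target = ψ.target :=
  h.target_left.trans h.target_right.symm

lemma IsGluePair.reset_eq (h : H.IsGluePair φ ψ δ) {p : Σ j, M j}
    (hp : p ∈ φ.source) (hG : p ∈ (𝓡∂ n).boundary (Σ j, M j)) : H.R p = ψ.symm (φ p) := by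
  have h1 := h.reset _ (φ.map_source hp) ((h.left.boundary_iff p hp).1 hG)
  rwa [φ.left_inv hp] at h1

lemma IsGluePair.reset_mem (h : H.IsGluePair φ ψ δ) {p : Σ j, M j}
    (hp : p ∈ φ.source) (hG : p ∈ (𝓡∂ n).boundary (Σ j, M j)) : H.R p ∈ ψ.source := by
  rw [h.reset_eq hp hG]
  exact ψ.map_target (h.target_eq ▸ φ.map_source hp)

lemma IsGluePair.apply_reset (h : H.IsGluePair φ ψ δ) {p : Σ j, M j}
    (hp : p ∈ φ.source) (hG : p ∈ (𝓡∂ n).boundary (Σ j, M j)) : ψ (H.R p) = φ p := by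
  rw [h.reset_eq hp hG]
  exact ψ.right_inv (h.target_eq ▸ φ.map_source hp)

lemma IsGluePair.exists_reset_eq (h : H.IsGluePair φ ψ δ) {p : Σ j, M j}
    (hp : p ∈ ψ.source) (hb : p ∈ (𝓡∂ n).boundary (Σ j, M j)) :
    ∃ q ∈ φ.source, q ∈ H.G ∧ H.R q = p := by
  have h0 := (h.right.boundary_iff p hp).1 hb
  have ht : ψ p ∈ φ.target := h.target_eq ▸ ψ.map_source hp
  refine ⟨φ.symm (ψ p), φ.map_target ht, h.mem_guard _ ht h0, ?_⟩
  rw [h.reset _ ht h0, ψ.left_inv hp]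

lemma IsGluePair.disjoint_source_image (h : H.IsGluePair φ ψ δ) (hH : H.IsGluable) :
    Disjoint φ.source (H.R '' H.G) := by
  rw [disjoint_left]
  intro p hp hpR
  exact disjoint_left.1 hH.disjoint
    (h.mem_guard_of_mem_boundary hp (hH.image_subset hpR)) hpR

lemma IsGluePair.disjoint_source_guard (h : H.IsGluePair φ ψ δ) (hH : H.IsGluable) :
    Disjoint ψ.source H.G := by
  rw [disjoint_left]
  intro p hp hpG
  obtain ⟨q, -, hqG, rfl⟩ := h.exists_reset_eq hp (hH.guard_subset hpG)
  exact hH.reset_notMem hqG hpG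

end GluePair

lemma isClosed_boundary_sigma : IsClosed ((𝓡∂ n).boundary (Σ j, M j)) :=
  ModelWithCorners.isClosed_boundary (n := ∞) (by simp)

variable [∀ j, T2Space (M j)]

/-- A limit point of `G` lies on the boundary. It cannot belong to `R(G)`, where the second chart of
a glue pair is a neighbourhood that misses `G`. -/
lemma IsGluable.isClosed_guard (hH : H.IsGluable) : IsClosed H.G := by
  refine isClosed_of_closure_subset fun x hx => ?_
  have hb : x ∈ (𝓡∂ n).boundary (Σ j, M j) :=
    closure_minimal hH.guard_subset isClosed_boundary_sigma hx
  rw [hH.boundary_eq] at hb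
  refine hb.resolve_right ?_
  rintro ⟨p, hp, rfl⟩
  obtain ⟨φ, ψ, δ, h, hpφ, -⟩ := exists_isGluePair hH hp
  obtain ⟨q, hq1, hq2⟩ := mem_closure_iff.1 hx ψ.source ψ.open_source
    (h.reset_mem hpφ (hH.guard_subset hp))
  exact disjoint_left.1 (h.disjoint_source_guard hH) hq1 hq2

lemma IsGluable.isClosed_image (hH : H.IsGluable) : IsClosed (H.R '' H.G) := by
  refine isClosed_of_closure_subset fun x hx => ?_
  have hb : x ∈ (𝓡∂ n).boundary (Σ j, M j) :=
    closure_minimal hH.image_subset isClosed_boundary_sigma hx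
  rw [hH.boundary_eq] at hb
  refine hb.resolve_left fun hp => ?_
  obtain ⟨φ, ψ, δ, h, hpφ, -⟩ := exists_isGluePair hH hp
  obtain ⟨q, hq1, hq2⟩ := mem_closure_iff.1 hx φ.source φ.open_source hpφ
  exact disjoint_left.1 (h.disjoint_source_image hH) hq1 hq2

/-- The saturation of a closed set adds to it its image and its preimage under the reset map. Both
are closed, as `G` and `R(G)` are closed and `R` and its inverse `S` are continuous on them. -/
lemma IsGluable.isClosedMap_proj (hH : H.IsGluable) : IsClosedMap H.proj := by
  intro C hC
  rw [← H.isQuotientMap_proj.isClosed_preimage]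
  obtain ⟨S, hS, hSR⟩ := hH.diffeo
  have h1 : H.proj ⁻¹' (H.proj '' C) = C ∪ (H.R '' H.G ∩ S ⁻¹' C) ∪ (H.G ∩ H.R ⁻¹' C) := by
    ext x
    constructor
    · rintro ⟨y, hy, hyx⟩
      rcases hH.proj_eq_iff.1 hyx with ⟨h1, rfl⟩ | ⟨h1, rfl⟩ | rfl
      · exact Or.inl (Or.inr ⟨mem_image_of_mem _ h1, by rwa [mem_preimage, hSR y h1]⟩)
      · exact Or.inr ⟨h1, hy⟩
      · exact Or.inl (Or.inl hy)
    · rintro ((h | ⟨⟨y, hy, rfl⟩, h⟩) | ⟨h1, h2⟩)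
      · exact ⟨x, h, rfl⟩
      · rw [mem_preimage, hSR y hy] at h
        exact ⟨y, h, (proj_reset hy).symm⟩
      · exact ⟨H.R x, h2, proj_reset h1⟩
  rw [h1]
  exact (hC.union (hS.continuousOn.preimage_isClosed_of_isClosed hH.isClosed_image hC)).union
    (H.contMDiffOn_R.continuousOn.preimage_isClosed_of_isClosed hH.isClosed_guard hC)

variable [Finite J] [∀ j, SecondCountableTopology (M j)]

lemma IsGluable.t2Space_glued (hH : H.IsGluable) : T2Space H.Glued := by
  have : LocallyCompactSpace (EuclideanHalfSpace n) := (𝓡∂ n).locallyCompactSpace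
  have : LocallyCompactSpace (Σ j, M j) :=
    ChartedSpace.locallyCompactSpace (EuclideanHalfSpace n) _
  have : NormalSpace (Σ j, M j) := inferInstance
  exact hH.isClosedMap_proj.t2Space H.isQuotientMap_proj.continuous H.surjective_proj

-- Unlike second countability, σ-compactness passes to every quotient; together with Euclidean
-- charts it yields second countability of the glued space.
omit [∀ j, T2Space (M j)] in
variable (H) in
lemma sigmaCompactSpace_glued : SigmaCompactSpace H.Glued := by
  have : LocallyCompactSpace (EuclideanHalfSpace n) := (𝓡∂ n).locallyCompactSpace
  have : LocallyCompactSpace (Σ j, M j) :=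
    ChartedSpace.locallyCompactSpace (EuclideanHalfSpace n) _
  have : SigmaCompactSpace (Σ j, M j) := inferInstance
  rw [← isSigmaCompact_univ_iff, ← H.surjective_proj.range_eq]
  exact isSigmaCompact_range H.isQuotientMap_proj.continuous

end HybridSystem

/-! ### Charts on a quotient -/

/-- A map that is defined on an open saturated set and is compatible with a quotient map descends
to a local homeomorphism of the quotient, if it has a continuous inverse. -/
lemma Topology.IsQuotientMap.exists_openPartialHomeomorph {X Y Z : Type*} [TopologicalSpace X]
    [TopologicalSpace Y] [TopologicalSpace Z] {π : X → Y} (hπ : IsQuotientMap π) {s : Set X}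
    (hs : IsOpen s) {t : Set Z} (ht : IsOpen t) {f : X → Z} {g : Z → Y}
    (hsat : ∀ p ∈ s, ∀ q, π p = π q → q ∈ s ∧ f q = f p) (hf : ContinuousOn f s)
    (hg : ContinuousOn g t) (hgf : ∀ p ∈ s, f p ∈ t ∧ g (f p) = π p)
    (hfg : ∀ w ∈ t, ∃ p ∈ s, f p = w) :
    ∃ e : OpenPartialHomeomorph Y Z, π ⁻¹' e.source = s ∧ e.target = t ∧
      ∀ p ∈ s, e (π p) = f p := by
  have hpre : π ⁻¹' (π '' s) = s := by
    refine subset_antisymm ?_ (subset_preimage_image _ _)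
    rintro q ⟨p, hp, hpq⟩
    exact (hsat p hp q hpq).1
  have hopen : IsOpen (π '' s) := by
    rw [← hπ.isOpen_preimage, hpre]
    exact hs
  -- The chart is evaluated on an arbitrary lift; compatibility of `f` with the fibres makes the
  -- choice immaterial.
  have hF : ∀ p ∈ s, f (Function.surjInv hπ.surjective (π p)) = f p := fun p hp =>
    (hsat p hp _ (Function.surjInv_eq hπ.surjective (π p)).symm).2
  have hmem : ∀ w ∈ t, g w ∈ π '' s ∧ f (Function.surjInv hπ.surjective (g w)) = w := by
    intro w hw
    obtain ⟨p, hp, rfl⟩ := hfg w hw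
    rw [(hgf p hp).2]
    exact ⟨mem_image_of_mem _ hp, hF p hp⟩
  refine ⟨{ toFun := fun y => f (Function.surjInv hπ.surjective y)
            invFun := g
            source := π '' s
            target := t
            map_source' := ?_
            map_target' := fun w hw => (hmem w hw).1
            left_inv' := ?_
            right_inv' := fun w hw => (hmem w hw).2
            open_source := hopen
            open_target := ht
            continuousOn_toFun := ?_
            continuousOn_invFun := hg }, hpre, rfl, hF⟩
  · rintro _ ⟨p, hp, rfl⟩
    rw [hF p hp]
    exact (hgf p hp).1
  · rintro _ ⟨p, hp, rfl⟩
    rw [hF p hp]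
    exact (hgf p hp).2
  · rw [hπ.continuousOn_isOpen_iff hopen, hpre]
    exact hf.congr hF

/-! ### The reflection in the boundary hyperplane -/

section Reflection

variable (n : ℕ) [NeZero n]

/-- The reflection of Euclidean space in the boundary of the half-space. -/
def normalReflection : EuclideanSpace ℝ (Fin n) ≃L[ℝ] EuclideanSpace ℝ (Fin n) :=
  let f : EuclideanSpace ℝ (Fin n) →L[ℝ] EuclideanSpace ℝ (Fin n) :=
    ContinuousLinearMap.id ℝ _ - (2 : ℝ) • (normalForm n).smulRight (normalVec n)
  have hf : ∀ z, f z = z - (2 * normalForm n z) • normalVec n := fun z => by simp [f, mul_smul]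
  have hff : ∀ z, f (f z) = z := fun z => by
    rw [hf (f z), hf z]
    simp only [map_sub, map_smul, normalForm_normalVec, smul_eq_mul]
    module
  ContinuousLinearEquiv.equivOfInverse f f hff hff

variable {n}

lemma normalReflection_apply (z : EuclideanSpace ℝ (Fin n)) :
    normalReflection n z = z - (2 * normalForm n z) • normalVec n := by
  simp [normalReflection, mul_smul]

@[simp] lemma normalReflection_normalReflection (z : EuclideanSpace ℝ (Fin n)) :
    normalReflection n (normalReflection n z) = z :=
  (normalReflection n).left_inv z

@[simp] lemma normalForm_normalReflection (z : EuclideanSpace ℝ (Fin n)) :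
    normalForm n (normalReflection n z) = -normalForm n z := by
  rw [normalReflection_apply, map_sub, map_smul, normalForm_normalVec, smul_eq_mul]
  ring

lemma normalReflection_of_eq_zero {z : EuclideanSpace ℝ (Fin n)} (hz : normalForm n z = 0) :
    normalReflection n z = z := by
  rw [normalReflection_apply, hz, mul_zero, zero_smul, sub_zero]

@[simp] lemma norm_normalReflection (z : EuclideanSpace ℝ (Fin n)) :
    ‖normalReflection n z‖ = ‖z‖ := by
  rw [EuclideanSpace.norm_eq, EuclideanSpace.norm_eq]
  congr 1
  refine Finset.sum_congr rfl fun i _ => ?_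
  congr 1
  rw [normalReflection_apply]
  by_cases hi : i = 0
  · subst hi
    have : (z - (2 * normalForm n z) • normalVec n) 0 = - z 0 := by
      simp [normalForm_apply, normalVec]
      ring
    rw [this, norm_neg]
  · simp [normalVec, hi]

lemma normalReflection_mem_ball {z : EuclideanSpace ℝ (Fin n)} {δ : ℝ} :
    normalReflection n z ∈ Metric.ball (0 : EuclideanSpace ℝ (Fin n)) δ ↔
      z ∈ Metric.ball (0 : EuclideanSpace ℝ (Fin n)) δ := by
  simp

@[simp] lemma norm_normalVec : ‖normalVec n‖ = 1 := by simp [normalVec]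

lemma abs_normalForm_le (z : EuclideanSpace ℝ (Fin n)) : |normalForm n z| ≤ ‖z‖ := by
  have := PiLp.norm_apply_le z 0
  rwa [Real.norm_eq_abs] at this

lemma normalReflection_normalVec : normalReflection n (normalVec n) = -normalVec n := by
  rw [normalReflection_apply, normalForm_normalVec]
  module

end Reflection

/-! ### Inverses of extended charts -/

section ChartInverse

variable {n : ℕ} [NeZero n] {N : Type*} [TopologicalSpace N]
  [ChartedSpace (EuclideanHalfSpace n) N]

omit [ChartedSpace (EuclideanHalfSpace n) N] in
lemma mem_extend_target_iff {φ : OpenPartialHomeomorph N (EuclideanHalfSpace n)}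
    {w : EuclideanSpace ℝ (Fin n)} :
    w ∈ (φ.extend (𝓡∂ n)).target ↔ (𝓡∂ n).symm w ∈ φ.target ∧ 0 ≤ normalForm n w := by
  rw [φ.extend_target, range_euclideanHalfSpace_eq]
  rfl

lemma contMDiffOn_extend_symm_target [IsManifold (𝓡∂ n) ∞ N]
    {φ : OpenPartialHomeomorph N (EuclideanHalfSpace n)}
    (hφ : φ ∈ IsManifold.maximalAtlas (𝓡∂ n) ∞ N) :
    ContMDiffOn 𝓘(ℝ, EuclideanSpace ℝ (Fin n)) (𝓡∂ n) ∞ (φ.extend (𝓡∂ n)).symm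
      (φ.extend (𝓡∂ n)).target := by
  rw [φ.extend_target']
  exact contMDiffOn_extend_symm hφ

omit [ChartedSpace (EuclideanHalfSpace n) N] in
lemma extend_target_mem_nhds {φ : OpenPartialHomeomorph N (EuclideanHalfSpace n)}
    {w : EuclideanSpace ℝ (Fin n)} (hw : w ∈ (φ.extend (𝓡∂ n)).target)
    (h0 : 0 < normalForm n w) : (φ.extend (𝓡∂ n)).target ∈ 𝓝 w := by
  have h1 : IsOpen ((𝓡∂ n).symm ⁻¹' φ.target) := φ.open_target.preimage (𝓡∂ n).continuous_symm
  have h2 : IsOpen {w | 0 < normalForm n w} := isOpen_lt continuous_const (normalForm n).continuous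
  filter_upwards [h1.mem_nhds (mem_extend_target_iff.1 hw).1, h2.mem_nhds h0] with v hv1 hv2
  exact mem_extend_target_iff.2 ⟨hv1, le_of_lt hv2⟩

end ChartInverse

/-! ### Interior charts and glue charts of the quotient -/

namespace HybridSystem

variable {n : ℕ} [NeZero n] {J : Type*} {M : J → Type*}
  [∀ j, TopologicalSpace (M j)] [∀ j, ChartedSpace (EuclideanHalfSpace n) (M j)]
  [∀ j, IsManifold (𝓡∂ n) ∞ (M j)]

/-- The chart of the glued space induced by a chart, away from the boundary. -/
structure IsInteriorChart (H : HybridSystem n M)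
    (φ : OpenPartialHomeomorph (Σ j, M j) (EuclideanHalfSpace n))
    (e : OpenPartialHomeomorph H.Glued (EuclideanSpace ℝ (Fin n))) : Prop where
  mem_atlas : φ ∈ atlas (EuclideanHalfSpace n) (Σ j, M j)
  preimage_source : H.proj ⁻¹' e.source = φ.source \ (𝓡∂ n).boundary (Σ j, M j)
  apply_proj : ∀ p ∈ φ.source \ (𝓡∂ n).boundary (Σ j, M j), e (H.proj p) = φ.extend (𝓡∂ n) p

/-- The chart of the glued space induced by a glue pair: the two half balls are put together to a
ball. -/
structure IsGlueChart (H : HybridSystem n M)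
    (φ ψ : OpenPartialHomeomorph (Σ j, M j) (EuclideanHalfSpace n)) (δ : ℝ)
    (e : OpenPartialHomeomorph H.Glued (EuclideanSpace ℝ (Fin n))) : Prop where
  preimage_source : H.proj ⁻¹' e.source = φ.source ∪ ψ.source
  target_eq : e.target = Metric.ball 0 δ
  apply_left : ∀ p ∈ φ.source, e (H.proj p) = normalReflection n (φ.extend (𝓡∂ n) p)
  apply_right : ∀ p ∈ ψ.source, e (H.proj p) = ψ.extend (𝓡∂ n) p

variable {H : HybridSystem n M}

/-- Nothing is identified off the boundary, so a chart descends once restricted to the points of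
positive normal coordinate. -/
lemma IsGluable.exists_isInteriorChart (hH : H.IsGluable)
    {φ : OpenPartialHomeomorph (Σ j, M j) (EuclideanHalfSpace n)}
    (hφ : φ ∈ atlas (EuclideanHalfSpace n) (Σ j, M j)) :
    ∃ e : OpenPartialHomeomorph H.Glued (EuclideanSpace ℝ (Fin n)), H.IsInteriorChart φ e := by
  have hφ' : φ ∈ IsManifold.maximalAtlas (𝓡∂ n) ∞ (Σ j, M j) :=
    IsManifold.subset_maximalAtlas hφ
  let t : Set (EuclideanSpace ℝ (Fin n)) :=
    (𝓡∂ n).symm ⁻¹' φ.target ∩ {w | 0 < normalForm n w}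
  have ht : ∀ w ∈ t, w ∈ (φ.extend (𝓡∂ n)).target := fun w hw =>
    mem_extend_target_iff.2 ⟨hw.1, le_of_lt hw.2⟩
  obtain ⟨e, he1, -, he3⟩ := H.isQuotientMap_proj.exists_openPartialHomeomorph
    (s := φ.source \ (𝓡∂ n).boundary (Σ j, M j))
    (t := t) (f := φ.extend (𝓡∂ n)) (g := fun w => H.proj ((φ.extend (𝓡∂ n)).symm w))
    (φ.open_source.sdiff isClosed_boundary_sigma)
    ((φ.open_target.preimage (𝓡∂ n).continuous_symm).inter
      (isOpen_lt continuous_const (normalForm n).continuous))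
    (fun p hp q hpq => by
      have := hH.eq_of_proj_eq hp.2 hpq
      subst this
      exact ⟨hp, rfl⟩)
    ((φ.continuousOn_extend).mono (by rw [φ.extend_source]; exact sdiff_subset))
    (H.isQuotientMap_proj.continuous.comp_continuousOn
      ((contMDiffOn_extend_symm_target hφ').continuousOn.mono ht))
    (fun p hp => by
      have h1 := φ.extend_left_inv (I := 𝓡∂ n) hp.1
      refine ⟨⟨?_, ?_⟩, by rw [h1]⟩
      · change (𝓡∂ n).symm ((𝓡∂ n) (φ p)) ∈ φ.target
        rw [(𝓡∂ n).left_inv]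
        exact φ.map_source hp.1
      · refine lt_of_le_of_ne (normalForm_coe_nonneg (φ p)) fun h => hp.2 ?_
        exact (boundary_iff_of_mem_atlas hφ hp.1).2 h.symm)
    (fun w hw => by
      have h1 := (φ.extend (𝓡∂ n)).map_target (ht w hw)
      have h2 := (φ.extend (𝓡∂ n)).right_inv (ht w hw)
      rw [φ.extend_source] at h1
      refine ⟨_, ⟨h1, fun hb => ?_⟩, h2⟩
      rw [boundary_iff_of_mem_atlas hφ h1, h2] at hb
      exact hw.2.ne' hb)
  exact ⟨e, hφ, he1, he3⟩

section GlueChart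

variable {φ ψ : OpenPartialHomeomorph (Σ j, M j) (EuclideanHalfSpace n)} {δ : ℝ}

lemma IsGluePair.mem_target_left (h : H.IsGluePair φ ψ δ) {w : EuclideanSpace ℝ (Fin n)}
    (hw : w ∈ Metric.ball (0 : EuclideanSpace ℝ (Fin n)) δ) (h0 : 0 ≤ normalForm n w) :
    w ∈ (φ.extend (𝓡∂ n)).target := by
  refine mem_extend_target_iff.2 ⟨?_, h0⟩
  rw [h.target_left, mem_preimage, modelWithCorners_symm_right_inv h0]
  exact hw

lemma IsGluePair.mem_target_right (h : H.IsGluePair φ ψ δ) {w : EuclideanSpace ℝ (Fin n)}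
    (hw : w ∈ Metric.ball (0 : EuclideanSpace ℝ (Fin n)) δ) (h0 : 0 ≤ normalForm n w) :
    w ∈ (ψ.extend (𝓡∂ n)).target := by
  refine mem_extend_target_iff.2 ⟨?_, h0⟩
  rw [h.target_right, mem_preimage, modelWithCorners_symm_right_inv h0]
  exact hw

/-- On the common flat face the reset map reads as the identity, so the inverse charts of the two
half balls agree after projection. -/
lemma IsGluePair.proj_symm_eq (h : H.IsGluePair φ ψ δ) {w : EuclideanSpace ℝ (Fin n)}
    (hw : w ∈ Metric.ball (0 : EuclideanSpace ℝ (Fin n)) δ) (h0 : normalForm n w = 0) :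
    H.proj ((φ.extend (𝓡∂ n)).symm w) = H.proj ((ψ.extend (𝓡∂ n)).symm w) := by
  have h1 := (mem_extend_target_iff.1 (h.mem_target_left hw h0.ge)).1
  have h2 : normalForm n ((𝓡∂ n) ((𝓡∂ n).symm w)) = 0 := by
    rw [modelWithCorners_symm_right_inv h0.ge, h0]
  have h3 := h.reset _ h1 h2
  change H.proj (φ.symm ((𝓡∂ n).symm w)) = H.proj (ψ.symm ((𝓡∂ n).symm w))
  rw [← h3, proj_reset (h.mem_guard _ h1 h2)]

lemma IsGluePair.mem_source_of_proj_eq (h : H.IsGluePair φ ψ δ) (hH : H.IsGluable)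
    {p q : Σ j, M j} (hp : p ∈ φ.source ∪ ψ.source) (hpq : H.proj p = H.proj q) (hne : p ≠ q) :
    (p ∈ φ.source ∧ p ∈ (𝓡∂ n).boundary (Σ j, M j) ∧ q ∈ ψ.source ∧ H.R p = q) ∨
    (p ∈ ψ.source ∧ q ∈ φ.source ∧ q ∈ (𝓡∂ n).boundary (Σ j, M j) ∧ H.R q = p) := by
  rcases hH.proj_eq_iff.1 hpq with ⟨h1, rfl⟩ | ⟨h1, rfl⟩ | rfl
  · have hb := hH.guard_subset h1
    have hpφ := hp.resolve_right fun hps => disjoint_left.1 (h.disjoint_source_guard hH) hps h1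
    exact Or.inl ⟨hpφ, hb, h.reset_mem hpφ hb, rfl⟩
  · have hpψ := hp.resolve_left fun hps =>
      disjoint_left.1 (h.disjoint_source_image hH) hps (mem_image_of_mem _ h1)
    obtain ⟨q', hq1, hq2, hq3⟩ :=
      h.exists_reset_eq hpψ (hH.image_subset (mem_image_of_mem _ h1))
    obtain rfl := hH.injOn hq2 h1 hq3
    exact Or.inr ⟨hpψ, hq1, hH.guard_subset h1, rfl⟩
  · exact (hne rfl).elim

theorem IsGluePair.exists_isGlueChart (h : H.IsGluePair φ ψ δ) (hH : H.IsGluable) :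
    ∃ e : OpenPartialHomeomorph H.Glued (EuclideanSpace ℝ (Fin n)), H.IsGlueChart φ ψ δ e := by
  classical
  let f : (Σ j, M j) → EuclideanSpace ℝ (Fin n) := fun p =>
    if p ∈ φ.source then normalReflection n (φ.extend (𝓡∂ n) p) else ψ.extend (𝓡∂ n) p
  -- The image side fills the upper half of the ball, the guard side, reflected, the lower half.
  let g : EuclideanSpace ℝ (Fin n) → H.Glued := fun w =>
    if 0 ≤ normalForm n w then H.proj ((ψ.extend (𝓡∂ n)).symm w)
    else H.proj ((φ.extend (𝓡∂ n)).symm (normalReflection n w))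
  have hfl : ∀ p ∈ φ.source, f p = normalReflection n (φ.extend (𝓡∂ n) p) := fun p hp => if_pos hp
  have hfr : ∀ p ∈ ψ.source, f p = ψ.extend (𝓡∂ n) p := fun p hp =>
    if_neg fun hp' => disjoint_left.1 h.disjoint hp' hp
  have hgr : ∀ w, 0 ≤ normalForm n w → g w = H.proj ((ψ.extend (𝓡∂ n)).symm w) :=
    fun w hw => if_pos hw
  have hgl : ∀ w ∈ Metric.ball (0 : EuclideanSpace ℝ (Fin n)) δ, normalForm n w ≤ 0 →
      g w = H.proj ((φ.extend (𝓡∂ n)).symm (normalReflection n w)) := by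
    intro w hw hw0
    rcases hw0.lt_or_eq with h1 | h1
    · exact if_neg (not_le.2 h1)
    · rw [hgr w h1.ge, normalReflection_of_eq_zero h1, h.proj_symm_eq hw h1]
  have hreset : ∀ p ∈ φ.source, p ∈ (𝓡∂ n).boundary (Σ j, M j) → f (H.R p) = f p := by
    intro p hp hb
    rw [hfl p hp, hfr _ (h.reset_mem hp hb),
      normalReflection_of_eq_zero ((h.left.boundary_iff p hp).1 hb)]
    change (𝓡∂ n) (ψ (H.R p)) = (𝓡∂ n) (φ p)
    rw [h.apply_reset hp hb]
  have hballl : ∀ p ∈ φ.source, φ.extend (𝓡∂ n) p ∈ Metric.ball (0 : EuclideanSpace ℝ (Fin n)) δ :=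
    fun p hp => by
      have h1 := φ.map_source hp
      rwa [h.target_left] at h1
  have hballr : ∀ p ∈ ψ.source, ψ.extend (𝓡∂ n) p ∈ Metric.ball (0 : EuclideanSpace ℝ (Fin n)) δ :=
    fun p hp => by
      have h1 := ψ.map_source hp
      rwa [h.target_right] at h1
  suffices key : ∃ e : OpenPartialHomeomorph H.Glued (EuclideanSpace ℝ (Fin n)),
      H.proj ⁻¹' e.source = φ.source ∪ ψ.source ∧ e.target = Metric.ball 0 δ ∧
      ∀ p ∈ φ.source ∪ ψ.source, e (H.proj p) = f p by
    obtain ⟨e, he1, he2, he3⟩ := key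
    exact ⟨e, he1, he2, fun p hp => (he3 p (Or.inl hp)).trans (hfl p hp),
      fun p hp => (he3 p (Or.inr hp)).trans (hfr p hp)⟩
  refine H.isQuotientMap_proj.exists_openPartialHomeomorph
    (g := g) (φ.open_source.union ψ.open_source) Metric.isOpen_ball ?_ ?_ ?_ ?_ ?_
  · intro p hp q hpq
    by_cases hne : p = q
    · subst hne
      exact ⟨hp, rfl⟩
    rcases h.mem_source_of_proj_eq hH hp hpq hne with ⟨h1, h2, h3, rfl⟩ | ⟨h1, h2, h3, rfl⟩
    · exact ⟨Or.inr h3, hreset p h1 h2⟩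
    · exact ⟨Or.inl h2, (hreset q h2 h3).symm⟩
  · refine ContinuousOn.union_of_isOpen ?_ ?_ φ.open_source ψ.open_source
    · refine ContinuousOn.congr ((normalReflection n).continuous.comp_continuousOn ?_) hfl
      have := φ.continuousOn_extend (I := 𝓡∂ n)
      rwa [φ.extend_source] at this
    · refine ContinuousOn.congr ?_ hfr
      have := ψ.continuousOn_extend (I := 𝓡∂ n)
      rwa [ψ.extend_source] at this
  · have hsub : Metric.ball (0 : EuclideanSpace ℝ (Fin n)) δ =
        (Metric.ball 0 δ ∩ {w | 0 ≤ normalForm n w}) ∪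
          (Metric.ball 0 δ ∩ {w | normalForm n w ≤ 0}) := by
      ext w
      simp only [mem_union, mem_inter_iff, mem_ofPred_eq, ← and_or_left]
      exact ⟨fun hw => ⟨hw, le_total _ _⟩, fun hw => hw.1⟩
    have hcr : ContinuousOn g (Metric.ball 0 δ ∩ {w | 0 ≤ normalForm n w}) := by
      refine ContinuousOn.congr (H.isQuotientMap_proj.continuous.comp_continuousOn
        ((contMDiffOn_extend_symm_target h.right.mem_maximalAtlas).continuousOn.mono
          fun w hw => h.mem_target_right hw.1 hw.2)) fun w hw => hgr w hw.2
    have hcl : ContinuousOn g (Metric.ball 0 δ ∩ {w | normalForm n w ≤ 0}) := by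
      refine ContinuousOn.congr (H.isQuotientMap_proj.continuous.comp_continuousOn
        ((contMDiffOn_extend_symm_target h.left.mem_maximalAtlas).continuousOn.comp
          (normalReflection n).continuous.continuousOn
          fun w hw => h.mem_target_left (normalReflection_mem_ball.2 hw.1) ?_))
        fun w hw => hgl w hw.1 hw.2
      rw [normalForm_normalReflection]
      exact neg_nonneg.2 hw.2
    intro w hw
    -- Pasting over two closed halves: at a point outside the closed set `C`, continuity within `C`
    -- is vacuous.
    have key : ∀ C : Set (EuclideanSpace ℝ (Fin n)), IsClosed C →
        ContinuousOn g (Metric.ball 0 δ ∩ C) → ContinuousWithinAt g (Metric.ball 0 δ ∩ C) w := by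
      intro C hC hgC
      by_cases hwC : w ∈ C
      · exact hgC w ⟨hw, hwC⟩
      · refine continuousWithinAt_of_notMem_closure fun hcl => hwC ?_
        exact hC.closure_subset (closure_mono inter_subset_right hcl)
    rw [hsub]
    exact (key _ (isClosed_le continuous_const (normalForm n).continuous) hcr).union
      (key _ (isClosed_le (normalForm n).continuous continuous_const) hcl)
  · rintro p (hp | hp)
    · have h1 := hballl p hp
      rw [hfl p hp]
      refine ⟨normalReflection_mem_ball.2 h1, ?_⟩
      rw [hgl _ (normalReflection_mem_ball.2 h1), normalReflection_normalReflection,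
        φ.extend_left_inv hp]
      rw [normalForm_normalReflection]
      exact neg_nonpos.2 (normalForm_coe_nonneg (φ p))
    · rw [hfr p hp]
      refine ⟨hballr p hp, ?_⟩
      rw [hgr (ψ.extend (𝓡∂ n) p) (normalForm_coe_nonneg (ψ p)), ψ.extend_left_inv hp]
  · intro w hw
    rcases le_total 0 (normalForm n w) with h0 | h0
    · have h1 := h.mem_target_right hw h0
      have h2 := (ψ.extend (𝓡∂ n)).map_target h1
      rw [ψ.extend_source] at h2
      exact ⟨_, Or.inr h2, (hfr _ h2).trans ((ψ.extend (𝓡∂ n)).right_inv h1)⟩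
    · have h1 : normalReflection n w ∈ (φ.extend (𝓡∂ n)).target := by
        refine h.mem_target_left (normalReflection_mem_ball.2 hw) ?_
        rw [normalForm_normalReflection]
        exact neg_nonneg.2 h0
      have h2 := (φ.extend (𝓡∂ n)).map_target h1
      rw [φ.extend_source] at h2
      refine ⟨_, Or.inl h2, (hfl _ h2).trans ?_⟩
      rw [(φ.extend (𝓡∂ n)).right_inv h1, normalReflection_normalReflection]

end GlueChart

end HybridSystem

/-! ### Maps that straighten the field are affine along normals -/

section Straightening

variable {n : ℕ} [NeZero n] {N : Type*} [TopologicalSpace N]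
  [ChartedSpace (EuclideanHalfSpace n) N] [IsManifold (𝓡∂ n) ∞ N]

/-- In a flow chart, a map which sends the vector field to the unit normal field is affine along
the lines normal to the boundary. -/
lemma IsFlowChart.apply_symm_eq {F : (x : N) → TangentSpace (𝓡∂ n) x} {c : ℝ}
    {φ : OpenPartialHomeomorph N (EuclideanHalfSpace n)} (h : IsFlowChart F c φ) (hc : c * c = 1)
    {f : N → EuclideanSpace ℝ (Fin n)} {s : Set N} (hs : IsOpen s)
    (hf : ContMDiffOn (𝓡∂ n) 𝓘(ℝ, EuclideanSpace ℝ (Fin n)) ∞ f s)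
    (hF : ∀ q ∈ s, (show EuclideanSpace ℝ (Fin n) from
      mfderiv (𝓡∂ n) 𝓘(ℝ, EuclideanSpace ℝ (Fin n)) f q (F q)) = normalVec n)
    {u : EuclideanSpace ℝ (Fin n)} (hu0 : 0 ≤ normalForm n u)
    (hu : ∀ t ∈ Icc 0 (normalForm n u), u - t • normalVec n ∈ (φ.extend (𝓡∂ n)).target ∧
      (φ.extend (𝓡∂ n)).symm (u - t • normalVec n) ∈ s) :
    f ((φ.extend (𝓡∂ n)).symm u) =
      f ((φ.extend (𝓡∂ n)).symm (u - normalForm n u • normalVec n)) +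
        (c * normalForm n u) • normalVec n := by
  let T : Set (EuclideanSpace ℝ (Fin n)) :=
    (φ.extend (𝓡∂ n)).target ∩ (φ.extend (𝓡∂ n)).symm ⁻¹' s
  let g : EuclideanSpace ℝ (Fin n) → EuclideanSpace ℝ (Fin n) :=
    fun w => f ((φ.extend (𝓡∂ n)).symm w)
  have hg : ContDiffOn ℝ ∞ g T := by
    rw [← contMDiffOn_iff_contDiffOn]
    exact hf.comp ((contMDiffOn_extend_symm_target h.mem_maximalAtlas).mono inter_subset_left)
      fun w hw => hw.2
  have hD : ∀ w ∈ T, ∃ D : EuclideanSpace ℝ (Fin n) →L[ℝ] EuclideanSpace ℝ (Fin n),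
      HasFDerivWithinAt g D T w ∧ D (normalVec n) = c • normalVec n := by
    intro w hw
    have h1 := ((hg w hw).differentiableWithinAt (by simp)).hasFDerivWithinAt
    refine ⟨_, h1, ?_⟩
    set D := fderivWithin ℝ g T w
    set p := (φ.extend (𝓡∂ n)).symm w with hp
    have hps : p ∈ φ.source := by
      have := (φ.extend (𝓡∂ n)).map_target hw.1
      rwa [φ.extend_source] at this
    have hpw : φ.extend (𝓡∂ n) p = w := (φ.extend (𝓡∂ n)).right_inv hw.1
    have h2 := ((φ.contMDiffAt_extend h.mem_maximalAtlas hps).mdifferentiableAt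
      (by simp)).hasMFDerivAt
    have hnhds : φ.source ∩ s ∈ 𝓝 p := (φ.open_source.inter hs).mem_nhds ⟨hps, hw.2⟩
    have hleft : ∀ q ∈ φ.source, (φ.extend (𝓡∂ n)).symm (φ.extend (𝓡∂ n) q) = q :=
      fun q hq => φ.extend_left_inv hq
    have h3 : HasMFDerivWithinAt (𝓡∂ n) 𝓘(ℝ, EuclideanSpace ℝ (Fin n)) (g ∘ φ.extend (𝓡∂ n))
        (φ.source ∩ s) p (D.comp (mfderiv (𝓡∂ n) 𝓘(ℝ, EuclideanSpace ℝ (Fin n))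
          (φ.extend (𝓡∂ n)) p)) := by
      refine HasMFDerivWithinAt.comp (u := T) p ?_ h2.hasMFDerivWithinAt ?_
      · rw [hpw]
        exact h1.hasMFDerivWithinAt
      · rintro q ⟨hq1, hq2⟩
        refine ⟨(φ.extend (𝓡∂ n)).map_source (by rwa [φ.extend_source]), ?_⟩
        rw [mem_preimage, hleft q hq1]
        exact hq2
    have h4 := (h3.hasMFDerivAt hnhds).congr_of_eventuallyEq (f₁ := f) (by
      filter_upwards [hnhds] with q hq
      simp only [g, Function.comp_apply, hleft q hq.1])
    -- The chain rule at `p`: `F` reads as `c • normalVec n` in `φ`, while `f` sends it to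
    -- `normalVec n`.
    have h5 : D (c • normalVec n) = normalVec n := by
      refine (congrArg D (h.mfderiv_eq p hps)).symm.trans (Eq.trans ?_ (hF p hw.2))
      exact (DFunLike.congr_fun h4.mfderiv (F p)).symm
    rw [map_smul] at h5
    rw [← one_smul ℝ (D (normalVec n)), ← hc, mul_smul, h5]
  have hcurve : ∀ t : ℝ, HasDerivAt (fun t : ℝ => u - t • normalVec n) (-normalVec n) t :=
    fun t => by simpa using ((hasDerivAt_id t).smul_const (normalVec n)).const_sub u
  -- Moving down the normal changes `g` at the rate `-c` times the normal vector; with the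
  -- compensating term the derivative is zero, so the values at both ends of the segment agree.
  have hk : ∀ t ∈ Icc 0 (normalForm n u),
      HasDerivWithinAt (fun t : ℝ => g (u - t • normalVec n) + (c * t) • normalVec n) 0
        (Icc 0 (normalForm n u)) t := by
    intro t ht
    obtain ⟨D, hD1, hD2⟩ := hD _ (hu t ht)
    have h1 := hD1.comp_hasDerivWithinAt t (hcurve t).hasDerivWithinAt fun t' ht' => hu t' ht'
    have h2 := (((hasDerivAt_id t).const_mul c).smul_const (normalVec n)).hasDerivWithinAt
      (s := Icc 0 (normalForm n u))
    refine (h1.add h2).congr_deriv ?_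
    rw [map_neg, hD2, mul_one, neg_add_cancel]
  have h6 := constant_of_has_deriv_right_zero (fun t ht => (hk t ht).continuousWithinAt)
    (fun t ht => (hk t ⟨ht.1, ht.2.le⟩).mono_of_mem_nhdsWithin
      (Icc_mem_nhdsGE_of_mem ht)) (normalForm n u) ⟨hu0, le_rfl⟩
  simp only [g, mul_zero, zero_smul, sub_zero, add_zero] at h6
  exact h6.symm

end Straightening

/-! ### Smoothness of the transition maps -/

namespace HybridSystem

variable {n : ℕ} [NeZero n] {J : Type*} {M : J → Type*}
  [∀ j, TopologicalSpace (M j)] [∀ j, ChartedSpace (EuclideanHalfSpace n) (M j)]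
  [∀ j, IsManifold (𝓡∂ n) ∞ (M j)]

/-- The charts of the glued space. -/
def IsGluedChart (H : HybridSystem n M)
    (e : OpenPartialHomeomorph H.Glued (EuclideanSpace ℝ (Fin n))) : Prop :=
  (∃ φ, H.IsInteriorChart φ e) ∨ ∃ φ ψ δ, H.IsGluePair φ ψ δ ∧ H.IsGlueChart φ ψ δ e

variable {H : HybridSystem n M}

lemma IsGluable.exists_isGluedChart [∀ j, T2Space (M j)] (hH : H.IsGluable) (y : H.Glued) :
    ∃ e, H.IsGluedChart e ∧ y ∈ e.source := by
  obtain ⟨p, rfl⟩ := H.surjective_proj y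
  have hglue : ∀ q ∈ H.G, ∃ e, H.IsGluedChart e ∧ H.proj q ∈ e.source := by
    intro q hq
    obtain ⟨φ, ψ, δ, h, hqφ, -⟩ := exists_isGluePair hH hq
    obtain ⟨e, he⟩ := h.exists_isGlueChart hH
    refine ⟨e, Or.inr ⟨φ, ψ, δ, h, he⟩, ?_⟩
    rw [← mem_preimage, he.preimage_source]
    exact Or.inl hqφ
  by_cases hp : p ∈ (𝓡∂ n).boundary (Σ j, M j)
  · rw [hH.boundary_eq] at hp
    rcases hp with hp | ⟨q, hq, rfl⟩
    · exact hglue p hp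
    · rw [proj_reset hq]
      exact hglue q hq
  · obtain ⟨e, he⟩ := hH.exists_isInteriorChart (chart_mem_atlas (EuclideanHalfSpace n) p)
    refine ⟨e, Or.inl ⟨_, he⟩, ?_⟩
    rw [← mem_preimage, he.preimage_source]
    exact ⟨mem_chart_source _ p, hp⟩

namespace IsGluedChart

variable {e e' : OpenPartialHomeomorph H.Glued (EuclideanSpace ℝ (Fin n))}

/-- Both kinds of chart of the quotient come from a chart of the disjoint union up to a linear
isomorphism, the identity or the reflection. Most later arguments use only this. -/
lemma exists_chart (he : H.IsGluedChart e) {p : Σ j, M j} (hp : H.proj p ∈ e.source) :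
    ∃ φ ∈ IsManifold.maximalAtlas (𝓡∂ n) ∞ (Σ j, M j), p ∈ φ.source ∧
      (p ∈ (𝓡∂ n).boundary (Σ j, M j) ↔ normalForm n (φ.extend (𝓡∂ n) p) = 0) ∧
      ∃ A : EuclideanSpace ℝ (Fin n) ≃L[ℝ] EuclideanSpace ℝ (Fin n),
        ∀ q ∈ φ.source, H.proj q ∈ e.source → e (H.proj q) = A (φ.extend (𝓡∂ n) q) := by
  rw [← mem_preimage] at hp
  rcases he with ⟨φ, h⟩ | ⟨φ, ψ, δ, h, h'⟩
  · rw [h.preimage_source] at hp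
    refine ⟨φ, IsManifold.subset_maximalAtlas h.mem_atlas, hp.1,
      boundary_iff_of_mem_atlas h.mem_atlas hp.1, .refl ℝ _, fun q hq hqe => ?_⟩
    rw [← mem_preimage, h.preimage_source] at hqe
    exact h.apply_proj q hqe
  · rw [h'.preimage_source] at hp
    rcases hp with hp | hp
    · exact ⟨φ, h.left.mem_maximalAtlas, hp, h.left.boundary_iff p hp, normalReflection n,
        fun q hq _ => h'.apply_left q hq⟩
    · exact ⟨ψ, h.right.mem_maximalAtlas, hp, h.right.boundary_iff p hp, .refl ℝ _,
        fun q hq _ => h'.apply_right q hq⟩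

variable (e) in
lemma isOpen_preimage_source : IsOpen (H.proj ⁻¹' e.source) :=
  e.open_source.preimage H.isQuotientMap_proj.continuous

lemma contMDiffOn (he : H.IsGluedChart e) :
    ContMDiffOn (𝓡∂ n) 𝓘(ℝ, EuclideanSpace ℝ (Fin n)) ∞ (fun p => e (H.proj p))
      (H.proj ⁻¹' e.source) := by
  intro p hp
  obtain ⟨φ, hφ, hpφ, -, A, hA⟩ := he.exists_chart hp
  refine ContMDiffAt.contMDiffWithinAt ?_
  refine ((A.contDiff.contMDiff.contMDiffAt).comp p
    (φ.contMDiffAt_extend hφ hpφ)).congr_of_eventuallyEq ?_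
  filter_upwards [φ.open_source.mem_nhds hpφ, (isOpen_preimage_source e).mem_nhds hp]
    with q hq1 hq2 using hA q hq1 hq2

lemma mdifferentiableAt (he : H.IsGluedChart e) {p : Σ j, M j} (hp : H.proj p ∈ e.source) :
    MDifferentiableAt (𝓡∂ n) 𝓘(ℝ, EuclideanSpace ℝ (Fin n)) (fun p => e (H.proj p)) p :=
  (he.contMDiffOn.contMDiffAt ((isOpen_preimage_source e).mem_nhds hp)).mdifferentiableAt (by simp)

/-- A chart of the glued space around a boundary point is a flow box. -/
lemma mfderiv_eq (he : H.IsGluedChart e) {p q : Σ j, M j}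
    (hb : p ∈ (𝓡∂ n).boundary (Σ j, M j)) (hp : H.proj p ∈ e.source) (hq : H.proj q ∈ e.source) :
    (show EuclideanSpace ℝ (Fin n) from
      mfderiv (𝓡∂ n) 𝓘(ℝ, EuclideanSpace ℝ (Fin n)) (fun p => e (H.proj p)) q (H.F q)) =
      normalVec n := by
  rw [← mem_preimage] at hp hq
  rcases he with ⟨φ, h⟩ | ⟨φ, ψ, δ, h, h'⟩
  · rw [h.preimage_source] at hp
    exact (hp.2 hb).elim
  · rw [h'.preimage_source] at hq
    rcases hq with hq | hq
    · have h1 := ((φ.contMDiffAt_extend h.left.mem_maximalAtlas hq).mdifferentiableAt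
        (by simp)).hasMFDerivAt
      have h2 := HasMFDerivAt.comp q (normalReflection n).hasFDerivAt.hasMFDerivAt h1
      have h3 := h2.congr_of_eventuallyEq (f₁ := fun p => e (H.proj p)) (by
        filter_upwards [φ.open_source.mem_nhds hq] with q' hq' using h'.apply_left q' hq')
      refine (DFunLike.congr_fun h3.mfderiv (H.F q)).trans ?_
      refine (congrArg (normalReflection n) (h.left.mfderiv_eq q hq)).trans ?_
      -- On the guard side the field is minus the normal vector, and the reflection reverses it.
      rw [map_smul, normalReflection_normalVec, neg_smul_neg, one_smul]
    · have h3 : (fun p => e (H.proj p)) =ᶠ[𝓝 q] ψ.extend (𝓡∂ n) := by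
        filter_upwards [ψ.open_source.mem_nhds hq] with q' hq' using h'.apply_right q' hq'
      refine (DFunLike.congr_fun h3.mfderiv_eq (H.F q)).trans ?_
      exact (h.right.mfderiv_eq q hq).trans (one_smul ℝ _)

/-- Away from the boundary, the inverse of a chart lifts to a smooth map. -/
lemma exists_lift (he : H.IsGluedChart e) {p : Σ j, M j}
    (hb : p ∉ (𝓡∂ n).boundary (Σ j, M j)) (hp : H.proj p ∈ e.source) :
    ∃ m : EuclideanSpace ℝ (Fin n) → Σ j, M j,
      ContMDiffAt 𝓘(ℝ, EuclideanSpace ℝ (Fin n)) (𝓡∂ n) ∞ m (e (H.proj p)) ∧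
      m (e (H.proj p)) = p ∧ ∀ᶠ w in 𝓝 (e (H.proj p)), H.proj (m w) = e.symm w := by
  obtain ⟨φ, hφ, hpφ, hpb, A, hA⟩ := he.exists_chart hp
  have hz : A.symm (e (H.proj p)) = φ.extend (𝓡∂ n) p := by
    rw [hA p hpφ hp, A.symm_apply_apply]
  have hzt : φ.extend (𝓡∂ n) p ∈ (φ.extend (𝓡∂ n)).target :=
    (φ.extend (𝓡∂ n)).map_source (by rwa [φ.extend_source])
  have hnhds := extend_target_mem_nhds hzt
    ((normalForm_coe_nonneg (φ p)).lt_of_ne fun h => hb (hpb.2 h.symm))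
  have hm : ContMDiffAt 𝓘(ℝ, EuclideanSpace ℝ (Fin n)) (𝓡∂ n) ∞
      (fun w => (φ.extend (𝓡∂ n)).symm (A.symm w)) (e (H.proj p)) := by
    refine ContMDiffAt.comp (e (H.proj p)) (g := (φ.extend (𝓡∂ n)).symm) ?_
      A.symm.contDiff.contMDiff.contMDiffAt
    rw [hz]
    exact (contMDiffOn_extend_symm_target hφ).contMDiffAt hnhds
  have hmp : (φ.extend (𝓡∂ n)).symm (A.symm (e (H.proj p))) = p := by
    rw [hz]
    exact φ.extend_left_inv hpφ
  refine ⟨_, hm, hmp, ?_⟩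
  have h1 : ∀ᶠ w in 𝓝 (e (H.proj p)), A.symm w ∈ (φ.extend (𝓡∂ n)).target :=
    A.symm.continuous.continuousAt.eventually_mem (by rw [hz]; exact hnhds)
  have h2 : ∀ᶠ w in 𝓝 (e (H.proj p)),
      (φ.extend (𝓡∂ n)).symm (A.symm w) ∈ H.proj ⁻¹' e.source :=
    hm.continuousAt.eventually_mem ((isOpen_preimage_source e).mem_nhds (by
      rw [mem_preimage, hmp]
      exact hp))
  filter_upwards [h1, h2] with w hw1 hw2
  have h3 : (φ.extend (𝓡∂ n)).symm (A.symm w) ∈ φ.source := by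
    have := (φ.extend (𝓡∂ n)).map_target hw1
    rwa [φ.extend_source] at this
  have h4 := hA _ h3 hw2
  rw [(φ.extend (𝓡∂ n)).right_inv hw1, A.apply_symm_apply] at h4
  rw [← e.left_inv hw2, h4]

/-- Transition maps are smooth at the glued points. -/
lemma contDiffAt_of_mem_boundary (he : H.IsGluedChart e) (he' : H.IsGluedChart e')
    {p : Σ j, M j} (hb : p ∈ (𝓡∂ n).boundary (Σ j, M j)) (hp : H.proj p ∈ e.source)
    (hp' : H.proj p ∈ e'.source) : ContDiffAt ℝ ∞ (e' ∘ e.symm) (e (H.proj p)) := by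
  rcases he with ⟨φ, h⟩ | ⟨φ, ψ, δ, h, h'⟩
  · rw [← mem_preimage, h.preimage_source] at hp
    exact (hp.2 hb).elim
  set z := e (H.proj p) with hz
  have hzt : z ∈ e.target := e.map_source hp
  have hz0 : normalForm n z = 0 := by
    have h1 := hp
    rw [← mem_preimage, h'.preimage_source] at h1
    rcases h1 with h1 | h1
    · rw [hz, h'.apply_left p h1, normalForm_normalReflection, (h.left.boundary_iff p h1).1 hb,
        neg_zero]
    · rw [hz, h'.apply_right p h1, (h.right.boundary_iff p h1).1 hb]
  have hopen : IsOpen (e.target ∩ e.symm ⁻¹' e'.source) :=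
    e.symm.isOpen_inter_preimage e'.open_source
  obtain ⟨ε, hε, hball⟩ := Metric.isOpen_iff.1 hopen z
    ⟨hzt, by rw [mem_preimage, hz, e.left_inv hp]; exact hp'⟩
  let s : Set (Σ j, M j) := H.proj ⁻¹' e'.source
  let f : (Σ j, M j) → EuclideanSpace ℝ (Fin n) := fun p => e' (H.proj p)
  have hsr : ∀ w ∈ Metric.ball z ε, 0 ≤ normalForm n w → w ∈ (ψ.extend (𝓡∂ n)).target ∧
      (ψ.extend (𝓡∂ n)).symm w ∈ s ∧ H.proj ((ψ.extend (𝓡∂ n)).symm w) = e.symm w := by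
    intro w hw hw0
    have hwb := hball hw
    have h1 : w ∈ (ψ.extend (𝓡∂ n)).target :=
      h.mem_target_right (h'.target_eq ▸ hwb.1) hw0
    have h2 : (ψ.extend (𝓡∂ n)).symm w ∈ ψ.source := by
      have := (ψ.extend (𝓡∂ n)).map_target h1
      rwa [ψ.extend_source] at this
    have h3 : H.proj ((ψ.extend (𝓡∂ n)).symm w) ∈ e.source := by
      rw [← mem_preimage, h'.preimage_source]
      exact Or.inr h2
    have h4 := h'.apply_right _ h2
    rw [(ψ.extend (𝓡∂ n)).right_inv h1] at h4
    have h5 : H.proj ((ψ.extend (𝓡∂ n)).symm w) = e.symm w := by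
      rw [← e.left_inv h3, h4]
    refine ⟨h1, ?_, h5⟩
    rw [mem_preimage, h5]
    exact hwb.2
  have hsl : ∀ w, normalReflection n w ∈ Metric.ball z ε → 0 ≤ normalForm n w →
      w ∈ (φ.extend (𝓡∂ n)).target ∧ (φ.extend (𝓡∂ n)).symm w ∈ s ∧
        H.proj ((φ.extend (𝓡∂ n)).symm w) = e.symm (normalReflection n w) := by
    intro w hw hw0
    have hwb := hball hw
    have h1 : w ∈ (φ.extend (𝓡∂ n)).target :=
      h.mem_target_left (normalReflection_mem_ball.1 (h'.target_eq ▸ hwb.1)) hw0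
    have h2 : (φ.extend (𝓡∂ n)).symm w ∈ φ.source := by
      have := (φ.extend (𝓡∂ n)).map_target h1
      rwa [φ.extend_source] at this
    have h3 : H.proj ((φ.extend (𝓡∂ n)).symm w) ∈ e.source := by
      rw [← mem_preimage, h'.preimage_source]
      exact Or.inl h2
    have h4 := h'.apply_left _ h2
    rw [(φ.extend (𝓡∂ n)).right_inv h1] at h4
    have h5 : H.proj ((φ.extend (𝓡∂ n)).symm w) = e.symm (normalReflection n w) := by
      rw [← e.left_inv h3, h4]
    refine ⟨h1, ?_, h5⟩
    rw [mem_preimage, h5]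
    exact hwb.2
  have hs : IsOpen s := isOpen_preimage_source e'
  have hfF : ∀ q ∈ s, (show EuclideanSpace ℝ (Fin n) from
      mfderiv (𝓡∂ n) 𝓘(ℝ, EuclideanSpace ℝ (Fin n)) f q (H.F q)) = normalVec n :=
    fun q hq => he'.mfderiv_eq hb hp' hq
  -- Since `z` is on the hyperplane, `|normalForm n u| ≤ ‖u - z‖ < ε / 2`, so the normal segment
  -- below `u` stays within `ε` of `z`.
  have hseg : ∀ u ∈ Metric.ball z (ε / 2), ∀ t, |t| ≤ |normalForm n u| →
      u - t • normalVec n ∈ Metric.ball z ε := by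
    intro u hu t ht
    rw [mem_ball_iff_norm] at hu ⊢
    have h1 : |normalForm n u| ≤ ‖u - z‖ := by
      have := abs_normalForm_le (u - z)
      rwa [map_sub, hz0, sub_zero] at this
    have h2 : u - t • normalVec n - z = (u - z) - t • normalVec n := by module
    rw [h2]
    refine (norm_sub_le _ _).trans_lt ?_
    rw [norm_smul, norm_normalVec, mul_one, Real.norm_eq_abs]
    linarith
  -- One formula for both sides of the seam: the value at the projection to the hyperplane, computed
  -- through `ψ` alone, plus the normal part. For the lower half, the sign of the field and the
  -- reflection cancel.
  have hformula : ∀ u ∈ Metric.ball z (ε / 2), (e' ∘ e.symm) u =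
      f ((ψ.extend (𝓡∂ n)).symm (u - normalForm n u • normalVec n)) +
        normalForm n u • normalVec n := by
    intro u hu
    have huε : u ∈ Metric.ball z ε := Metric.ball_subset_ball (by linarith) hu
    rcases le_total 0 (normalForm n u) with h0 | h0
    · have h1 := h.right.apply_symm_eq (one_mul 1) hs he'.contMDiffOn hfF h0 fun t ht => by
        have h2 := hsr (u - t • normalVec n)
          (hseg u hu t (by rw [abs_of_nonneg ht.1, abs_of_nonneg h0]; exact ht.2))
          (by rw [map_sub, map_smul, normalForm_normalVec]; simpa using ht.2)
        exact ⟨h2.1, h2.2.1⟩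
      rw [one_mul] at h1
      rw [← h1, (hsr u huε h0).2.2]
      rfl
    · have hr0 : 0 ≤ normalForm n (normalReflection n u) := by
        rw [normalForm_normalReflection]
        exact neg_nonneg.2 h0
      have h1 := h.left.apply_symm_eq (u := normalReflection n u) (by norm_num) hs
        he'.contMDiffOn hfF hr0 fun t ht => by
          have h2 := hsl (normalReflection n u - t • normalVec n) (by
              rw [map_sub, normalReflection_normalReflection, map_smul,
                normalReflection_normalVec, smul_neg, ← neg_smul]
              refine hseg u hu (-t) ?_
              rw [normalForm_normalReflection] at ht
              rw [abs_neg, abs_of_nonneg ht.1, abs_of_nonpos h0]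
              exact ht.2)
            (by rw [map_sub, map_smul, normalForm_normalVec]; simpa using ht.2)
          exact ⟨h2.1, h2.2.1⟩
      have h3 : normalReflection n u - normalForm n (normalReflection n u) • normalVec n =
          u - normalForm n u • normalVec n := by
        rw [normalForm_normalReflection, normalReflection_apply]
        module
      have hP0 : normalForm n (u - normalForm n u • normalVec n) = 0 := normalForm_sub_normal u
      have hPr := normalReflection_of_eq_zero hP0
      have hPε := hseg u hu (normalForm n u) le_rfl
      have h4 : f ((φ.extend (𝓡∂ n)).symm (u - normalForm n u • normalVec n)) =
          f ((ψ.extend (𝓡∂ n)).symm (u - normalForm n u • normalVec n)) := by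
        simp only [f]
        rw [(hsl _ (by rw [hPr]; exact hPε) hP0.ge).2.2, hPr, (hsr _ hPε hP0.ge).2.2]
      rw [h3] at h1
      change f _ = f _ + _ at h1
      rw [h4, normalForm_normalReflection, neg_mul_neg, one_mul] at h1
      rw [← h1]
      have h5 := (hsl (normalReflection n u) (by rwa [normalReflection_normalReflection]) hr0).2.2
      simp only [normalReflection_normalReflection, Function.comp_apply] at h5 ⊢
      rw [← h5]
  have hsm : ContDiffOn ℝ ∞ (fun u : EuclideanSpace ℝ (Fin n) =>
      f ((ψ.extend (𝓡∂ n)).symm (u - normalForm n u • normalVec n)) +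
        normalForm n u • normalVec n) (Metric.ball z (ε / 2)) := by
    refine ContDiffOn.add ?_ ((normalForm n).contDiff.smul contDiff_const).contDiffOn
    rw [← contMDiffOn_iff_contDiffOn]
    refine he'.contMDiffOn.comp (t := s) ((contMDiffOn_extend_symm_target
      h.right.mem_maximalAtlas).comp (contDiff_id.sub
        ((normalForm n).contDiff.smul contDiff_const)).contMDiff.contMDiffOn fun u hu => ?_)
      fun u hu => ?_
    · exact (hsr _ (hseg u hu (normalForm n u) le_rfl) (normalForm_sub_normal u).ge).1
    · exact (hsr _ (hseg u hu (normalForm n u) le_rfl) (normalForm_sub_normal u).ge).2.1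
  exact (hsm.congr hformula).contDiffAt (Metric.ball_mem_nhds z (by positivity))

/-- At glued points both charts are flow boxes; elsewhere `e.symm` lifts to the disjoint union,
where `e'` composed with the projection is smooth. -/
lemma contDiffOn_trans (he : H.IsGluedChart e) (he' : H.IsGluedChart e') :
    ContDiffOn ℝ ∞ (e' ∘ e.symm) (e.symm ≫ₕ e').source := by
  rintro z ⟨hz1, hz2⟩
  refine ContDiffAt.contDiffWithinAt ?_
  obtain ⟨p, hp⟩ := H.surjective_proj (e.symm z)
  have hzp : e (H.proj p) = z := by rw [hp, e.right_inv hz1]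
  have hpe : H.proj p ∈ e.source := by rw [hp]; exact e.map_target hz1
  have hpe' : H.proj p ∈ e'.source := by rw [hp]; exact hz2
  rw [← hzp]
  by_cases hb : p ∈ (𝓡∂ n).boundary (Σ j, M j)
  · exact he.contDiffAt_of_mem_boundary he' hb hpe hpe'
  · obtain ⟨m, hm1, hm2, hm3⟩ := he.exists_lift hb hpe
    rw [← contMDiffAt_iff_contDiffAt]
    refine ContMDiffAt.congr_of_eventuallyEq (f := fun w => e' (H.proj (m w))) ?_
      (hm3.mono fun w hw => by simp only [Function.comp_apply, hw])
    refine ContMDiffAt.comp (e (H.proj p)) (g := fun q => e' (H.proj q)) ?_ hm1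
    rw [hm2]
    exact he'.contMDiffOn.contMDiffAt ((isOpen_preimage_source e').mem_nhds hpe')

end IsGluedChart

end HybridSystem

/-! ### Charts of a disjoint union and of its pieces -/

section SigmaChart

variable {n : ℕ} [NeZero n] {J : Type*} {M : J → Type*}
  [∀ j, TopologicalSpace (M j)] [∀ j, ChartedSpace (EuclideanHalfSpace n) (M j)]

lemma sigma_chartAt_apply {j : J} (x y : M j) :
    chartAt (EuclideanHalfSpace n) (⟨j, x⟩ : Σ j, M j) ⟨j, y⟩ =
      chartAt (EuclideanHalfSpace n) x y :=
  OpenPartialHomeomorph.lift_openEmbedding_apply _ _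

lemma sigma_chartAt_symm_apply {j : J} (x : M j) (h : EuclideanHalfSpace n) :
    (chartAt (EuclideanHalfSpace n) (⟨j, x⟩ : Σ j, M j)).symm h =
      ⟨j, (chartAt (EuclideanHalfSpace n) x).symm h⟩ :=
  rfl

/-- The restriction of a chart of a disjoint union to one of the pieces. -/
def sigmaRestr (j : J) [Nonempty (M j)]
    (φ : OpenPartialHomeomorph (Σ j, M j) (EuclideanHalfSpace n)) :
    OpenPartialHomeomorph (M j) (EuclideanHalfSpace n) :=
  (Topology.IsOpenEmbedding.sigmaMk.toOpenPartialHomeomorph (Sigma.mk j)).trans φ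

omit [∀ j, ChartedSpace (EuclideanHalfSpace n) (M j)] in
lemma sigmaRestr_mem_source {j : J} [Nonempty (M j)]
    {φ : OpenPartialHomeomorph (Σ j, M j) (EuclideanHalfSpace n)} {x : M j} :
    x ∈ (sigmaRestr j φ).source ↔ (⟨j, x⟩ : Σ j, M j) ∈ φ.source := by
  simp [sigmaRestr]

variable [∀ j, IsManifold (𝓡∂ n) ∞ (M j)]

lemma contMDiff_sigmaMk (j : J) :
    ContMDiff (𝓡∂ n) (𝓡∂ n) ∞ (Sigma.mk j : M j → Σ j, M j) := by
  intro x
  have h1 : ContMDiffAt (𝓡∂ n) (𝓡∂ n) ∞ (fun y : M j =>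
      (chartAt (EuclideanHalfSpace n) (⟨j, x⟩ : Σ j, M j)).symm
        (chartAt (EuclideanHalfSpace n) x y)) x := by
    refine ContMDiffAt.comp x (contMDiffOn_chart_symm.contMDiffAt ?_)
      (contMDiffOn_chart.contMDiffAt
        ((chartAt (EuclideanHalfSpace n) x).open_source.mem_nhds (mem_chart_source _ x)))
    refine (chartAt (EuclideanHalfSpace n) (⟨j, x⟩ : Σ j, M j)).open_target.mem_nhds ?_
    exact (chartAt (EuclideanHalfSpace n) x).map_source (mem_chart_source _ x)
  refine h1.congr_of_eventuallyEq ?_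
  filter_upwards [(chartAt (EuclideanHalfSpace n) x).open_source.mem_nhds (mem_chart_source _ x)]
    with y hy
  rw [sigma_chartAt_symm_apply, (chartAt (EuclideanHalfSpace n) x).left_inv hy]

/-- The immersion property concerns each piece, so charts of the disjoint union have to be
restricted to charts of the piece. -/
lemma sigmaRestr_mem_maximalAtlas {j : J} [Nonempty (M j)]
    {φ : OpenPartialHomeomorph (Σ j, M j) (EuclideanHalfSpace n)}
    (hφ : φ ∈ IsManifold.maximalAtlas (𝓡∂ n) ∞ (Σ j, M j)) :
    sigmaRestr j φ ∈ IsManifold.maximalAtlas (𝓡∂ n) ∞ (M j) := by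
  refine OpenPartialHomeomorph.mem_maximalAtlas_of_contMDiffOn _ ?_ ?_
  · exact (contMDiffOn_of_mem_maximalAtlas hφ).comp (contMDiff_sigmaMk j).contMDiffOn
      fun x hx => sigmaRestr_mem_source.1 hx
  · intro h hh
    refine ContMDiffAt.contMDiffWithinAt ?_
    set x := (sigmaRestr j φ).symm h with hx
    have hmk : ∀ h ∈ (sigmaRestr j φ).target,
        (⟨j, (sigmaRestr j φ).symm h⟩ : Σ j, M j) = φ.symm h := by
      intro h hh
      have h1 := (sigmaRestr j φ).map_target hh
      have h2 : φ (⟨j, (sigmaRestr j φ).symm h⟩ : Σ j, M j) = h :=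
        (sigmaRestr j φ).right_inv hh
      rw [← φ.left_inv (sigmaRestr_mem_source.1 h1), h2]
    have h1 : ContMDiffAt (𝓡∂ n) (𝓡∂ n) ∞ (fun h => (chartAt (EuclideanHalfSpace n) x).symm
        (chartAt (EuclideanHalfSpace n) (⟨j, x⟩ : Σ j, M j) (φ.symm h))) h := by
      refine ContMDiffAt.comp h (g := (chartAt (EuclideanHalfSpace n) x).symm)
        (contMDiffOn_chart_symm.contMDiffAt ?_) (ContMDiffAt.comp h ?_
          ((contMDiffOn_symm_of_mem_maximalAtlas hφ).contMDiffAt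
            (φ.open_target.mem_nhds hh.1)))
      · rw [← hmk h hh, ← hx, sigma_chartAt_apply]
        exact (chartAt (EuclideanHalfSpace n) x).open_target.mem_nhds
          ((chartAt (EuclideanHalfSpace n) x).map_source (mem_chart_source _ x))
      · rw [← hmk h hh, ← hx]
        exact contMDiffOn_chart.contMDiffAt
          ((chartAt (EuclideanHalfSpace n) (⟨j, x⟩ : Σ j, M j)).open_source.mem_nhds
            (mem_chart_source _ _))
    refine h1.congr_of_eventuallyEq ?_
    have hc : ContinuousAt (sigmaRestr j φ).symm h := (sigmaRestr j φ).symm.continuousAt hh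
    filter_upwards [(sigmaRestr j φ).open_target.mem_nhds hh, hc.eventually_mem
      ((chartAt (EuclideanHalfSpace n) x).open_source.mem_nhds (mem_chart_source _ x))] with k hk hk'
    rw [← hmk k hk, sigma_chartAt_apply, (chartAt (EuclideanHalfSpace n) x).left_inv hk']

end SigmaChart

/-! ### The smooth structure; immersion and embedding -/

namespace HybridSystem

variable {n : ℕ} [NeZero n] {J : Type*} {M : J → Type*}
  [∀ j, TopologicalSpace (M j)] [∀ j, ChartedSpace (EuclideanHalfSpace n) (M j)]
  [∀ j, IsManifold (𝓡∂ n) ∞ (M j)] {H : HybridSystem n M}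

/-- The charts of the glued space make it a charted space. -/
abbrev IsGluable.chartedSpace [∀ j, T2Space (M j)] (hH : H.IsGluable) :
    ChartedSpace (EuclideanSpace ℝ (Fin n)) H.Glued where
  atlas := {e | H.IsGluedChart e}
  chartAt y := (hH.exists_isGluedChart y).choose
  mem_chart_source y := (hH.exists_isGluedChart y).choose_spec.2
  chart_mem_atlas y := (hH.exists_isGluedChart y).choose_spec.1

variable [ChartedSpace (EuclideanSpace ℝ (Fin n)) H.Glued]

lemma isManifold_glued
    (hat : ∀ e ∈ atlas (EuclideanSpace ℝ (Fin n)) H.Glued, H.IsGluedChart e) :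
    IsManifold (𝓡 n) ∞ H.Glued := by
  refine isManifold_of_contDiffOn _ _ _ fun e e' he he' => ?_
  simpa only [mfld_simps] using! (hat e he).contDiffOn_trans (hat e' he')

variable [IsManifold (𝓡 n) ∞ H.Glued]

/-- In suitable charts the projection is a linear isomorphism, so the complement in the normal form
of an immersion is the trivial space `PUnit`. -/
lemma isImmersion_proj
    (hat : ∀ e ∈ atlas (EuclideanSpace ℝ (Fin n)) H.Glued, H.IsGluedChart e) (j : J) :
    Manifold.IsImmersion (𝓡∂ n) (𝓡 n) ∞ (fun x : M j => H.proj ⟨j, x⟩) := by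
  refine ⟨PUnit, inferInstance, inferInstance, fun x => ?_⟩
  have : Nonempty (M j) := ⟨x⟩
  have hcont : Continuous (fun x : M j => H.proj ⟨j, x⟩) :=
    H.isQuotientMap_proj.continuous.comp continuous_sigmaMk
  set e := chartAt (EuclideanSpace ℝ (Fin n)) (H.proj ⟨j, x⟩) with he
  have hex : H.proj ⟨j, x⟩ ∈ e.source := mem_chart_source _ _
  obtain ⟨φ, hφ, hxφ, -, A, hA⟩ := (hat e (chart_mem_atlas _ _)).exists_chart hex
  have hs : IsOpen ((fun x : M j => H.proj ⟨j, x⟩) ⁻¹' e.source) := e.open_source.preimage hcont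
  have hmem : (sigmaRestr j φ).restrOpen _ hs ∈ IsManifold.maximalAtlas (𝓡∂ n) ∞ (M j) := by
    have h1 := sigmaRestr_mem_maximalAtlas (j := j) hφ
    exact OpenPartialHomeomorph.mem_maximalAtlas_of_contMDiffOn _
      ((contMDiffOn_of_mem_maximalAtlas h1).mono fun y hy => hy.1)
      ((contMDiffOn_symm_of_mem_maximalAtlas h1).mono fun w hw => hw.1)
  refine Manifold.IsImmersionAtOfComplement.mk_of_continuousAt hcont.continuousAt
    ((ContinuousLinearEquiv.prodUnique ℝ (EuclideanSpace ℝ (Fin n)) PUnit).trans A)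
    ((sigmaRestr j φ).restrOpen _ hs) e ?_ hex hmem
    (IsManifold.chart_mem_maximalAtlas _) ?_
  · exact ⟨sigmaRestr_mem_source.2 hxφ, hex⟩
  · intro w hw
    have h1 := (((sigmaRestr j φ).restrOpen _ hs).extend (𝓡∂ n)).map_target hw
    have h2 := (((sigmaRestr j φ).restrOpen _ hs).extend (𝓡∂ n)).right_inv hw
    rw [OpenPartialHomeomorph.extend_source] at h1
    have h3 := hA _ (sigmaRestr_mem_source.1 h1.1) h1.2
    refine h3.trans (congrArg A ?_)
    exact h2

-- Without resets from a piece to itself, the projection is injective there; being also a closed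
-- map, it is a closed embedding.
omit [ChartedSpace (EuclideanSpace ℝ (Fin n)) H.Glued] [IsManifold (𝓡 n) ∞ H.Glued] in
lemma IsGluable.isEmbedding_proj [∀ j, T2Space (M j)] (hH : H.IsGluable) {j : J}
    (hj : ∀ x : M j, (⟨j, x⟩ : Σ j, M j) ∈ H.G → (H.R ⟨j, x⟩).1 ≠ j) :
    Topology.IsEmbedding (fun x : M j => H.proj ⟨j, x⟩) := by
  refine (Topology.IsClosedEmbedding.of_continuous_injective_isClosedMap
    (H.isQuotientMap_proj.continuous.comp continuous_sigmaMk) ?_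
    (hH.isClosedMap_proj.comp isClosedMap_sigmaMk)).isEmbedding
  intro x y hxy
  rcases hH.proj_eq_iff.1 hxy with ⟨h1, h2⟩ | ⟨h1, h2⟩ | h1
  · exact (hj x h1 (by rw [h2])).elim
  · exact (hj y h1 (by rw [h2])).elim
  · exact sigma_mk_injective h1

end HybridSystem

/-! ### The vector field on the quotient -/

namespace HybridSystem

variable {n : ℕ} [NeZero n] {J : Type*} {M : J → Type*}
  [∀ j, TopologicalSpace (M j)] [∀ j, ChartedSpace (EuclideanHalfSpace n) (M j)]
  [∀ j, IsManifold (𝓡∂ n) ∞ (M j)] {H : HybridSystem n M}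
  [ChartedSpace (EuclideanSpace ℝ (Fin n)) H.Glued]

lemma contMDiff_proj (hat : ∀ e ∈ atlas (EuclideanSpace ℝ (Fin n)) H.Glued, H.IsGluedChart e) :
    ContMDiff (𝓡∂ n) (𝓡 n) ∞ H.proj := by
  intro p
  rw [contMDiffAt_iff_target]
  refine ⟨H.isQuotientMap_proj.continuous.continuousAt, ?_⟩
  have h1 := hat _ (chart_mem_atlas (EuclideanSpace ℝ (Fin n)) (H.proj p))
  refine (h1.contMDiffOn.contMDiffAt ((IsGluedChart.isOpen_preimage_source _).mem_nhds
    (mem_chart_source _ _))).congr_of_eventuallyEq (Eventually.of_forall fun q => ?_)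
  simp only [mfld_simps]

/-- Tangent vectors of the quotient are read in the preferred chart at the image point. Two lifts of
one point share that chart, so their derivatives can be compared as Euclidean vectors. -/
lemma mfderiv_proj (hat : ∀ e ∈ atlas (EuclideanSpace ℝ (Fin n)) H.Glued, H.IsGluedChart e)
    (p : Σ j, M j) (v : TangentSpace (𝓡∂ n) p) :
    (show EuclideanSpace ℝ (Fin n) from mfderiv (𝓡∂ n) (𝓡 n) H.proj p v) =
      mfderiv (𝓡∂ n) 𝓘(ℝ, EuclideanSpace ℝ (Fin n))
        (fun q => chartAt (EuclideanSpace ℝ (Fin n)) (H.proj p) (H.proj q)) p v := by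
  have h1 : MDifferentiableAt (𝓡∂ n) (𝓡 n) H.proj p :=
    (contMDiff_proj hat p).mdifferentiableAt (by simp)
  have h2 := (hat _ (chart_mem_atlas (EuclideanSpace ℝ (Fin n)) (H.proj p))).mdifferentiableAt
    (mem_chart_source _ (H.proj p))
  have h3 : HasMFDerivAt (𝓡∂ n) 𝓘(ℝ, EuclideanSpace ℝ (Fin n))
      (fun q => chartAt (EuclideanSpace ℝ (Fin n)) (H.proj p) (H.proj q)) p
      (mfderiv (𝓡∂ n) (𝓡 n) H.proj p) := by
    refine ⟨h2.continuousAt, ?_⟩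
    have h4 := h1.hasMFDerivAt.2
    simpa only [writtenInExtChartAt, mfld_simps] using! h4
  exact (DFunLike.congr_fun h3.mfderiv v).symm

/-- The vector field on the glued space. -/
def gluedField (H : HybridSystem n M) [ChartedSpace (EuclideanSpace ℝ (Fin n)) H.Glued]
    (y : H.Glued) : TangentSpace (𝓡 n) y :=
  show EuclideanSpace ℝ (Fin n) from
    mfderiv (𝓡∂ n) (𝓡 n) H.proj (Function.surjInv H.surjective_proj y) (H.F _)

/-- Independence of the lift: an interior point has only one, and at a glued point every lift gives
the unit normal in the flow box. -/
lemma IsGluable.gluedField_proj (hH : H.IsGluable)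
    (hat : ∀ e ∈ atlas (EuclideanSpace ℝ (Fin n)) H.Glued, H.IsGluedChart e) (p : Σ j, M j) :
    H.gluedField (H.proj p) = mfderiv (𝓡∂ n) (𝓡 n) H.proj p (H.F p) := by
  set q := Function.surjInv H.surjective_proj (H.proj p) with hq
  have hqp : H.proj q = H.proj p := Function.surjInv_eq H.surjective_proj (H.proj p)
  have key : (show EuclideanSpace ℝ (Fin n) from mfderiv (𝓡∂ n) (𝓡 n) H.proj q (H.F q)) =
      (show EuclideanSpace ℝ (Fin n) from mfderiv (𝓡∂ n) (𝓡 n) H.proj p (H.F p)) := by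
    by_cases hb : q ∈ (𝓡∂ n).boundary (Σ j, M j)
    · refine (mfderiv_proj hat q (H.F q)).trans (Eq.trans ?_ (mfderiv_proj hat p (H.F p)).symm)
      rw [hqp]
      have he := hat _ (chart_mem_atlas (EuclideanSpace ℝ (Fin n)) (H.proj p))
      have hp := mem_chart_source (EuclideanSpace ℝ (Fin n)) (H.proj p)
      have hq' : H.proj q ∈ (chartAt (EuclideanSpace ℝ (Fin n)) (H.proj p)).source := by
        rw [hqp]; exact hp
      exact (he.mfderiv_eq hb hq' hq').trans (he.mfderiv_eq hb hq' hp).symm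
    · rw [hH.eq_of_proj_eq hb hqp]
  exact key

variable [IsManifold (𝓡 n) ∞ H.Glued]

/-- Near a glued point the field is the image of a constant field under an inverse chart; elsewhere
it is the tangent map of the projection applied to `F` along a smooth local lift. -/
theorem IsGluable.contMDiff_gluedField (hH : H.IsGluable)
    (hat : ∀ e ∈ atlas (EuclideanSpace ℝ (Fin n)) H.Glued, H.IsGluedChart e) :
    ContMDiff (𝓡 n) (𝓡 n).tangent ∞
      (fun y => (⟨y, H.gluedField y⟩ : TangentBundle (𝓡 n) H.Glued)) := by
  have htan : ∀ p : Σ j, M j,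
      (⟨H.proj p, H.gluedField (H.proj p)⟩ : TangentBundle (𝓡 n) H.Glued) =
        tangentMap (𝓡∂ n) (𝓡 n) H.proj ⟨p, H.F p⟩ := fun p => by
    rw [hH.gluedField_proj hat p]
    rfl
  have hsm : ContMDiff (𝓡∂ n).tangent (𝓡 n).tangent ∞ (tangentMap (𝓡∂ n) (𝓡 n) H.proj) :=
    (contMDiff_proj hat).contMDiff_tangentMap (by simp)
  intro y
  obtain ⟨p, rfl⟩ := H.surjective_proj y
  set e := chartAt (EuclideanSpace ℝ (Fin n)) (H.proj p) with he_def
  have he : H.IsGluedChart e := hat _ (chart_mem_atlas _ _)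
  have hp : H.proj p ∈ e.source := mem_chart_source _ _
  have hem : ContMDiffAt (𝓡 n) 𝓘(ℝ, EuclideanSpace ℝ (Fin n)) ∞ e (H.proj p) :=
    contMDiffOn_chart.contMDiffAt (e.open_source.mem_nhds hp)
  by_cases hb : p ∈ (𝓡∂ n).boundary (Σ j, M j)
  · have h1 : ContMDiffOn 𝓘(ℝ, EuclideanSpace ℝ (Fin n)) (𝓡 n) ∞ e.symm e.target :=
      contMDiffOn_chart_symm
    have h2 := h1.contMDiffOn_tangentMapWithin (m := ∞) (by simp)
      e.open_target.uniqueMDiffOn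
    have h3 : ContMDiff 𝓘(ℝ, EuclideanSpace ℝ (Fin n)) 𝓘(ℝ, EuclideanSpace ℝ (Fin n)).tangent ∞
        (fun z => (⟨z, normalVec n⟩ :
          TangentBundle 𝓘(ℝ, EuclideanSpace ℝ (Fin n)) (EuclideanSpace ℝ (Fin n)))) :=
      fun z => contMDiffAt_vectorSpace_iff_contDiffAt.2 contDiffAt_const
    have h4 := h2.comp (h3.comp_contMDiffOn
      (contMDiffOn_chart (I := 𝓡 n) (n := ∞) (x := H.proj p))) fun y hy => e.map_source hy
    refine (h4.contMDiffAt (e.open_source.mem_nhds hp)).congr_of_eventuallyEq ?_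
    filter_upwards [e.open_source.mem_nhds hp] with y hy
    obtain ⟨q, rfl⟩ := H.surjective_proj y
    rw [htan q]
    have hzt : e (H.proj q) ∈ e.target := e.map_source hy
    have h5 : HasMFDerivAt 𝓘(ℝ, EuclideanSpace ℝ (Fin n)) (𝓡 n) e.symm (e (H.proj q))
        (mfderivWithin 𝓘(ℝ, EuclideanSpace ℝ (Fin n)) (𝓡 n) e.symm e.target (e (H.proj q))) :=
      ((h1 _ hzt).mdifferentiableWithinAt (by simp)).hasMFDerivWithinAt.hasMFDerivAt
        (e.open_target.mem_nhds hzt)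
    have h6 := HasMFDerivAt.comp q h5 (he.mdifferentiableAt hy).hasMFDerivAt
    have h7 := h6.congr_of_eventuallyEq (f₁ := H.proj) (by
      filter_upwards [(IsGluedChart.isOpen_preimage_source e).mem_nhds hy] with q' hq'
      exact (e.left_inv hq').symm)
    have h8 : mfderiv (𝓡∂ n) (𝓡 n) H.proj q (H.F q) =
        mfderivWithin 𝓘(ℝ, EuclideanSpace ℝ (Fin n)) (𝓡 n) e.symm e.target (e (H.proj q))
          (normalVec n) := by
      refine (DFunLike.congr_fun h7.mfderiv (H.F q)).trans ?_
      exact congrArg (mfderivWithin 𝓘(ℝ, EuclideanSpace ℝ (Fin n)) (𝓡 n) e.symm e.target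
        (e (H.proj q))) (he.mfderiv_eq hb hp hy)
    simp only [Function.comp_apply, tangentMap, tangentMapWithin]
    refine Bundle.TotalSpace.ext (e.left_inv hy).symm ?_
    exact heq_of_eq h8
  · obtain ⟨m, hm1, hm2, hm3⟩ := he.exists_lift hb hp
    have h1 : ContMDiffAt (𝓡 n) (𝓡 n).tangent ∞ (fun y =>
        tangentMap (𝓡∂ n) (𝓡 n) H.proj (⟨m (e y), H.F (m (e y))⟩ :
          TangentBundle (𝓡∂ n) (Σ j, M j))) (H.proj p) := by
      refine hsm.contMDiffAt.comp (H.proj p) ?_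
      refine H.contMDiff_F.contMDiffAt.comp (H.proj p) (f := fun y => m (e y)) ?_
      exact ContMDiffAt.comp (H.proj p) hm1 hem
    refine h1.congr_of_eventuallyEq ?_
    filter_upwards [e.open_source.mem_nhds hp, (e.continuousAt hp).eventually hm3] with y hy1 hy2
    rw [e.left_inv hy1] at hy2
    rw [← htan, hy2]

end HybridSystem

/-! ### Derivatives of curves at an isolated exceptional time -/

section OneSidedDerivative

variable {E : Type*} [NormedAddCommGroup E] [NormedSpace ℝ E]

lemma Set.OrdConnected.mem_nhds_of_lt_of_lt {T : Set ℝ} (hT : T.OrdConnected) {a s b : ℝ}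
    (ha : a ∈ T) (hb : b ∈ T) (h1 : a < s) (h2 : s < b) : T ∈ 𝓝 s :=
  mem_of_superset (Ioo_mem_nhds h1 h2) (Ioo_subset_Icc_self.trans (hT.out ha hb))

/-- A continuous curve on an interval that has constant derivative at all nearby points has that
derivative at the point itself. -/
lemma hasDerivWithinAt_of_eventually_hasDerivWithinAt {T : Set ℝ} (hT : T.OrdConnected) {t : ℝ}
    (ht : t ∈ T) {y : ℝ → E} {v : E} (hy : ContinuousWithinAt y T t)
    (hd : ∀ᶠ s in 𝓝[≠] t, s ∈ T → HasDerivWithinAt y v T s) : HasDerivWithinAt y v T t := by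
  obtain ⟨ε, hε, hball⟩ := Metric.mem_nhdsWithin_iff.1 hd
  have hd' : ∀ s ∈ T, s ≠ t → |s - t| < ε → HasDerivWithinAt y v T s := fun s hs hne hst =>
    hball ⟨by rwa [Metric.mem_ball, Real.dist_eq], hne⟩ hs
  -- A continuous function whose derivative has a one-sided limit has that limit as one-sided
  -- derivative. If `t` is an end point of `T`, one side is a single point and the claim is void
  -- there.
  have hR : HasDerivWithinAt y v (T ∩ Ici t) t := by
    by_cases h : ∃ b ∈ T, t < b
    · obtain ⟨b, hb, htb⟩ := h
      have hlt : t < min b (t + ε) := lt_min htb (by linarith)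
      have key : ∀ s ∈ Ioo t (min b (t + ε)), HasDerivAt y v s := fun s hs =>
        (hd' s (hT.out ht hb ⟨hs.1.le, (hs.2.trans_le (min_le_left _ _)).le⟩) hs.1.ne'
          (by rw [abs_of_pos (by linarith [hs.1])]
              linarith [hs.2.trans_le (min_le_right b (t + ε))])).hasDerivAt
          (hT.mem_nhds_of_lt_of_lt ht hb hs.1 (hs.2.trans_le (min_le_left _ _)))
      refine (hasDerivWithinAt_Ici_of_tendsto_deriv (s := Ioo t (min b (t + ε)))
        (fun s hs => (key s hs).differentiableAt.differentiableWithinAt)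
        (hy.mono fun s hs => hT.out ht hb ⟨hs.1.le, (hs.2.trans_le (min_le_left _ _)).le⟩)
        (Ioo_mem_nhdsGT hlt) ?_).mono inter_subset_right
      refine tendsto_const_nhds.congr' ?_
      filter_upwards [Ioo_mem_nhdsGT hlt] with s hs using (key s hs).deriv.symm
    · push Not at h
      have : T ∩ Ici t ⊆ {t} := fun s hs => le_antisymm (h s hs.1) hs.2
      exact (hasDerivWithinAt_iff_hasFDerivWithinAt.2
        (HasFDerivWithinAt.of_subsingleton subsingleton_singleton)).mono this
  have hL : HasDerivWithinAt y v (T ∩ Iic t) t := by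
    by_cases h : ∃ b ∈ T, b < t
    · obtain ⟨b, hb, htb⟩ := h
      have hlt : max b (t - ε) < t := max_lt htb (by linarith)
      have key : ∀ s ∈ Ioo (max b (t - ε)) t, HasDerivAt y v s := fun s hs =>
        (hd' s (hT.out hb ht ⟨((le_max_left _ _).trans_lt hs.1).le, hs.2.le⟩) hs.2.ne
          (by rw [abs_of_neg (by linarith [hs.2])]
              linarith [(le_max_right b (t - ε)).trans_lt hs.1])).hasDerivAt
          (hT.mem_nhds_of_lt_of_lt hb ht ((le_max_left _ _).trans_lt hs.1) hs.2)
      refine (hasDerivWithinAt_Iic_of_tendsto_deriv (s := Ioo (max b (t - ε)) t)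
        (fun s hs => (key s hs).differentiableAt.differentiableWithinAt)
        (hy.mono fun s hs => hT.out hb ht ⟨((le_max_left _ _).trans_lt hs.1).le, hs.2.le⟩)
        (Ioo_mem_nhdsLT hlt) ?_).mono inter_subset_right
      refine tendsto_const_nhds.congr' ?_
      filter_upwards [Ioo_mem_nhdsLT hlt] with s hs using (key s hs).deriv.symm
    · push Not at h
      have : T ∩ Iic t ⊆ {t} := fun s hs => le_antisymm hs.2 (h s hs.1)
      exact (hasDerivWithinAt_iff_hasFDerivWithinAt.2
        (HasFDerivWithinAt.of_subsingleton subsingleton_singleton)).mono this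
  exact (hL.union hR).mono fun s hs => (le_total s t).imp (fun h => ⟨hs, h⟩) fun h => ⟨hs, h⟩

end OneSidedDerivative

lemma comp_smulRight_one {E F : Type*} [AddCommGroup E] [Module ℝ E] [TopologicalSpace E]
    [ContinuousSMul ℝ E] [AddCommGroup F] [Module ℝ F] [TopologicalSpace F] [ContinuousSMul ℝ F]
    (L : E →L[ℝ] F) (v : E) :
    L.comp ((1 : ℝ →L[ℝ] ℝ).smulRight v) = (1 : ℝ →L[ℝ] ℝ).smulRight (L v) := by
  ext
  simp

/-! ### Executions project to integral curves -/

namespace HybridSystem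

variable {n : ℕ} [NeZero n] {J : Type*} {M : J → Type*}
  [∀ j, TopologicalSpace (M j)] [∀ j, ChartedSpace (EuclideanHalfSpace n) (M j)]
  [∀ j, IsManifold (𝓡∂ n) ∞ (M j)] {H : HybridSystem n M}

/-- Executions have no jumps shortly before and shortly after a jump. -/
lemma IsExecution.eventually_continuousWithinAt [∀ j, T2Space (M j)] [RegularSpace (Σ j, M j)]
    (hH : H.IsGluable) {T : Set ℝ} {x : ℝ → Σ j, M j} (hx : H.IsExecution T x) {t : ℝ}
    (ht : t ∈ T) {p : Σ j, M j} (hp : p ∈ H.G) (hlim : Tendsto x (𝓝[T ∩ Iio t] t) (𝓝 p))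
    (hR : H.R p = x t) : ∀ᶠ s in 𝓝[≠] t, s ∈ T → ContinuousWithinAt x T s := by
  -- A jump at `s` puts `x s` in `R(G)`; shortly before `t` this is excluded because the left limit
  -- `p` lies outside this closed set.
  have hleft : ∀ᶠ s in 𝓝[T ∩ Iio t] t, x s ∈ (H.R '' H.G)ᶜ :=
    hlim.eventually_mem (hH.isClosed_image.isOpen_compl.mem_nhds
      fun h => disjoint_left.1 hH.disjoint hp h)
  have hxG : x t ∈ H.Gᶜ := by
    rw [← hR]
    exact hH.reset_notMem hp
  -- A closed neighbourhood is needed: after `t`, a jump at `s` has a left limit in `G`, and `W`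
  -- must contain such limits in order to exclude it.
  obtain ⟨W, hW, hWc, hWG⟩ :=
    exists_mem_nhds_isClosed_subset (hH.isClosed_guard.isOpen_compl.mem_nhds hxG)
  have hright : ∀ᶠ s in 𝓝[T ∩ Ici t] t, x s ∈ W := (hx.rightContinuous t ht).eventually_mem hW
  rw [eventually_nhdsWithin_iff] at hleft hright
  obtain ⟨ε, hε, hball⟩ := Metric.eventually_nhds_iff.1 (hleft.and hright)
  rw [eventually_nhdsWithin_iff]
  filter_upwards [Metric.ball_mem_nhds t hε] with s hs hne hsT
  by_contra hcont
  obtain ⟨q, hq, hqlim, hqR⟩ := hx.jump s hsT hcont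
  rcases lt_or_gt_of_ne hne with hst | hst
  · exact (hball hs).1 ⟨hsT, hst⟩ ⟨q, hq, hqR⟩
  · have hsub : Ioo t s ⊆ T ∩ Iio s := fun r hr =>
      ⟨hx.ordConnected.out ht hsT ⟨hr.1.le, hr.2.le⟩, hr.2⟩
    have : (𝓝[Ioo t s] s).NeBot := by
      rw [nhdsWithin_Ioo_eq_nhdsLT hst]
      infer_instance
    refine hWG (hWc.mem_of_tendsto (hqlim.mono_left (nhdsWithin_mono s hsub)) ?_) hq
    filter_upwards [self_mem_nhdsWithin] with r hr
    refine (hball ?_).2 ⟨(hsub hr).1, hr.1.le⟩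
    rw [Metric.mem_ball, Real.dist_eq, abs_of_pos (by linarith)] at hs
    rw [Real.dist_eq, abs_of_pos (by linarith [hr.1])]
    linarith [hr.2]

variable [ChartedSpace (EuclideanSpace ℝ (Fin n)) H.Glued]

/-- Executions descend to integral curves on the glued space. -/
theorem IsExecution.isMIntegralCurveOn_proj [∀ j, T2Space (M j)] [RegularSpace (Σ j, M j)]
    (hH : H.IsGluable)
    (hat : ∀ e ∈ atlas (EuclideanSpace ℝ (Fin n)) H.Glued, H.IsGluedChart e)
    {T : Set ℝ} {x : ℝ → Σ j, M j} (hx : H.IsExecution T x) :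
    IsMIntegralCurveOn (fun t => H.proj (x t)) H.gluedField T := by
  intro t ht
  by_cases hc : ContinuousWithinAt x T t
  · have h1 := HasMFDerivAt.comp_hasMFDerivWithinAt t
      ((contMDiff_proj hat (x t)).mdifferentiableAt (by simp)).hasMFDerivAt (hx.flow t ht hc)
    rw [hH.gluedField_proj hat]
    exact h1.congr_mfderiv (comp_smulRight_one _ _)
  obtain ⟨p, hp, hlim, hR⟩ := hx.jump t ht hc
  have hpR : H.proj p = H.proj (x t) := by rw [← hR, proj_reset hp]
  have hπ := H.isQuotientMap_proj.continuous
  -- The left limit `p` and the value `x t = R p` are the same point of the quotient, so the jump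
  -- disappears.
  have hγ : ContinuousWithinAt (fun t => H.proj (x t)) T t := by
    have h1 : ContinuousWithinAt (fun t => H.proj (x t)) (T ∩ Ici t) t :=
      hπ.continuousAt.comp_continuousWithinAt (hx.rightContinuous t ht)
    have h2 : ContinuousWithinAt (fun t => H.proj (x t)) (T ∩ Iio t) t := by
      rw [ContinuousWithinAt, ← hpR]
      exact (hπ.tendsto p).comp hlim
    exact (h2.union h1).mono fun s hs => (lt_or_ge s t).imp (fun h => ⟨hs, h⟩) fun h => ⟨hs, h⟩
  set e := chartAt (EuclideanSpace ℝ (Fin n)) (H.proj (x t)) with he_def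
  have he : H.IsGluedChart e := hat _ (chart_mem_atlas _ _)
  have hxe : H.proj (x t) ∈ e.source := mem_chart_source _ _
  have hb := hH.guard_subset hp
  have hpe : H.proj p ∈ e.source := by rw [hpR]; exact hxe
  -- Jumps are isolated and `e` is a flow box, so at all nearby times other than `t` the velocity in
  -- this chart is the unit normal.
  have hy : HasDerivWithinAt (fun s => e (H.proj (x s))) (normalVec n) T t := by
    refine hasDerivWithinAt_of_eventually_hasDerivWithinAt hx.ordConnected ht
      ((e.continuousAt hxe).comp_continuousWithinAt (f := fun s => H.proj (x s)) hγ) ?_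
    have hsrc : ∀ᶠ s in 𝓝[≠] t, s ∈ T → H.proj (x s) ∈ e.source := by
      have := hγ.eventually_mem (e.open_source.mem_nhds hxe)
      exact (eventually_nhdsWithin_iff.1 this).filter_mono nhdsWithin_le_nhds
    filter_upwards [hsrc, hx.eventually_continuousWithinAt hH ht hp hlim hR] with s hs1 hs2 hsT
    have h1 := HasMFDerivAt.comp_hasMFDerivWithinAt s
      (he.mdifferentiableAt (hs1 hsT)).hasMFDerivAt (hx.flow s hsT (hs2 hsT))
    have h2 := h1.congr_mfderiv ((comp_smulRight_one _ _).trans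
      (congrArg ((1 : ℝ →L[ℝ] ℝ).smulRight) (he.mfderiv_eq hb hpe (hs1 hsT))))
    exact hasDerivWithinAt_iff_hasFDerivWithinAt.2 h2.hasFDerivWithinAt
  have hF : H.gluedField (H.proj (x t)) = (normalVec n : EuclideanSpace ℝ (Fin n)) :=
    (hH.gluedField_proj hat (x t)).trans
      ((mfderiv_proj hat (x t) (H.F (x t))).trans (he.mfderiv_eq hb hpe hxe))
  refine ⟨hγ, ?_⟩
  rw [hF]
  simpa only [writtenInExtChartAt, mfld_simps] using! hy.hasFDerivWithinAt

end HybridSystem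

end

/-! ### The smoothing theorem -/

theorem theorem3 {n : ℕ} [NeZero n] {J : Type*} [Finite J] {M : J → Type*}
    [∀ j, TopologicalSpace (M j)] [∀ j, T2Space (M j)] [∀ j, SecondCountableTopology (M j)]
    [∀ j, ConnectedSpace (M j)] [∀ j, ChartedSpace (EuclideanHalfSpace n) (M j)]
    [∀ j, IsManifold (𝓡∂ n) ∞ (M j)] (H : HybridSystem n M)
    (hG_out : ∀ x ∈ H.G, IsOutwardPointing x (H.F x))
    (hR_diffeo : H.IsResetDiffeo)
    (h_boundary : (𝓡∂ n).boundary (Σ j, M j) = H.G ∪ H.R '' H.G)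
    (h_disjoint : Disjoint H.G (H.R '' H.G))
    (hRG_in : ∀ x ∈ H.R '' H.G, IsInwardPointing x (H.F x)) :
    ∃ (_ : ChartedSpace (EuclideanSpace ℝ (Fin n)) H.Glued) (_ : IsManifold (𝓡 n) ∞ H.Glued),
      T2Space H.Glued ∧ SecondCountableTopology H.Glued ∧
      (∀ j, Manifold.IsImmersion (𝓡∂ n) (𝓡 n) ∞ (fun x : M j => H.proj ⟨j, x⟩)) ∧
      (∀ j, (∀ x : M j, (⟨j, x⟩ : Σ j, M j) ∈ H.G → (H.R ⟨j, x⟩).1 ≠ j) →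
        Manifold.IsSmoothEmbedding (𝓡∂ n) (𝓡 n) ∞ (fun x : M j => H.proj ⟨j, x⟩)) ∧
      ∃ F' : (y : H.Glued) → TangentSpace (𝓡 n) y,
        ContMDiff (𝓡 n) (𝓡 n).tangent ∞
          (fun y => (⟨y, F' y⟩ : TangentBundle (𝓡 n) H.Glued)) ∧
        ∀ (T : Set ℝ) (x : ℝ → Σ j, M j), H.IsExecution T x →
          IsMIntegralCurveOn (fun t => H.proj (x t)) F' T := by
  have hH : H.IsGluable := ⟨hG_out, hR_diffeo, h_boundary, h_disjoint, hRG_in⟩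
  let _ : ChartedSpace (EuclideanSpace ℝ (Fin n)) H.Glued := hH.chartedSpace
  have hat : ∀ e ∈ atlas (EuclideanSpace ℝ (Fin n)) H.Glued, H.IsGluedChart e := fun _ he => he
  have hman : IsManifold (𝓡 n) ∞ H.Glued := HybridSystem.isManifold_glued hat
  have : LocallyCompactSpace (EuclideanHalfSpace n) := (𝓡∂ n).locallyCompactSpace
  have : LocallyCompactSpace (Σ j, M j) :=
    ChartedSpace.locallyCompactSpace (EuclideanHalfSpace n) _
  have : SigmaCompactSpace H.Glued := H.sigmaCompactSpace_glued
  refine ⟨inferInstance, hman, hH.t2Space_glued,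
    ChartedSpace.secondCountable_of_sigmaCompact (EuclideanSpace ℝ (Fin n)) _,
    HybridSystem.isImmersion_proj hat,
    fun j hj => ⟨HybridSystem.isImmersion_proj hat j, hH.isEmbedding_proj hj⟩,
    H.gluedField, hH.contMDiff_gluedField hat, fun T x hx => hx.isMIntegralCurveOn_proj hH hat⟩
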